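/- **Notation.** Let $f(z)=z+z^2$. For a map $g$ of germs at $0^+$ put $g^{\log}(\zeta)=-\ln g(e^{-\zeta})$; put $A(h)=\ln\circ h\circ\exp$, $m_\alpha(\zeta)=\alpha\zeta$, $\mathbb C_a^+=\{\operatorname{Re}\zeta\ge a\}$. All identities between real functions are between germs at $+\infty$. Let $$B=m_2^{-1}\circ A(f^{\log})\circ m_2,\qquad g=A(f^{\log})-\mathrm{id},\qquad R=A(f^{\log})\circ B,\qquad D=g\circ B-g .$$ *Polycycles.* A simple alternant polycycle of a real analytic vector field on a real analytic surface is a cyclic sequence of distinct equilibria, consecutive ones joined by an orbit, such that near each equilibrium the field is, for some $k\ge1$, real analytically orbitally equivalent, in forward or backward time, to $\dot x=x^{k+1},\ \dot y=-y$ at the origin, the polycycle passing there along the half axes $\{x=0,y>0\}$ (hyperbolic side) and $\{y=0,x>0\}$ (center side), and such that passages from the hyperbolic to the center side (forward time) and from the center to the hyperbolic side (backward time) alternate. *Classes.* $FC^0$ is the set of functions $\phi$ analytic on some $\mathbb C_a^+$, $a\ge0$, with $\phi(\zeta)-\sum_{q<N}b_qe^{-c_q\zeta}=O(e^{-c_N\operatorname{Re}\zeta})$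 there for every $N$, with $b_q,c_q$ real and $0<c_0<c_1<\dots\to\infty$; $\mathcal H=\mathrm{id}+FC^0$. $E^1$ is the set of functions $\mathbf e$ analytic on some $\mathbb C_a^+$ with, in the same sense, an asymptotic series $\nu(\mathbf e)e^{\zeta}+\sum_q b_qe^{(1-c_q)\zeta}$ there, $\nu(\mathbf e)\in\mathbb R$. $K_{1,0}$ is the set of finite sums of functions $e^{\lambda\zeta}\phi$, $\lambda>0$, $\phi\in FC^0$. Fix a set $Z$ with $\mathbb R\subseteq Z\subseteq\mathbb C$ on which asymptotics are tested ($Z=\mathbb C$: on the complex domains $\ln\mathbb C_b^+$; $Z=\mathbb R$: on the real axis only). A STAR-series of $\psi\circ\exp$ is a series $\sum_q k_qe^{\mathbf e_q}$ with $\mathbf e_q\in E^1$, $\nu(\mathbf e_q)$ non-increasing with limit $-\infty$, such that for every $\lambda>0$ all sufficiently long initial segments differ from $\psi\circ\exp$ by at most $e^{-\lambda\operatorname{Re}e^\zeta}$ on $Z\cap\ln\mathbb C_b^+$ for some $b>0$ (depending on the segment). $FC^{1,p}$ is the set of $\psi$ analytic on some $\mathbb C_a^+$ and exponentially decreasing ($|\psi(e^\zeta)|\le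 e^{-\lambda\operatorname{Re}e^\zeta}$ on $Z\cap\ln\mathbb C_b^+$ for some $\lambda,b>0$) such that $\psi\circ\exp$ has a STAR-series with all $k_q\in K_{1,p}$. $K_{1,p+1}$ is the set of sums $\phi+\sum_{q=1}^n\psi_q\circ\exp\circ m_{\alpha_q}$ with $\phi\in K_{1,0}$, $\psi_q\in FC^{1,p}$, $0<\alpha_q<1$. (Elements of the $K_{1,p}$ are considered on $\ln\mathbb C_b^+$ for $b$ large.) A real germ at $+\infty$ belongs to one of these classes if it agrees for large real arguments with an element of the class. **Statement.** 1. There are a real analytic surface (Hausdorff, second countable), a real analytic vector field on it, a simple alternant polycycle with $4$ equilibria $E_1,\dots,E_4$, and transverse real analytic sections $\Sigma_{i,1}$ (entry) and $\Sigma_{i,2}$ (exit) at $E_i$, such that in suitable parameters $z>0$ the transit maps are, in order from $\Sigma_{4,2}$, $$\Sigma_{4,2}\xrightarrow{\ z\ }\Sigma_{1,1}\xrightarrow{\ e^{-1/z^2}\ }\Sigma_{1,2}\xrightarrow{\ z+z^2\ }\Sigma_{2,1}\xrightarrow{\ (-1/\ln z)^{1/2}\ }\Sigma_{2,2}\xrightarrow{\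 z\ }\Sigma_{3,1}\xrightarrow{\ e^{-1/z}\ }\Sigma_{3,2}\xrightarrow{\ z+z^2\ }\Sigma_{4,1}\xrightarrow{\ -1/\ln z\ }\Sigma_{4,2},$$ and the first return map $\Delta$ of $\Sigma_{4,2}$ along the polycycle satisfies $\Delta^{\log}=R=A(f^{\log})\circ(m_2^{-1}\circ A(f^{\log})\circ m_2)$ near $+\infty$. 2. $R$ is not the identity germ. 3. For every $Z$ as above: (a) $D\in FC^{1,1}\circ\exp\circ m_2$ and $D\notin FC^{1,0}\circ\exp\circ m_2$. (b) Let $F$ be any class of real germs at $+\infty$ with the properties by which the return map is expanded: $A\mathcal H\subseteq\mathrm{id}+F\circ\exp$; $a^{-1}\circ(\mathrm{id}+F\circ\exp\circ m_{\alpha'})\circ a\subseteq\mathrm{id}+F\circ\exp\circ m_{\alpha'}\circ m_\alpha$ for $a(\zeta)=\alpha\zeta+\beta$, $\alpha,\alpha'>0$, $\beta\in\mathbb R$; and $u\circ(\mathrm{id}+F\circ\exp\circ m_{\alpha_1})\subseteq u+F\circ\exp\circ m_{\alpha_1}$ for $u\in F\circ\exp\circ m_{\alpha_2}$, $\alpha_1>\alpha_2>0$.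 Then there is $\psi\in F$ with $D=\psi\circ\exp\circ m_2$, and $\psi\in FC^{1,1}\setminus FC^{1,0}$. In particular $F\not\subseteq FC^{1,0}$. (c) If $D=\psi\circ\exp\circ m_2$ for large real arguments, then every STAR-series of $\psi\circ\exp$, whatever its coefficients, has a coefficient outside $K_{1,0}$. (d) Let $p\ge0$, $k_1,k_2\in K_{1,p}$ and $\mathbf e_1,\mathbf e_2\in E^1$. The divide and differentiate step, i.e. that where $k_1\ne0$ in some $\ln\mathbb C_b^+$ $$\frac{d}{d\zeta}\Big(\frac{k_2}{k_1}e^{\mathbf e_2-\mathbf e_1}\Big)=\frac{k}{k_1^2}\,e^{\mathbf e_2-\mathbf e_1}\quad\text{for some }k\in K_{1,p},$$ is possible if and only if $k_2'k_1-k_1'k_2+k_2k_1(\mathbf e_2'-\mathbf e_1')\in K_{1,p}$. In particular, for $p=1$, the level that (a)-(c) force, and $\mathbf e_1=\mathbf e_2$, it is possible if and only if $k_2'k_1-k_1'k_2\in K_{1,1}$. -/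

import Mathlib

open scoped Manifold ContDiff Topology
open Filter Set

/-! ### Simple alternant polycycles on real analytic surfaces -/

/-- The planar vector field `ẋ = x ^ (k + 1)`, `ẏ = -y`. -/
def normalField (k : ℕ) (p : ℝ × ℝ) : ℝ × ℝ := (p.1 ^ (k + 1), -p.2)

/-- The half axis `x = 0`, `y > 0`, the hyperbolic separatrix of `normalField k`. -/
def hyperbolicAxis : Set (ℝ × ℝ) := {p | p.1 = 0 ∧ 0 < p.2}

/-- The half axis `y = 0`, `x > 0`, the center separatrix of `normalField k`. -/
def centerAxis : Set (ℝ × ℝ) := {p | 0 < p.1 ∧ p.2 = 0}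

/-- The vector field `V` on the real analytic surface `M` is real analytic. -/
def IsAnalyticField {M : Type*} [TopologicalSpace M] [ChartedSpace (ℝ × ℝ) M]
    [IsManifold 𝓘(ℝ, ℝ × ℝ) ω M] (V : (x : M) → TangentSpace 𝓘(ℝ, ℝ × ℝ) x) : Prop :=
  ContMDiff 𝓘(ℝ, ℝ × ℝ) 𝓘(ℝ, ℝ × ℝ).tangent ω
    (fun x => (⟨x, V x⟩ : TangentBundle 𝓘(ℝ, ℝ × ℝ) M))

/-- A simple alternant polycycle with `N` equilibria of the vector field `V`. The equilibria are
listed cyclically in forward time, and `connection i` is the orbit from the equilibrium `i` to the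
equilibrium `i + 1` (indices modulo `N`). `fromHyperbolic i` says that the equilibrium `i` is
traversed from the hyperbolic side to the center side. -/
structure SimpleAlternantPolycycle {M : Type*} [TopologicalSpace M] [ChartedSpace (ℝ × ℝ) M]
    (V : (x : M) → TangentSpace 𝓘(ℝ, ℝ × ℝ) x) (N : ℕ) [NeZero N] where
  equilibrium : Fin N → M
  equilibrium_injective : Function.Injective equilibrium
  exponent : Fin N → ℕ
  one_le_exponent : ∀ i, 1 ≤ exponent i
  fromHyperbolic : Fin N → Prop
  /-- Real analytic coordinates near each equilibrium. -/
  chart : Fin N → OpenPartialHomeomorph M (ℝ × ℝ)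
  chart_mem : ∀ i, chart i ∈ IsManifold.maximalAtlas 𝓘(ℝ, ℝ × ℝ) ω M
  mem_source : ∀ i, equilibrium i ∈ (chart i).source
  chart_equilibrium : ∀ i, chart i (equilibrium i) = 0
  /-- Orbital equivalence: in the coordinates, `V` is an analytic function `factor i`, without
  zeros, times the normal form. The factor is positive (forward time) where the passage is from
  hyperbolic to center and negative (backward time) where it is from center to hyperbolic. -/
  factor : Fin N → ℝ × ℝ → ℝ
  factor_analytic : ∀ i, AnalyticOnNhd ℝ (factor i) (chart i).target
  factor_pos : ∀ i, fromHyperbolic i → ∀ p ∈ (chart i).target, 0 < factor i p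
  factor_neg : ∀ i, ¬ fromHyperbolic i → ∀ p ∈ (chart i).target, factor i p < 0
  mfderiv_chart : ∀ i, ∀ x ∈ (chart i).source,
    (mfderiv 𝓘(ℝ, ℝ × ℝ) 𝓘(ℝ, ℝ × ℝ) (chart i) x (V x) : ℝ × ℝ) =
      factor i (chart i x) • normalField (exponent i) (chart i x)
  connection : Fin N → ℝ → M
  connection_integral : ∀ i, IsMIntegralCurve (connection i) V
  connection_atBot : ∀ i, Tendsto (connection i) atBot (𝓝 (equilibrium i))
  connection_atTop : ∀ i, Tendsto (connection i) atTop (𝓝 (equilibrium (i + 1)))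
  leaves_center : ∀ i, fromHyperbolic i →
    ∀ᶠ t in atBot, chart i (connection i t) ∈ centerAxis
  leaves_hyperbolic : ∀ i, ¬ fromHyperbolic i →
    ∀ᶠ t in atBot, chart i (connection i t) ∈ hyperbolicAxis
  arrives_hyperbolic : ∀ i, fromHyperbolic (i + 1) →
    ∀ᶠ t in atTop, chart (i + 1) (connection i t) ∈ hyperbolicAxis
  arrives_center : ∀ i, ¬ fromHyperbolic (i + 1) →
    ∀ᶠ t in atTop, chart (i + 1) (connection i t) ∈ centerAxis
  alternates : ∀ i, fromHyperbolic (i + 1) ↔ ¬ fromHyperbolic i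

/-- The polycycle as a subset of the surface. -/
def SimpleAlternantPolycycle.carrier {M : Type*} [TopologicalSpace M] [ChartedSpace (ℝ × ℝ) M]
    {V : (x : M) → TangentSpace 𝓘(ℝ, ℝ × ℝ) x} {N : ℕ} [NeZero N]
    (P : SimpleAlternantPolycycle V N) : Set M :=
  range P.equilibrium ∪ ⋃ i, range (P.connection i)

/-- `σ` parametrizes, near the parameter `0`, a real analytic section transverse to `V` that meets
the orbit parametrized by `γ` at the parameter `0`, lies in the coordinate domain of `φ`, and on
which small positive parameters give points of the open positive quadrant. -/
def IsSection {M : Type*} [TopologicalSpace M] [ChartedSpace (ℝ × ℝ) M]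
    (V : (x : M) → TangentSpace 𝓘(ℝ, ℝ × ℝ) x) (φ : OpenPartialHomeomorph M (ℝ × ℝ))
    (γ σ : ℝ → M) : Prop :=
  ContMDiffAt 𝓘(ℝ, ℝ) 𝓘(ℝ, ℝ × ℝ) ω σ 0 ∧
  LinearIndependent ℝ ![mfderiv 𝓘(ℝ, ℝ) 𝓘(ℝ, ℝ × ℝ) σ 0 (1 : ℝ), V (σ 0)] ∧
  σ 0 ∈ range γ ∧
  σ 0 ∈ φ.source ∧
  ∀ᶠ z in 𝓝[>] (0 : ℝ), 0 < (φ (σ z)).1 ∧ 0 < (φ (σ z)).2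

/-- `T` is the germ at `0⁺` of the transit map of the flow of `V` from the section `σ` to the
section `τ` along the set `S`: the orbit starting at `σ z` next hits the section `τ` at `τ (T z)`,
and up to that time it stays in any prescribed neighbourhood of `S` once `z > 0` is small enough.
For `τ = σ` this is the first return map. -/
def IsTransitMap {M : Type*} [TopologicalSpace M] [ChartedSpace (ℝ × ℝ) M]
    (V : (x : M) → TangentSpace 𝓘(ℝ, ℝ × ℝ) x) (S : Set M) (σ τ : ℝ → M) (T : ℝ → ℝ) : Prop :=
  ∃ ε > 0, InjOn τ (Ico 0 ε) ∧
    ∀ U ∈ 𝓝ˢ S, ∀ᶠ z in 𝓝[>] (0 : ℝ), T z ∈ Ioo 0 ε ∧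
      ∃ s > 0, ∃ γ : ℝ → M, IsMIntegralCurveOn γ V (Icc 0 s) ∧
        γ 0 = σ z ∧ γ s = τ (T z) ∧
        (∀ t ∈ Ioo 0 s, γ t ∉ τ '' Ioo 0 ε) ∧
        ∀ t ∈ Icc 0 s, γ t ∈ U

/-! ### The logarithmic chart and the maps of the example -/

/-- The map `g` in the logarithmic chart `ζ = -ln z`. -/
noncomputable def logChart (g : ℝ → ℝ) (ζ : ℝ) : ℝ := -Real.log (g (Real.exp (-ζ)))

/-- Conjugation by `exp`: `A h = ln ∘ h ∘ exp`. -/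
noncomputable def conjExp (h : ℝ → ℝ) (ζ : ℝ) : ℝ := Real.log (h (Real.exp ζ))

/-- `f z = z + z ^ 2`. -/
def gluingMap (z : ℝ) : ℝ := z + z ^ 2

/-- Multiplication by `α`. -/
def mulMap (α : ℝ) (ζ : ℝ) : ℝ := α * ζ

/-- `A (f^log)`. -/
noncomputable def innerMap : ℝ → ℝ := conjExp (logChart gluingMap)

/-- `m₂⁻¹ ∘ A (f^log) ∘ m₂`. -/
noncomputable def conjugatedMap : ℝ → ℝ := mulMap 2⁻¹ ∘ innerMap ∘ mulMap 2

/-- `A (f^log) ∘ (m₂⁻¹ ∘ A (f^log) ∘ m₂)`. -/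
noncomputable def logReturnMap : ℝ → ℝ := innerMap ∘ conjugatedMap

/-- `(A (f^log) - id) ∘ (m₂⁻¹ ∘ A (f^log) ∘ m₂) - (A (f^log) - id)`. -/
noncomputable def expansionTerm (ζ : ℝ) : ℝ :=
  (innerMap (conjugatedMap ζ) - conjugatedMap ζ) - (innerMap ζ - ζ)

/-! ### Functional cochains -/

/-- The closed half plane `Re ζ ≥ a`. -/
def halfPlane (a : ℝ) : Set ℂ := {ζ | a ≤ ζ.re}

/-- The image of the half plane `Re ζ ≥ b` (with `b > 0`) under the principal logarithm. -/
noncomputable def lnHalfPlane (b : ℝ) : Set ℂ := Complex.log '' halfPlane b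

/-- `FC⁰`: the functions analytic on some half plane with a Dulac series `∑ b_q e^(-c_q ζ)` there,
`b_q` and `c_q` real, `c_q > 0` strictly increasing to `+∞`. -/
def FC0 : Set (ℂ → ℂ) :=
  {φ | ∃ a ≥ (0 : ℝ), AnalyticOnNhd ℂ φ (halfPlane a) ∧
    ∃ b c : ℕ → ℝ, 0 < c 0 ∧ StrictMono c ∧ Tendsto c atTop atTop ∧
      ∀ N, ∃ C : ℝ, ∀ ζ ∈ halfPlane a,
        ‖φ ζ - ∑ q ∈ Finset.range N, (b q : ℂ) * Complex.exp (-(c q : ℂ) * ζ)‖ ≤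
          C * Real.exp (-c N * ζ.re)}

/-- The class `𝓗 = id + FC⁰`. -/
def classH : Set (ℂ → ℂ) := {f | (fun ζ => f ζ - ζ) ∈ FC0}

/-- `e` belongs to the set of exponents `E¹` and `ν` is its principal exponent:
`e` is asymptotic to `ν e^ζ + ∑ b_q e^((1 - c_q) ζ)` on some half plane. -/
def IsExponent (e : ℂ → ℂ) (ν : ℝ) : Prop :=
  ∃ a : ℝ, AnalyticOnNhd ℂ e (halfPlane a) ∧
    ∃ b c : ℕ → ℝ, 0 < c 0 ∧ StrictMono c ∧ Tendsto c atTop atTop ∧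
      ∀ N, ∃ C : ℝ, ∀ ζ ∈ halfPlane a,
        ‖e ζ - (ν : ℂ) * Complex.exp ζ -
            ∑ q ∈ Finset.range N, (b q : ℂ) * Complex.exp ((1 - (c q : ℂ)) * ζ)‖ ≤
          C * Real.exp ((1 - c N) * ζ.re)

/-- `K_{1,0}`: finite sums of elements of `FC⁰` multiplied by exponentials `e^(λ ζ)`, `λ > 0`. As
for all classes of coefficients, equality is required near infinity in the domains `ln (ℂ_b⁺)`. -/
def K10 : Set (ℂ → ℂ) :=
  {k | ∃ (n : ℕ) (l : Fin n → ℝ) (φ : Fin n → ℂ → ℂ), (∀ i, 0 < l i ∧ φ i ∈ FC0) ∧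
    ∃ b > 0, ∀ ζ ∈ lnHalfPlane b, k ζ = ∑ i, Complex.exp ((l i : ℂ) * ζ) * φ i ζ}

/-- `∑ k_q e^(e_q)` is a STAR-series for `ψ ∘ exp` with principal exponents `ν_q`: the `ν_q` are
non-increasing with limit `-∞`, and for every `l`, all sufficiently long initial segments
approximate `ψ ∘ exp` up to `e^(-l Re e^ζ)` on some `ln (ℂ_b⁺)`. The approximation is asked for at
the points of `Z`; `Z = univ` gives all of `ln (ℂ_b⁺)`, `Z = ℝ` gives the real axis only. -/
def HasStarSeries (Z : Set ℂ) (ψ : ℂ → ℂ) (k e : ℕ → ℂ → ℂ) (ν : ℕ → ℝ) : Prop :=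
  (∀ q, IsExponent (e q) (ν q)) ∧ Antitone ν ∧ Tendsto ν atTop atBot ∧
  ∀ l > (0 : ℝ), ∃ N₀, ∀ N ≥ N₀, ∃ b > 0, ∀ ζ ∈ lnHalfPlane b ∩ Z,
    ‖ψ (Complex.exp ζ) - ∑ q ∈ Finset.range N, k q ζ * Complex.exp (e q ζ)‖ ≤
      Real.exp (-l * (Complex.exp ζ).re)

/-- The functions `ψ`, analytic on some half plane and exponentially decreasing, such that
`ψ ∘ exp` has a STAR-series with coefficients in `K`. -/
def starClass (Z : Set ℂ) (K : Set (ℂ → ℂ)) : Set (ℂ → ℂ) :=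
  {ψ | (∃ a : ℝ, AnalyticOnNhd ℂ ψ (halfPlane a)) ∧
    (∃ l > (0 : ℝ), ∃ b > 0, ∀ ζ ∈ lnHalfPlane b ∩ Z,
      ‖ψ (Complex.exp ζ)‖ ≤ Real.exp (-l * (Complex.exp ζ).re)) ∧
    ∃ (k e : ℕ → ℂ → ℂ) (ν : ℕ → ℝ), (∀ q, k q ∈ K) ∧ HasStarSeries Z ψ k e ν}

/-- The classes of coefficients `K_{1,p}`. An element of `K_{1,p+1}` is a sum
`φ + ∑ ψ_q ∘ exp ∘ m_{α_q}` with `φ ∈ K_{1,0}`, `ψ_q ∈ FC^{1,p}` and `0 < α_q < 1`. -/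
def K1 (Z : Set ℂ) : ℕ → Set (ℂ → ℂ)
  | 0 => K10
  | p + 1 => {k | ∃ φ ∈ K10, ∃ (n : ℕ) (ψ : Fin n → ℂ → ℂ) (α : Fin n → ℝ),
      (∀ i, ψ i ∈ starClass Z (K1 Z p) ∧ 0 < α i ∧ α i < 1) ∧
      ∃ b > 0, ∀ ζ ∈ lnHalfPlane b, k ζ = φ ζ + ∑ i, ψ i (Complex.exp ((α i : ℂ) * ζ))}

/-- `FC^{1,p}`. -/
def FC1 (Z : Set ℂ) (p : ℕ) : Set (ℂ → ℂ) := starClass Z (K1 Z p)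

/-! ### Germs at `+∞` and the expansion framework -/

/-- The real functions that agree near `+∞` with an element of `S`. -/
def realGerms (S : Set (ℂ → ℂ)) : Set (ℝ → ℝ) :=
  {r | ∃ ψ ∈ S, ∀ᶠ x : ℝ in atTop, (r x : ℂ) = ψ x}

/-- `F ∘ exp ∘ m_α`, as germs at `+∞`. -/
def compExp (F : Set (ℝ → ℝ)) (α : ℝ) : Set (ℝ → ℝ) :=
  {g | ∃ ψ ∈ F, ∀ᶠ ζ in atTop, g ζ = ψ (Real.exp (α * ζ))}

/-- `id + F ∘ exp ∘ m_α`, as germs at `+∞`. -/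
def idAddCompExp (F : Set (ℝ → ℝ)) (α : ℝ) : Set (ℝ → ℝ) :=
  {f | (fun ζ => f ζ - ζ) ∈ compExp F α}

/-- The properties of a class `F` in the role of `FC¹` that the expansion of the return map uses:
`F` accounts for `A 𝓗`, conjugation by affine maps rescales `id + F ∘ exp ∘ m_α`, and compositions
with smaller perturbations of the identity expand into sums. -/
structure ExpansionFramework (F : Set (ℝ → ℝ)) : Prop where
  conjExp_mem : ∀ h ∈ realGerms classH, conjExp h ∈ idAddCompExp F 1
  affine_conj : ∀ α > 0, ∀ β : ℝ, ∀ α' > 0, ∀ f ∈ idAddCompExp F α',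
    (fun ζ => (f (α * ζ + β) - β) / α) ∈ idAddCompExp F (α' * α)
  expand : ∀ α₁ α₂ : ℝ, 0 < α₂ → α₂ < α₁ → ∀ g ∈ compExp F α₂, ∀ f ∈ idAddCompExp F α₁,
    (fun ζ => g (f ζ) - g ζ) ∈ compExp F α₁

/-- The divide and differentiate step of the ordering argument, for coefficients in `K_{1,p}`:
the derivative of the quotient of `k₂ e^(e₂)` by `k₁ e^(e₁)` is again of the form
`(k / k₁²) e^(e₂ - e₁)` with `k` in `K_{1,p}`. -/
def DivideDifferentiate (Z : Set ℂ) (p : ℕ) (k₁ e₁ k₂ e₂ : ℂ → ℂ) : Prop :=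
  ∃ k ∈ K1 Z p, ∃ b > 0, ∀ ζ ∈ lnHalfPlane b, k₁ ζ ≠ 0 →
    HasDerivAt (fun w => k₂ w / k₁ w * Complex.exp (e₂ w - e₁ w))
      (k ζ / k₁ ζ ^ 2 * Complex.exp (e₂ ζ - e₁ ζ)) ζ

/-! The polycycle is made of explicit solutions. For `ẋ = x^(k+1)`, `ẏ = -y` the time left before
`x` blows up is `T = 1/(k x^k)`, so `w = y e^(-T)` is a first integral. Another one is `z`, with
`1/(k x^k) = z^(-k) + log y`, which for `x > 0` is related to the former by `w = e^(-z^(-k))`. With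
`z` as parameter on the hyperbolic side and `w` on the center side the passage is therefore exactly
`e^(-1/z^k)`, or its inverse in backward time. Four such boxes, with `k = 2, 2, 1, 1` and
alternating time directions, are glued along flow boxes in which the field is `∂/∂τ`. The parameters
are identified there by `z` or by `z + z²`, so that all transit maps are the prescribed formulas and
their composition, in the logarithmic chart, is `R`. Since `f^log` lies strictly below the identity,
so do both factors of `R`, and `R` is not the identity.

Put `ell X = log (1 + e^(-X))`, so that `f^log X = X - ell X`, and `G X = log (1 - ell √X / √X)`.
For `X = e^(2ζ)` one has `g ζ = G X` and `g (B ζ) = G (X - ell X)`. Hence `D` is `shiftTerm X = G (X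
- ell X) - G X`, and Taylor's formula gives `∑ G⁽ⁿ⁾(X) (-ell X)ⁿ / n!` over `n ≥ 1`. The coefficient
of `e^(-jX)` is a finite sum of polynomials in `1/X` times derivatives of `G`, and these expand in
powers of `e^(-√X)` with polynomials in `1/√X` as coefficients. As functions of `log X` the
coefficients belong to `FC^{1,0} ∘ exp ∘ m_{1/2}`, hence to `K_{1,1}` (`shiftTerm_approx`,
`shiftTerm_mem_FC1`).

Coefficients from `K_{1,0}` do not suffice. The leading part `-G'(X) e^(-X)` contains a non-trivial
term of order `e^(-X - m√X)` for every `m ≥ 1` (`coeff_gamSeries_one_ne_zero`), whereas a truncation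
of a STAR-series has finitely many exponents. Some `m₀` thus has an exponent at unbounded distance
from all of them (`exists_inequivalent`). Elements of `K_{1,0}` and of `E¹` have expansions in real
exponentials on half planes, and by Phragmén–Lindelöf such a function is zero or has a non-zero
leading exponential (`TameOn.dichotomy`). Terms with exponents at bounded distance can be merged,
and the remaining exponents are totally ordered by domination, so a finite sum cannot be much
smaller than a non-trivial term with an isolated exponent (`false_of_isolated`). The contradiction
takes place on the real axis, so it holds for every `Z`.

The germ `ψ` in `D = ψ ∘ exp ∘ m₂` is determined by `D`, whatever class it is taken from; this gives
the statement on expansion frameworks. The criterion for the divide and differentiate step is the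
quotient rule together with the identity theorem. -/

/-! ### Gluing plane domains to an analytic surface with a vector field -/

/-- Open subsets `dom i` of the plane with analytic vector fields, glued along open sets
`overlap i j` by analytic maps `trans i j` that respect the fields. -/
structure ChartGluing (ι : Type) where
  dom : ι → Set (ℝ × ℝ)
  overlap : ι → ι → Set (ℝ × ℝ)
  trans : ι → ι → ℝ × ℝ → ℝ × ℝ
  field : ι → ℝ × ℝ → ℝ × ℝ
  isOpen_dom : ∀ i, IsOpen (dom i)
  dom_nonempty : ∀ i, (dom i).Nonempty
  isOpen_overlap : ∀ i j, IsOpen (overlap i j)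
  overlap_subset : ∀ i j, overlap i j ⊆ dom i
  overlap_self : ∀ i, overlap i i = dom i
  trans_self : ∀ i, ∀ p ∈ dom i, trans i i p = p
  trans_mem : ∀ i j, ∀ p ∈ overlap i j, trans i j p ∈ overlap j i
  trans_trans_symm : ∀ i j, ∀ p ∈ overlap i j, trans j i (trans i j p) = p
  mem_overlap_of_mem : ∀ i j k, ∀ p ∈ overlap i j, trans i j p ∈ overlap j k → p ∈ overlap i k
  trans_trans : ∀ i j k, ∀ p ∈ overlap i j, trans i j p ∈ overlap j k →
    trans j k (trans i j p) = trans i k p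
  contDiffOn_trans : ∀ i j, ContDiffOn ℝ ω (trans i j) (overlap i j)
  isClosed_graph : ∀ i j,
    IsClosed {r : dom i × dom j | (r.1 : ℝ × ℝ) ∈ overlap i j ∧ trans i j r.1 = r.2}
  contDiffOn_field : ∀ i, ContDiffOn ℝ ω (field i) (dom i)
  fderiv_trans : ∀ i j, ∀ p ∈ overlap i j,
    fderiv ℝ (trans i j) p (field i p) = field j (trans i j p)

namespace ChartGluing

variable {ι : Type} (G : ChartGluing ι)

/-- Two points of the disjoint union are identified when a transition map relates them. -/
def setoid : Setoid (Σ i, G.dom i) where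
  r a b := (a.2 : ℝ × ℝ) ∈ G.overlap a.1 b.1 ∧ G.trans a.1 b.1 a.2 = b.2
  iseqv :=
    { refl := fun a => ⟨by rw [G.overlap_self]; exact a.2.2, G.trans_self _ _ a.2.2⟩
      symm := by
        rintro a b ⟨h1, h2⟩
        have h3 := G.trans_mem _ _ _ h1
        have h4 := G.trans_trans_symm _ _ _ h1
        rw [h2] at h3 h4
        exact ⟨h3, h4⟩
      trans := by
        rintro a b c ⟨h1, h2⟩ ⟨h3, h4⟩
        rw [← h2] at h3 h4
        exact ⟨G.mem_overlap_of_mem _ _ _ _ h1 h3, by rw [← h4, G.trans_trans _ _ _ _ h1 h3]⟩ }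

/-- The surface obtained by gluing. -/
def Space : Type := Quotient G.setoid

instance : TopologicalSpace G.Space := inferInstanceAs (TopologicalSpace (Quotient G.setoid))

/-- The projection of the disjoint union onto the surface. -/
def proj : (Σ i, G.dom i) → G.Space := Quotient.mk G.setoid

theorem proj_eq_iff {a b : Σ i, G.dom i} :
    G.proj a = G.proj b ↔ (a.2 : ℝ × ℝ) ∈ G.overlap a.1 b.1 ∧ G.trans a.1 b.1 a.2 = b.2 :=
  Quotient.eq (r := G.setoid)

theorem proj_surjective : Function.Surjective G.proj := Quotient.mk_surjective

theorem continuous_proj : Continuous G.proj := continuous_quotient_mk'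

theorem isOpen_proj_image_iff {s : Set G.Space} : IsOpen s ↔ IsOpen (G.proj ⁻¹' s) := Iff.rfl

/-- Seen in another sheet, the saturation of an open set is its preimage under a transition map,
which is continuous on the open overlap. -/
theorem isOpenMap_proj_mk (i : ι) : IsOpenMap fun p : G.dom i => G.proj ⟨i, p⟩ := by
  intro W hW
  rw [isOpen_proj_image_iff, isOpen_sigma_iff]
  intro j
  obtain ⟨W', hW', rfl⟩ := isOpen_induced_iff.1 hW
  have : Sigma.mk j ⁻¹' (G.proj ⁻¹' ((fun p : G.dom i => G.proj ⟨i, p⟩) '' (Subtype.val ⁻¹' W'))) =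
      Subtype.val ⁻¹' (G.overlap j i ∩ G.trans j i ⁻¹' W') := by
    ext q
    simp only [mem_preimage, mem_image, mem_inter_iff]
    constructor
    · rintro ⟨p, hp, h⟩
      obtain ⟨h1, h2⟩ := G.proj_eq_iff.1 h.symm
      exact ⟨h1, by simpa only [h2] using hp⟩
    · rintro ⟨h1, h2⟩
      refine ⟨⟨G.trans j i q, G.overlap_subset _ _ (G.trans_mem _ _ _ h1)⟩, h2, ?_⟩
      exact (G.proj_eq_iff.2 ⟨h1, rfl⟩).symm
  rw [this]
  exact ((G.contDiffOn_trans j i).continuousOn.isOpen_inter_preimage (G.isOpen_overlap j i)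
    hW').preimage continuous_subtype_val

theorem isOpenQuotientMap_proj : IsOpenQuotientMap G.proj :=
  ⟨G.proj_surjective, G.continuous_proj, isOpenMap_sigma.2 G.isOpenMap_proj_mk⟩

/-- The quotient by an open map is Hausdorff when the relation is closed, and this is
`isClosed_graph` on each pair of sheets. -/
instance : T2Space G.Space := by
  rw [t2Space_iff_of_isOpenQuotientMap G.isOpenQuotientMap_proj]
  rw [← isOpen_compl_iff, isOpen_iff_mem_nhds]
  rintro ⟨⟨i, p⟩, ⟨j, q⟩⟩ h
  rw [nhds_prod_eq, Sigma.nhds_mk, Sigma.nhds_mk, Filter.prod_map_map_eq, ← nhds_prod_eq, mem_map]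
  refine mem_of_superset ((G.isClosed_graph i j).isOpen_compl.mem_nhds
    (x := (p, q)) fun h' => h (G.proj_eq_iff.2 h')) ?_
  intro r hr h'
  exact hr (G.proj_eq_iff.1 h')

theorem isOpenEmbedding_proj_mk (i : ι) :
    Topology.IsOpenEmbedding fun p : G.dom i => G.proj ⟨i, p⟩ := by
  refine .of_continuous_injective_isOpenMap (G.continuous_proj.comp continuous_sigmaMk) ?_
    (G.isOpenMap_proj_mk i)
  intro p q h
  have h' := (G.proj_eq_iff.1 h).2
  exact Subtype.ext ((G.trans_self i p p.2).symm.trans h')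

instance (i : ι) : Nonempty (G.dom i) := (G.dom_nonempty i).to_subtype

/-- The chart of the surface with values in `dom i`. -/
noncomputable def chart (i : ι) : OpenPartialHomeomorph G.Space (ℝ × ℝ) :=
  ((G.isOpenEmbedding_proj_mk i).toOpenPartialHomeomorph _).symm.trans
    (TopologicalSpace.Opens.openPartialHomeomorphSubtypeCoe ⟨G.dom i, G.isOpen_dom i⟩
      (G.dom_nonempty i).to_subtype)

/-- The point of the surface with coordinates `p` in the chart `i`. -/
noncomputable def pt (i : ι) (p : ℝ × ℝ) : G.Space := (G.chart i).symm p

theorem chart_target (i : ι) : (G.chart i).target = G.dom i := by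
  ext p
  simp [chart]

theorem pt_eq_proj {i : ι} {p : ℝ × ℝ} (hp : p ∈ G.dom i) : G.pt i p = G.proj ⟨i, p, hp⟩ := by
  have h : (TopologicalSpace.Opens.openPartialHomeomorphSubtypeCoe ⟨G.dom i, G.isOpen_dom i⟩
      (G.dom_nonempty i).to_subtype).symm p = ⟨p, hp⟩ := by
    apply Subtype.ext
    exact OpenPartialHomeomorph.right_inv
      (TopologicalSpace.Opens.openPartialHomeomorphSubtypeCoe ⟨G.dom i, G.isOpen_dom i⟩
        (G.dom_nonempty i).to_subtype) (by simpa using hp)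
  change G.proj ⟨i, (TopologicalSpace.Opens.openPartialHomeomorphSubtypeCoe
    ⟨G.dom i, G.isOpen_dom i⟩ (G.dom_nonempty i).to_subtype).symm p⟩ = _
  rw [h]

theorem pt_mem_source {i : ι} {p : ℝ × ℝ} (hp : p ∈ G.dom i) : G.pt i p ∈ (G.chart i).source :=
  (G.chart i).map_target (by rwa [chart_target])

theorem chart_pt {i : ι} {p : ℝ × ℝ} (hp : p ∈ G.dom i) : G.chart i (G.pt i p) = p :=
  (G.chart i).right_inv (by rwa [chart_target])

theorem chart_mem {i : ι} {x : G.Space} (hx : x ∈ (G.chart i).source) : G.chart i x ∈ G.dom i := by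
  rw [← chart_target]; exact (G.chart i).map_source hx

theorem pt_chart {i : ι} {x : G.Space} (hx : x ∈ (G.chart i).source) : G.pt i (G.chart i x) = x :=
  (G.chart i).left_inv hx

theorem pt_eq_pt_iff {i j : ι} {p q : ℝ × ℝ} (hp : p ∈ G.dom i) (hq : q ∈ G.dom j) :
    G.pt i p = G.pt j q ↔ p ∈ G.overlap i j ∧ G.trans i j p = q := by
  rw [pt_eq_proj _ hp, pt_eq_proj _ hq, proj_eq_iff]

theorem pt_trans {i j : ι} {p : ℝ × ℝ} (hp : p ∈ G.overlap i j) :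
    G.pt j (G.trans i j p) = G.pt i p :=
  ((G.pt_eq_pt_iff (G.overlap_subset _ _ hp)
    (G.overlap_subset _ _ (G.trans_mem _ _ _ hp))).2 ⟨hp, rfl⟩).symm

theorem pt_mem_source_iff {i j : ι} {p : ℝ × ℝ} (hp : p ∈ G.dom i) :
    G.pt i p ∈ (G.chart j).source ↔ p ∈ G.overlap i j := by
  constructor
  · intro h
    exact ((G.pt_eq_pt_iff hp (G.chart_mem h)).1 (G.pt_chart h).symm).1
  · intro h
    rw [← G.pt_trans h]
    exact G.pt_mem_source (G.overlap_subset _ _ (G.trans_mem _ _ _ h))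

theorem chart_pt_of_mem {i j : ι} {p : ℝ × ℝ} (hp : p ∈ G.overlap i j) :
    G.chart j (G.pt i p) = G.trans i j p := by
  rw [← G.pt_trans hp, G.chart_pt (G.overlap_subset _ _ (G.trans_mem _ _ _ hp))]

theorem exists_mem_source (x : G.Space) : ∃ i, x ∈ (G.chart i).source := by
  obtain ⟨⟨i, p⟩, rfl⟩ := G.proj_surjective x
  exact ⟨i, by rw [← G.pt_eq_proj p.2]; exact G.pt_mem_source p.2⟩

/-- The index of the preferred chart at a point. -/
noncomputable def index (x : G.Space) : ι := (G.exists_mem_source x).choose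

theorem mem_source_index (x : G.Space) : x ∈ (G.chart (G.index x)).source :=
  (G.exists_mem_source x).choose_spec

noncomputable instance : ChartedSpace (ℝ × ℝ) G.Space where
  atlas := range G.chart
  chartAt x := G.chart (G.index x)
  mem_chart_source := G.mem_source_index
  chart_mem_atlas _ := mem_range_self _

theorem symm_trans_source (i j : ι) :
    ((G.chart i).symm.trans (G.chart j)).source = G.overlap i j := by
  ext p
  rw [OpenPartialHomeomorph.trans_source, OpenPartialHomeomorph.symm_source, chart_target]
  constructor
  · rintro ⟨h1, h2⟩
    exact (G.pt_mem_source_iff h1).1 h2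
  · intro h
    exact ⟨G.overlap_subset _ _ h, (G.pt_mem_source_iff (G.overlap_subset _ _ h)).2 h⟩

theorem contDiffOn_symm_trans (i j : ι) :
    ContDiffOn ℝ ω ((G.chart i).symm.trans (G.chart j))
      ((G.chart i).symm.trans (G.chart j)).source := by
  rw [symm_trans_source, OpenPartialHomeomorph.coe_trans]
  refine (G.contDiffOn_trans i j).congr ?_
  intro p hp
  rw [← G.chart_pt_of_mem hp]
  rfl

instance : IsManifold 𝓘(ℝ, ℝ × ℝ) ω G.Space := by
  apply isManifold_of_contDiffOn
  intro e e' he he'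
  obtain ⟨i, rfl⟩ : e ∈ range G.chart := he
  obtain ⟨j, rfl⟩ : e' ∈ range G.chart := he'
  have h := G.contDiffOn_symm_trans i j
  simpa only [modelWithCornersSelf_coe, modelWithCornersSelf_coe_symm, Function.id_comp,
    Function.comp_id, preimage_id, range_id, inter_univ] using h

theorem secondCountableTopology [Countable ι] : SecondCountableTopology G.Space := by
  have : SecondCountableTopology (Σ i, G.dom i) := inferInstance
  exact G.isOpenQuotientMap_proj.isQuotientMap.secondCountableTopology
    G.isOpenQuotientMap_proj.isOpenMap

theorem chart_mem_maximalAtlas (i : ι) :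
    G.chart i ∈ IsManifold.maximalAtlas 𝓘(ℝ, ℝ × ℝ) ω G.Space :=
  IsManifold.subset_maximalAtlas ⟨i, rfl⟩

/-- The vector field of the surface. -/
noncomputable def vectorField (x : G.Space) : TangentSpace 𝓘(ℝ, ℝ × ℝ) x :=
  G.field (G.index x) (G.chart (G.index x) x)

/-- The field is defined through one preferred chart at each point; since the transition maps
respect the fields, every other chart shows the same vector. -/
theorem mfderiv_chart (i : ι) {x : G.Space} (hx : x ∈ (G.chart i).source) :
    (mfderiv 𝓘(ℝ, ℝ × ℝ) 𝓘(ℝ, ℝ × ℝ) (G.chart i) x (G.vectorField x) : ℝ × ℝ) =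
      G.field i (G.chart i x) := by
  set j := G.index x with hj
  have hxj : x ∈ (G.chart j).source := G.mem_source_index x
  have hd : MDifferentiableAt 𝓘(ℝ, ℝ × ℝ) 𝓘(ℝ, ℝ × ℝ) (G.chart i) x :=
    ((contMDiffOn_of_mem_maximalAtlas (G.chart_mem_maximalAtlas i)).contMDiffAt
      ((G.chart i).open_source.mem_nhds hx)).mdifferentiableAt (by simp)
  have hov : G.chart j x ∈ G.overlap j i := by
    rw [← G.pt_mem_source_iff (G.chart_mem hxj), G.pt_chart hxj]; exact hx
  have h1 : mfderiv 𝓘(ℝ, ℝ × ℝ) 𝓘(ℝ, ℝ × ℝ) (G.chart i) x =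
      fderiv ℝ (G.trans j i) (G.chart j x) := by
    rw [hd.mfderiv]
    simp only [mfld_simps, fderivWithin_univ]
    apply Filter.EventuallyEq.fderiv_eq
    filter_upwards [(G.isOpen_overlap j i).mem_nhds hov] with p hp
    exact G.chart_pt_of_mem hp
  rw [h1]
  change fderiv ℝ (G.trans j i) (G.chart j x) (G.field j (G.chart j x)) = _
  rw [G.fderiv_trans j i _ hov, ← G.chart_pt_of_mem hov, G.pt_chart hxj]

theorem contMDiffOn_pt (i : ι) : ContMDiffOn 𝓘(ℝ, ℝ × ℝ) 𝓘(ℝ, ℝ × ℝ) ω (G.pt i) (G.dom i) := by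
  have := contMDiffOn_symm_of_mem_maximalAtlas (G.chart_mem_maximalAtlas i)
  rwa [chart_target] at this

theorem contMDiffAt_pt {i : ι} {p : ℝ × ℝ} (hp : p ∈ G.dom i) :
    ContMDiffAt 𝓘(ℝ, ℝ × ℝ) 𝓘(ℝ, ℝ × ℝ) ω (G.pt i) p :=
  (G.contMDiffOn_pt i).contMDiffAt ((G.isOpen_dom i).mem_nhds hp)

theorem contMDiffAt_chart {i : ι} {x : G.Space} (hx : x ∈ (G.chart i).source) :
    ContMDiffAt 𝓘(ℝ, ℝ × ℝ) 𝓘(ℝ, ℝ × ℝ) ω (G.chart i) x :=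
  (contMDiffOn_of_mem_maximalAtlas (G.chart_mem_maximalAtlas i)).contMDiffAt
      ((G.chart i).open_source.mem_nhds hx)

theorem mfderiv_pt {i : ι} {p : ℝ × ℝ} (hp : p ∈ G.dom i) :
    mfderiv 𝓘(ℝ, ℝ × ℝ) 𝓘(ℝ, ℝ × ℝ) (G.pt i) p (G.field i p) = G.vectorField (G.pt i p) := by
  have hx := G.pt_mem_source hp
  have h1 := (G.contMDiffAt_pt hp).mdifferentiableAt (by simp)
  have h2 := (G.contMDiffAt_chart hx).mdifferentiableAt (by simp)
  have h3 := G.mfderiv_chart i hx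
  rw [G.chart_pt hp] at h3
  have h1' := h1
  rw [← G.chart_pt hp] at h1'
  have h4 := mfderiv_comp (G.pt i p) h1' h2
  have h5 : (G.pt i ∘ G.chart i) =ᶠ[𝓝 (G.pt i p)] id := by
    filter_upwards [(G.chart i).open_source.mem_nhds hx] with y hy
    exact G.pt_chart hy
  rw [h5.mfderiv_eq, mfderiv_id] at h4
  have h6 := congrArg (fun L => L (G.vectorField (G.pt i p))) h4
  rw [G.chart_pt hp] at h6
  exact ((congrArg _ h3).symm.trans h6.symm)

/-- Locally the field is the image of an analytic field of the plane under the tangent map of the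
analytic parametrization `pt i`. -/
theorem isAnalyticField_vectorField : IsAnalyticField G.vectorField := by
  intro x
  have hx := G.mem_source_index x
  set i := G.index x
  have h1 : ContMDiffOn 𝓘(ℝ, ℝ × ℝ).tangent 𝓘(ℝ, ℝ × ℝ).tangent ω
      (tangentMapWithin 𝓘(ℝ, ℝ × ℝ) 𝓘(ℝ, ℝ × ℝ) (G.pt i) (G.dom i))
      (Bundle.TotalSpace.proj ⁻¹' (G.dom i)) :=
    (G.contMDiffOn_pt i).contMDiffOn_tangentMapWithin (by simp) (G.isOpen_dom i).uniqueMDiffOn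
  have h2 : ContMDiffOn 𝓘(ℝ, ℝ × ℝ) 𝓘(ℝ, ℝ × ℝ).tangent ω
      (fun p => (⟨p, G.field i p⟩ : TangentBundle 𝓘(ℝ, ℝ × ℝ) (ℝ × ℝ))) (G.dom i) := by
    exact contMDiffOn_vectorSpace_iff_contDiffOn.2 (G.contDiffOn_field i)
  have h3 := h1.comp h2 (fun p hp => hp)
  have h4 := h3.comp (contMDiffOn_of_mem_maximalAtlas (G.chart_mem_maximalAtlas i))
    (fun y hy => G.chart_mem hy)
  refine (h4.contMDiffAt ((G.chart i).open_source.mem_nhds hx)).congr_of_eventuallyEq ?_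
  filter_upwards [(G.chart i).open_source.mem_nhds hx] with y hy
  have h5 : mfderivWithin 𝓘(ℝ, ℝ × ℝ) 𝓘(ℝ, ℝ × ℝ) (G.pt i) (G.dom i) (G.chart i y) =
      mfderiv 𝓘(ℝ, ℝ × ℝ) 𝓘(ℝ, ℝ × ℝ) (G.pt i) (G.chart i y) :=
    mfderivWithin_of_mem_nhds ((G.isOpen_dom i).mem_nhds (G.chart_mem hy))
  simp only [Function.comp_apply, tangentMapWithin, h5, G.mfderiv_pt (G.chart_mem hy)]
  rw [G.pt_chart hy]

theorem hasMFDerivWithinAt_pt_comp {i : ι} {c : ℝ → ℝ × ℝ} {s : Set ℝ} {t : ℝ}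
    (ht : c t ∈ G.dom i) (hc : HasDerivWithinAt c (G.field i (c t)) s t) :
    HasMFDerivWithinAt 𝓘(ℝ, ℝ) 𝓘(ℝ, ℝ × ℝ) (fun t => G.pt i (c t)) s t
      ((1 : ℝ →L[ℝ] ℝ).smulRight (G.vectorField (G.pt i (c t)))) := by
  have h1 := ((G.contMDiffAt_pt ht).mdifferentiableAt (by simp)).hasMFDerivAt
  have h2 := hc.hasFDerivWithinAt.hasMFDerivWithinAt
  have h3 := h1.comp_hasMFDerivWithinAt t h2
  rw [← G.mfderiv_pt ht]
  refine h3.congr_mfderiv ?_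
  refine ContinuousLinearMap.ext fun (r : ℝ) => ?_
  exact (mfderiv 𝓘(ℝ, ℝ × ℝ) 𝓘(ℝ, ℝ × ℝ) (G.pt i) (c t)).map_smul r (G.field i (c t))

end ChartGluing

/-! ### Explicit solutions of the normal form -/

/-- The inverse `k`-th root. -/
noncomputable def invRoot (k : ℕ) (B : ℝ) : ℝ := B ^ (-(1 / (k : ℝ)))

theorem invRoot_pos (k : ℕ) {B : ℝ} (hB : 0 < B) : 0 < invRoot k B := Real.rpow_pos_of_pos hB _

theorem invRoot_pow {k : ℕ} (hk : 1 ≤ k) {B : ℝ} (hB : 0 < B) : invRoot k B ^ k = B⁻¹ := by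
  have : (k : ℝ) ≠ 0 := by positivity
  rw [invRoot, ← Real.rpow_natCast, ← Real.rpow_mul hB.le, ← Real.rpow_neg_one]
  congr 1
  field_simp

theorem invRoot_inv {k : ℕ} {B : ℝ} (hB : 0 < B) : invRoot k B⁻¹ = (invRoot k B)⁻¹ := by
  rw [invRoot, invRoot, Real.inv_rpow hB.le]

theorem eq_invRoot {k : ℕ} (hk : 1 ≤ k) {x B : ℝ} (hx : 0 < x) (hB : 0 < B)
    (h : x ^ k = B⁻¹) : x = invRoot k B := by
  rw [← invRoot_pow hk hB] at h
  exact (pow_left_inj₀ hx.le (invRoot_pos k hB).le (by omega)).1 h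

theorem invRoot_strictAntiOn {k : ℕ} (hk : 1 ≤ k) {B B' : ℝ} (hB : 0 < B) (h : B < B') :
    invRoot k B' < invRoot k B :=
  Real.rpow_lt_rpow_of_neg hB h (by
    have : (0 : ℝ) < k := by positivity
    simpa using this)

theorem contDiffAt_invRoot (k : ℕ) {B : ℝ} (hB : 0 < B) : ContDiffAt ℝ ω (invRoot k) B :=
  Real.contDiffAt_rpow_const_of_ne hB.ne'

theorem hasDerivAt_invRoot {k : ℕ} {B : ℝ} (hB : 0 < B) :
    HasDerivAt (invRoot k) (-(1 / k) * (invRoot k B * B⁻¹)) B := by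
  convert! Real.hasDerivAt_rpow_const (p := -(1 / (k : ℝ))) (Or.inl hB.ne') using 1
  rw [Real.rpow_sub hB, Real.rpow_one, invRoot]
  field_simp

/-- The first coordinate on the center side at the time `T` before infinity. -/
noncomputable def centerX (k : ℕ) (T : ℝ) : ℝ := invRoot k (k * T)

/-- The inverse of `centerX`. -/
noncomputable def centerT (k : ℕ) (x : ℝ) : ℝ := (k * x ^ k)⁻¹

theorem centerX_pos {k : ℕ} (hk : 1 ≤ k) {T : ℝ} (hT : 0 < T) : 0 < centerX k T :=
  invRoot_pos _ (by positivity)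

theorem centerX_pow {k : ℕ} (hk : 1 ≤ k) {T : ℝ} (hT : 0 < T) : centerX k T ^ k = (k * T)⁻¹ :=
  invRoot_pow hk (by positivity)

theorem centerT_centerX {k : ℕ} (hk : 1 ≤ k) {T : ℝ} (hT : 0 < T) :
    centerT k (centerX k T) = T := by
  have : (k : ℝ) ≠ 0 := by positivity
  rw [centerT, centerX_pow hk hT]
  field_simp

theorem centerT_pos {k : ℕ} (hk : 1 ≤ k) {x : ℝ} (hx : 0 < x) : 0 < centerT k x := by
  unfold centerT; positivity

theorem centerX_centerT {k : ℕ} (hk : 1 ≤ k) {x : ℝ} (hx : 0 < x) :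
    centerX k (centerT k x) = x := by
  have : (k : ℝ) ≠ 0 := by positivity
  refine (eq_invRoot hk hx (mul_pos (by positivity) (centerT_pos hk hx)) ?_).symm
  rw [centerT]
  field_simp

theorem centerX_lt_centerX {k : ℕ} (hk : 1 ≤ k) {T T' : ℝ} (hT : 0 < T) (h : T < T') :
    centerX k T' < centerX k T :=
  invRoot_strictAntiOn hk (by positivity) (by gcongr)

theorem centerX_le_centerX {k : ℕ} (hk : 1 ≤ k) {T T' : ℝ} (hT : 0 < T) (h : T ≤ T') :
    centerX k T' ≤ centerX k T := by
  rcases h.eq_or_lt with rfl | h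
  · exact le_rfl
  · exact (centerX_lt_centerX hk hT h).le

theorem lt_centerX_iff {k : ℕ} (hk : 1 ≤ k) {x T : ℝ} (hx : 0 < x) (hT : 0 < T) :
    x < centerX k T ↔ T < centerT k x := by
  rw [← not_le, ← not_le, not_iff_not]
  constructor
  · intro h
    by_contra! h'
    have := centerX_lt_centerX hk hT h'
    rw [centerX_centerT hk hx] at this
    linarith
  · intro h
    have := centerX_le_centerX hk (centerT_pos hk hx) h
    rwa [centerX_centerT hk hx] at this

theorem le_centerX_iff {k : ℕ} (hk : 1 ≤ k) {x T : ℝ} (hx : 0 < x) (hT : 0 < T) :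
    x ≤ centerX k T ↔ T ≤ centerT k x := by
  constructor
  · intro h
    by_contra! h'
    have := centerX_lt_centerX hk (centerT_pos hk hx) h'
    rw [centerX_centerT hk hx] at this
    linarith
  · intro h
    have := centerX_le_centerX hk hT h
    rwa [centerX_centerT hk hx] at this

/-- The variable `T` is the time left before blow-up, so it runs against the flow of the normal
form; hence the minus sign. -/
theorem hasDerivAt_centerX {k : ℕ} (hk : 1 ≤ k) {T : ℝ} (hT : 0 < T) :
    HasDerivAt (centerX k) (-centerX k T ^ (k + 1)) T := by
  have hk0 : (k : ℝ) ≠ 0 := by positivity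
  have h := (hasDerivAt_invRoot (k := k) (B := k * T) (by positivity)).comp T
    ((hasDerivAt_id T).const_mul (k : ℝ))
  refine h.congr_deriv ?_
  rw [pow_succ, centerX_pow hk hT, centerX]
  field_simp

theorem contDiffAt_centerX {k : ℕ} (hk : 1 ≤ k) {T : ℝ} (hT : 0 < T) :
    ContDiffAt ℝ ω (centerX k) T :=
  ContDiffAt.comp T (contDiffAt_invRoot k (by positivity)) (contDiffAt_const.mul contDiffAt_id)

theorem contDiffAt_centerT {k : ℕ} (hk : 1 ≤ k) {x : ℝ} (hx : 0 < x) :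
    ContDiffAt ℝ ω (centerT k) x :=
  ContDiffAt.inv (contDiffAt_const.mul (contDiffAt_id.pow k)) (by change (k : ℝ) * x ^ k ≠ 0; positivity)

theorem tendsto_centerX {k : ℕ} (hk : 1 ≤ k) : Tendsto (centerX k) atTop (𝓝 0) := by
  have hk0 : (0 : ℝ) < k := by positivity
  exact (tendsto_rpow_neg_atTop (y := 1 / (k : ℝ)) (by positivity)).comp
    (tendsto_id.const_mul_atTop hk0)

/-- The first coordinate, at the height `exp T`, of the orbit with the parameter `z` on the
hyperbolic side. -/
noncomputable def hyperX (k : ℕ) (z T : ℝ) : ℝ := z * invRoot k (k * (1 + T * z ^ k))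

/-- The inverse of `hyperX` in the parameter. -/
noncomputable def hyperZ (k : ℕ) (x T : ℝ) : ℝ := x * invRoot k (1 / k - T * x ^ k)

/-- For `z ≠ 0` this reads `1/(k x^k) = z^(-k) + T`: the parameter `z` is a first integral, in a
form that stays analytic across the axis `x = 0`. -/
theorem hyperX_pow {k : ℕ} (hk : 1 ≤ k) {z T : ℝ} (h : 0 < 1 + T * z ^ k) :
    hyperX k z T ^ k = z ^ k * (k * (1 + T * z ^ k))⁻¹ := by
  rw [hyperX, mul_pow, invRoot_pow hk (by positivity)]

theorem hyperX_aux {k : ℕ} (hk : 1 ≤ k) {z T : ℝ} (h : 0 < 1 + T * z ^ k) :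
    1 / k - T * hyperX k z T ^ k = (k * (1 + T * z ^ k))⁻¹ := by
  have hk0 : (k : ℝ) ≠ 0 := by positivity
  rw [hyperX_pow hk h]
  field_simp
  ring

theorem hyperZ_hyperX {k : ℕ} (hk : 1 ≤ k) {z T : ℝ} (h : 0 < 1 + T * z ^ k) :
    hyperZ k (hyperX k z T) T = z := by
  have hB : 0 < k * (1 + T * z ^ k) := by positivity
  rw [hyperZ, hyperX_aux hk h, invRoot_inv hB, hyperX]
  have := invRoot_pos k hB
  field_simp

theorem hyperZ_aux {k : ℕ} (hk : 1 ≤ k) {x T : ℝ} (h : 0 < 1 / k - T * x ^ k) :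
    k * (1 + T * hyperZ k x T ^ k) = (1 / k - T * x ^ k)⁻¹ := by
  have hk0 : (k : ℝ) ≠ 0 := by positivity
  rw [hyperZ, mul_pow, invRoot_pow hk h]
  field_simp
  have : 1 - k * T * x ^ k ≠ 0 := by
    have : (1 : ℝ) / k - T * x ^ k = (1 - k * T * x ^ k) / k := by field_simp
    rw [this] at h
    intro h0
    simp [h0] at h
  field_simp
  ring

theorem hyperX_hyperZ {k : ℕ} (hk : 1 ≤ k) {x T : ℝ} (h : 0 < 1 / k - T * x ^ k) :
    hyperX k (hyperZ k x T) T = x := by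
  rw [hyperX, hyperZ_aux hk h, invRoot_inv h, hyperZ, mul_assoc,
    mul_inv_cancel₀ (invRoot_pos k h).ne', mul_one]

theorem hasDerivAt_hyperX {k : ℕ} (hk : 1 ≤ k) {z T : ℝ} (h : 0 < 1 + T * z ^ k) :
    HasDerivAt (hyperX k z) (-hyperX k z T ^ (k + 1)) T := by
  have hk0 : (k : ℝ) ≠ 0 := by positivity
  have h1 := ((hasDerivAt_invRoot (k := k) (B := k * (1 + T * z ^ k)) (by positivity)).comp T
    ((((hasDerivAt_id T).mul_const (z ^ k)).const_add 1).const_mul (k : ℝ))).const_mul z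
  refine h1.congr_deriv ?_
  rw [pow_succ, hyperX_pow hk h, hyperX]
  field_simp

/-- The width `1/8` of the strips is matched to the bound `8` for the logarithm of the height:
together they give `|T z^k| < 1`. -/
theorem one_add_mul_pow_pos {k : ℕ} (hk : 1 ≤ k) {z T : ℝ} (hT : T ∈ Ioo (5 : ℝ) 8)
    (hz : |z| < 1 / 8) : 0 < 1 + T * z ^ k := by
  have h1 : |z ^ k| ≤ |z| := by
    rw [abs_pow]
    exact pow_le_of_le_one (abs_nonneg _) (by linarith) (by omega)
  have h2 : |T * z ^ k| < 1 := by
    rw [abs_mul, abs_of_pos (by linarith [hT.1])]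
    nlinarith [hT.1, hT.2, abs_nonneg (z ^ k)]
  linarith [(abs_lt.1 h2).1]

/-- For `z > 0` the time before blow-up is `z^(-k) + T`, which exceeds `4`. The tube around the
hyperbolic axis therefore stays away from the end of the center axis. -/
theorem hyperX_lt {k : ℕ} (hk : 1 ≤ k) {z T : ℝ} (hT : T ∈ Ioo (5 : ℝ) 8)
    (hz : |z| < 1 / 8) : hyperX k z T < centerX k 4 := by
  have h := one_add_mul_pow_pos hk hT hz
  rcases le_or_gt z 0 with h0 | h0
  · exact (mul_nonpos_of_nonpos_of_nonneg h0 (invRoot_pos _ (by positivity)).le).trans_lt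
      (centerX_pos hk (by norm_num))
  · have hx : 0 < hyperX k z T := mul_pos h0 (invRoot_pos _ (by positivity))
    have hk0 : (0 : ℝ) < k := by positivity
    rw [lt_centerX_iff hk hx (by norm_num), centerT, hyperX_pow hk h]
    have hzk : 0 < z ^ k := by positivity
    rw [lt_inv_comm₀ (by norm_num) (by positivity)]
    have hzk1 : T * z ^ k < 1 := by
      have h1 : z ^ k ≤ z := pow_le_of_le_one h0.le (by linarith [abs_lt.1 hz]) (by omega)
      nlinarith [hT.1, hT.2, (abs_lt.1 hz).2]
    have : (k : ℝ) * (z ^ k * (k * (1 + T * z ^ k))⁻¹) = z ^ k / (1 + T * z ^ k) := by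
      field_simp
    rw [this, div_lt_iff₀ h]
    nlinarith [hT.1]

theorem contDiffAt_hyperX {k : ℕ} (hk : 1 ≤ k) {r : ℝ × ℝ} (h : 0 < 1 + r.1 * r.2 ^ k) :
    ContDiffAt ℝ ω (fun r : ℝ × ℝ => hyperX k r.2 r.1) r :=
  contDiffAt_snd.mul ((contDiffAt_invRoot k (by positivity)).comp r
    (contDiffAt_const.mul (contDiffAt_const.add (contDiffAt_fst.mul (contDiffAt_snd.pow k)))))

theorem contDiffAt_hyperZ {k : ℕ} {p : ℝ × ℝ} (hp : 0 < p.2)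
    (h : 0 < 1 / k - Real.log p.2 * p.1 ^ k) :
    ContDiffAt ℝ ω (fun p : ℝ × ℝ => hyperZ k p.1 (Real.log p.2)) p :=
  contDiffAt_fst.mul (ContDiffAt.comp p (contDiffAt_invRoot k h)
    (contDiffAt_const.sub ((contDiffAt_snd.log hp.ne').mul (contDiffAt_fst.pow k))))

/-! ### The gluing maps -/

/-- The gluing map along the center connections, seen from the box at its end. -/
noncomputable def twist (b : Bool) (c : ℝ) : ℝ := if b then c else gluingMap c

/-- The inverse of `twist`. -/
noncomputable def untwist (b : Bool) (w : ℝ) : ℝ := if b then w else (√(1 + 4 * w) - 1) / 2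

/-- The image of the interval `(-1/8, 1/8)` under `twist`. -/
def twistRange (b : Bool) : Set ℝ := {w | 0 < 1 + 4 * w ∧ |untwist b w| < 1 / 8}

/-- The quadratic map is inverted through `1 + 4 (c + c²) = (1 + 2c)²`, where `1 + 2c` is positive.
-/
theorem untwist_twist (b : Bool) {c : ℝ} (hc : |c| < 1 / 8) : untwist b (twist b c) = c := by
  cases b
  · have h : 1 + 4 * (c + c ^ 2) = (1 + 2 * c) ^ 2 := by ring
    have h' : 0 ≤ 1 + 2 * c := by linarith [abs_lt.1 hc]
    simp only [untwist, twist, gluingMap, Bool.false_eq_true, if_false, h, Real.sqrt_sq h']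
    ring
  · simp [untwist, twist]

theorem twist_untwist (b : Bool) {w : ℝ} (hw : w ∈ twistRange b) : twist b (untwist b w) = w := by
  cases b
  · have h := Real.sq_sqrt hw.1.le
    simp only [untwist, twist, gluingMap, Bool.false_eq_true, if_false]
    linarith
  · simp [untwist, twist]

theorem twist_mem (b : Bool) {c : ℝ} (hc : |c| < 1 / 8) : twist b c ∈ twistRange b := by
  refine ⟨?_, by rwa [untwist_twist b hc]⟩
  have := abs_lt.1 hc
  cases b
  · simp only [twist, gluingMap, Bool.false_eq_true, if_false]; nlinarith
  · simp only [twist, if_true]; linarith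

theorem untwist_mem {b : Bool} {w : ℝ} (hw : w ∈ twistRange b) :
    untwist b w ∈ Ioo (-1 / 8 : ℝ) (1 / 8) := by
  have := abs_lt.1 hw.2
  exact ⟨by linarith, this.2⟩

theorem abs_lt_one_of_mem_twistRange {b : Bool} {w : ℝ} (hw : w ∈ twistRange b) : |w| < 1 := by
  rw [← twist_untwist b hw]
  have := abs_lt.1 hw.2
  rw [abs_lt]
  cases b
  · simp only [twist, gluingMap, Bool.false_eq_true, if_false]
    constructor <;> nlinarith
  · simp only [twist, if_true]
    constructor <;> linarith

theorem twist_zero (b : Bool) : twist b 0 = 0 := by cases b <;> simp [twist, gluingMap]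

theorem contDiff_twist (b : Bool) : ContDiff ℝ ω (twist b) := by
  cases b
  · exact contDiff_id.add (contDiff_id.pow 2)
  · exact contDiff_id

theorem contDiffAt_untwist (b : Bool) {w : ℝ} (hw : 0 < 1 + 4 * w) :
    ContDiffAt ℝ ω (untwist b) w := by
  cases b
  · have : ContDiffAt ℝ ω (fun w : ℝ => (√(1 + 4 * w) - 1) / 2) w :=
      (((contDiffAt_const.add (contDiffAt_const.mul contDiffAt_id)).sqrt hw.ne').sub
        contDiffAt_const).div_const 2
    exact this
  · exact contDiffAt_id

theorem isOpen_twistRange (b : Bool) : IsOpen (twistRange b) := by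
  have h : ContinuousOn (fun w => |untwist b w|) {w | 0 < 1 + 4 * w} := fun w hw =>
    ((contDiffAt_untwist b hw).continuousAt.abs).continuousWithinAt
  exact h.isOpen_inter_preimage (isOpen_lt continuous_const (by fun_prop)) (isOpen_Iio (a := 1 / 8))

theorem twistRange_mem_nhds_zero (b : Bool) : twistRange b ∈ 𝓝 (0 : ℝ) :=
  (isOpen_twistRange b).mem_nhds (by simpa [twist_zero] using twist_mem b (c := 0) (by norm_num))

/-! ### Flow boxes and their cyclic gluing -/

/-- The rectangle in which the flow boxes along the connections are straightened. -/
def stripRect : Set (ℝ × ℝ) := Ioo (0 : ℝ) 3 ×ˢ Ioo (-1 / 8 : ℝ) (1 / 8)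

theorem isOpen_stripRect : IsOpen stripRect := isOpen_Ioo.prod isOpen_Ioo

/-- A flow box `side` of the field `F` at an end of `U`: in the coordinates `coord` the field is
`∂/∂τ`. The parameter `o` says that the flow leaves `U` through this end. -/
structure Strip (U : Set (ℝ × ℝ)) (F : ℝ × ℝ → ℝ × ℝ) (o : Bool) where
  coord : ℝ × ℝ → ℝ × ℝ
  param : ℝ × ℝ → ℝ × ℝ
  side : Set (ℝ × ℝ)
  closedSide : Set (ℝ × ℝ)
  isOpen_side : IsOpen side
  exists_isClosed : ∃ C, IsClosed C ∧ closedSide = U ∩ C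
  side_subset : side ⊆ closedSide
  mem_side : ∀ p ∈ closedSide, (coord p).1 ∈ Ioo (0 : ℝ) 3 → p ∈ side
  continuousOn_coord : ContinuousOn coord closedSide
  coord_fst_mem : ∀ p ∈ closedSide, (coord p).1 ∈ if o then Ico (0 : ℝ) 3 else Ioc (0 : ℝ) 3
  coord_mem : ∀ p ∈ side, coord p ∈ stripRect
  param_mem : ∀ r ∈ stripRect, param r ∈ side
  coord_param : ∀ r ∈ stripRect, coord (param r) = r
  param_coord : ∀ p ∈ side, param (coord p) = p
  contDiffOn_coord : ContDiffOn ℝ ω coord side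
  contDiffOn_param : ContDiffOn ℝ ω param stripRect
  hasDerivAt_param : ∀ r ∈ stripRect, HasDerivAt (fun t => param (t, r.2)) (F (param r)) r.1

namespace Strip

variable {U : Set (ℝ × ℝ)} {F : ℝ × ℝ → ℝ × ℝ} {o : Bool} (S : Strip U F o)

theorem closedSide_subset : S.closedSide ⊆ U := by
  obtain ⟨C, -, h⟩ := S.exists_isClosed
  rw [h]
  exact inter_subset_left

theorem side_subset_dom : S.side ⊆ U := S.side_subset.trans S.closedSide_subset

theorem isClosed_closedSide : IsClosed (Subtype.val ⁻¹' S.closedSide : Set U) := by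
  obtain ⟨C, hC, h⟩ := S.exists_isClosed
  have : (Subtype.val ⁻¹' S.closedSide : Set U) = Subtype.val ⁻¹' C := by
    ext p
    simp [h]
  rw [this]
  exact hC.preimage continuous_subtype_val

theorem differentiableAt_param {r : ℝ × ℝ} (hr : r ∈ stripRect) :
    DifferentiableAt ℝ S.param r :=
  (S.contDiffOn_param.contDiffAt (isOpen_stripRect.mem_nhds hr)).differentiableAt (by simp)

theorem differentiableAt_coord {p : ℝ × ℝ} (hp : p ∈ S.side) : DifferentiableAt ℝ S.coord p :=
  (S.contDiffOn_coord.contDiffAt (S.isOpen_side.mem_nhds hp)).differentiableAt (by simp)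

theorem fderiv_param {r : ℝ × ℝ} (hr : r ∈ stripRect) :
    fderiv ℝ S.param r (1, 0) = F (S.param r) := by
  have h1 : HasDerivAt (fun t : ℝ => (t, r.2)) ((1 : ℝ), (0 : ℝ)) r.1 :=
    (hasDerivAt_id r.1).prodMk (hasDerivAt_const _ _)
  have h2 : HasDerivAt (S.param ∘ fun t : ℝ => (t, r.2)) (fderiv ℝ S.param r (1, 0)) r.1 :=
    HasFDerivAt.comp_hasDerivAt r.1 (S.differentiableAt_param hr).hasFDerivAt h1
  exact h2.unique (S.hasDerivAt_param r hr)

/-- Differentiate `coord ∘ param = id` and use that `param` carries `∂/∂τ` to the field. -/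
theorem fderiv_coord {p : ℝ × ℝ} (hp : p ∈ S.side) : fderiv ℝ S.coord p (F p) = (1, 0) := by
  have hr := S.coord_mem p hp
  have h1 : (S.coord ∘ S.param) =ᶠ[𝓝 (S.coord p)] id := by
    filter_upwards [isOpen_stripRect.mem_nhds hr] with r hr
    exact S.coord_param r hr
  have hp' : DifferentiableAt ℝ S.coord (S.param (S.coord p)) := by
    rw [S.param_coord p hp]
    exact S.differentiableAt_coord hp
  have h2 := h1.fderiv_eq (𝕜 := ℝ)
  rw [fderiv_comp _ hp' (S.differentiableAt_param hr), S.param_coord p hp, fderiv_id] at h2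
  have h3 := congrArg (fun L : ℝ × ℝ →L[ℝ] ℝ × ℝ => L (1, 0)) h2
  simpa [S.fderiv_param hr, S.param_coord p hp] using h3

variable {U' : Set (ℝ × ℝ)} {F' : ℝ × ℝ → ℝ × ℝ} {o' : Bool} (S' : Strip U' F' o')

theorem param_coord_mem {p : ℝ × ℝ} (hp : p ∈ S.side) : S'.param (S.coord p) ∈ S'.side :=
  S'.param_mem _ (S.coord_mem p hp)

theorem param_coord_param_coord {p : ℝ × ℝ} (hp : p ∈ S.side) :
    S.param (S'.coord (S'.param (S.coord p))) = p := by
  rw [S'.coord_param _ (S.coord_mem p hp), S.param_coord p hp]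

theorem contDiffOn_param_coord : ContDiffOn ℝ ω (fun p => S'.param (S.coord p)) S.side :=
  S'.contDiffOn_param.comp S.contDiffOn_coord S.coord_mem

theorem fderiv_param_coord {p : ℝ × ℝ} (hp : p ∈ S.side) :
    fderiv ℝ (fun p => S'.param (S.coord p)) p (F p) = F' (S'.param (S.coord p)) := by
  have hr := S.coord_mem p hp
  have := fderiv_comp p (S'.differentiableAt_param hr) (S.differentiableAt_coord hp)
  change fderiv ℝ (S'.param ∘ S.coord) p (F p) = _
  rw [this, ContinuousLinearMap.comp_apply, S.fderiv_coord hp, S'.fderiv_param hr]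

/-- On the relatively closed sides both coordinates are continuous, and the graph is the set where
they agree. On the exit side `τ` may be `0` but not `3`, on the entry side it may be `3` but not
`0`. Agreement thus excludes both values and brings the two points back into the open strips. The
Hausdorff property of the surface rests on this asymmetry. -/
theorem isClosed_graph (S : Strip U F true) (S' : Strip U' F' false) :
    IsClosed {r : U × U' | (r.1 : ℝ × ℝ) ∈ S.side ∧ S'.param (S.coord r.1) = r.2} := by
  have h : {r : U × U' | (r.1 : ℝ × ℝ) ∈ S.side ∧ S'.param (S.coord r.1) = r.2} =
      {r : U × U' | ((r.1 : ℝ × ℝ) ∈ S.closedSide ∧ (r.2 : ℝ × ℝ) ∈ S'.closedSide)} ∩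
        (fun r : U × U' => (S.coord r.1, S'.coord r.2)) ⁻¹' {x | x.1 = x.2} := by
    ext ⟨p, q⟩
    simp only [mem_ofPred_eq, mem_inter_iff, mem_preimage]
    constructor
    · rintro ⟨h1, h2⟩
      have h3 := S.coord_mem _ h1
      have h4 := S'.param_mem _ h3
      rw [← h2, S'.coord_param _ h3]
      exact ⟨⟨S.side_subset h1, S'.side_subset h4⟩, rfl⟩
    · rintro ⟨⟨h1, h2⟩, h3⟩
      have h4 := S.coord_fst_mem _ h1
      have h5 := S'.coord_fst_mem _ h2
      rw [← h3] at h5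
      simp only [if_true, Bool.false_eq_true, if_false] at h4 h5
      have h6 := S.mem_side _ h1 ⟨h5.1, h4.2⟩
      refine ⟨h6, ?_⟩
      rw [h3]
      exact S'.param_coord _ (S'.mem_side _ h2 (by rw [← h3]; exact ⟨h5.1, h4.2⟩))
  rw [h]
  refine ContinuousOn.preimage_isClosed_of_isClosed ?_ ?_ (isClosed_eq continuous_fst continuous_snd)
  · refine ContinuousOn.prodMk ?_ ?_
    · exact S.continuousOn_coord.comp (by fun_prop) fun r hr => hr.1
    · exact S'.continuousOn_coord.comp (by fun_prop) fun r hr => hr.2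
  · exact (S.isClosed_closedSide.preimage continuous_fst).inter
      (S'.isClosed_closedSide.preimage continuous_snd)

end Strip

/-- Four domains with an entry strip and an exit strip each. -/
structure StripCycle where
  dom : Fin 4 → Set (ℝ × ℝ)
  field : Fin 4 → ℝ × ℝ → ℝ × ℝ
  isOpen_dom : ∀ i, IsOpen (dom i)
  dom_nonempty : ∀ i, (dom i).Nonempty
  contDiffOn_field : ∀ i, ContDiffOn ℝ ω (field i) (dom i)
  exitStrip : ∀ i, Strip (dom i) (field i) true
  entryStrip : ∀ i, Strip (dom i) (field i) false
  disjoint_side : ∀ i, Disjoint (exitStrip i).side (entryStrip i).side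

namespace StripCycle

variable (C : StripCycle)

/-- The exit strip of each domain overlaps with the entry strip of the next one. -/
def overlap (i j : Fin 4) : Set (ℝ × ℝ) :=
  if j = i then C.dom i else if j = i + 1 then (C.exitStrip i).side
  else if i = j + 1 then (C.entryStrip i).side else ∅

/-- The transition maps. -/
def trans (i j : Fin 4) (p : ℝ × ℝ) : ℝ × ℝ :=
  if j = i then p else if j = i + 1 then (C.entryStrip j).param ((C.exitStrip i).coord p)
  else if i = j + 1 then (C.exitStrip j).param ((C.entryStrip i).coord p) else p

theorem overlap_self (i : Fin 4) : C.overlap i i = C.dom i := by simp [overlap]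

theorem overlap_next (i : Fin 4) : C.overlap i (i + 1) = (C.exitStrip i).side := by
  simp [overlap]

theorem overlap_prev (i : Fin 4) : C.overlap (i + 1) i = (C.entryStrip (i + 1)).side := by
  have h : ¬ i = i + 1 + 1 := by revert i; decide
  simp [overlap, h]

theorem overlap_opposite (i : Fin 4) : C.overlap i (i + 2) = ∅ := by
  have h : ¬ i + 2 = i + 1 := by revert i; decide
  have h' : ¬ i = i + 2 + 1 := by revert i; decide
  have h'' : ¬ i + 2 = i := by revert i; decide
  simp [overlap, h, h', h'']

theorem trans_self (i : Fin 4) : C.trans i i = id := by ext1 p; simp [trans]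

theorem trans_next (i : Fin 4) : C.trans i (i + 1) =
    fun p => (C.entryStrip (i + 1)).param ((C.exitStrip i).coord p) := by
  ext1 p; simp [trans]

theorem trans_prev (i : Fin 4) : C.trans (i + 1) i =
    fun p => (C.exitStrip i).param ((C.entryStrip (i + 1)).coord p) := by
  have h : ¬ i = i + 1 + 1 := by revert i; decide
  ext1 p; simp [trans, h]

theorem index_cases (i j : Fin 4) : j = i ∨ j = i + 1 ∨ i = j + 1 ∨ j = i + 2 := by
  revert i j; decide

theorem trans_mem_aux (i j : Fin 4) (p : ℝ × ℝ) (hp : p ∈ C.overlap i j) :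
    C.trans i j p ∈ C.overlap j i ∧ C.trans j i (C.trans i j p) = p := by
  rcases index_cases i j with rfl | rfl | rfl | rfl
  · rw [trans_self]; exact ⟨hp, rfl⟩
  · rw [overlap_next] at hp
    rw [overlap_prev, trans_next, trans_prev]
    exact ⟨Strip.param_coord_mem _ _ hp, Strip.param_coord_param_coord _ _ hp⟩
  · rw [overlap_prev] at hp
    rw [overlap_next, trans_next, trans_prev]
    exact ⟨Strip.param_coord_mem _ _ hp, Strip.param_coord_param_coord _ _ hp⟩
  · simp [overlap_opposite] at hp

/-- Opposite boxes do not meet, and no point lies in both strips of one box. The only composites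
that occur contain an identity or go to a neighbour and back. -/
theorem trans_trans_aux (i j k : Fin 4) (p : ℝ × ℝ) (hp : p ∈ C.overlap i j)
    (hp' : C.trans i j p ∈ C.overlap j k) :
    p ∈ C.overlap i k ∧ C.trans j k (C.trans i j p) = C.trans i k p := by
  have hsym := C.trans_mem_aux i j p hp
  rcases index_cases j k with rfl | rfl | rfl | rfl
  · rw [C.trans_self k]; exact ⟨hp, rfl⟩
  · rcases index_cases i j with rfl | rfl | h | rfl
    · rw [C.trans_self j] at hp' ⊢; exact ⟨hp', rfl⟩
    · rw [overlap_next] at hp'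
      rw [overlap_prev] at hsym
      exact absurd hsym.1 (Set.disjoint_left.1 (C.disjoint_side _) hp')
    · subst h
      rw [overlap_prev] at hp
      rw [C.overlap_self, hsym.2, C.trans_self]
      exact ⟨(C.entryStrip _).side_subset_dom hp, rfl⟩
    · simp [overlap_opposite] at hp
  · rcases index_cases i (k + 1) with h | h | h | h
    · subst h; rw [C.trans_self] at hp' ⊢; exact ⟨hp', rfl⟩
    · obtain rfl := add_right_cancel h
      rw [overlap_next] at hp
      rw [C.overlap_self, hsym.2, C.trans_self]
      exact ⟨(C.exitStrip _).side_subset_dom hp, rfl⟩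
    · subst h
      rw [overlap_prev] at hp'
      rw [overlap_next] at hsym
      exact absurd hp' (Set.disjoint_left.1 (C.disjoint_side _) hsym.1)
    · rw [h] at hp; simp [overlap_opposite] at hp
  · simp [overlap_opposite] at hp'

theorem isClosed_graph (i j : Fin 4) : IsClosed {r : C.dom i × C.dom j |
    (r.1 : ℝ × ℝ) ∈ C.overlap i j ∧ C.trans i j r.1 = r.2} := by
  rcases index_cases i j with rfl | rfl | rfl | rfl
  · have : {r : C.dom j × C.dom j | (r.1 : ℝ × ℝ) ∈ C.overlap j j ∧ C.trans j j r.1 = r.2} =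
        {r : C.dom j × C.dom j | r.1 = r.2} := by
      ext r
      simp [trans_self, overlap_self, Subtype.ext_iff]
    rw [this]
    exact isClosed_eq continuous_fst continuous_snd
  · simp only [overlap_next, trans_next]
    exact Strip.isClosed_graph _ _
  · have h := (Strip.isClosed_graph (C.exitStrip j) (C.entryStrip (j + 1))).preimage
      (continuous_swap (X := C.dom (j + 1)) (Y := C.dom j))
    convert h using 1
    ext ⟨p, q⟩
    simp only [overlap_prev, trans_prev, mem_ofPred_eq, mem_preimage, Prod.swap]
    constructor
    · rintro ⟨h1, h2⟩
      rw [← h2]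
      exact ⟨Strip.param_coord_mem _ _ h1, Strip.param_coord_param_coord _ _ h1⟩
    · rintro ⟨h1, h2⟩
      rw [← h2]
      exact ⟨Strip.param_coord_mem _ _ h1, Strip.param_coord_param_coord _ _ h1⟩
  · simp [overlap_opposite]

/-- The surface obtained by gluing the exit strips to the entry strips. -/
def gluing : ChartGluing (Fin 4) where
  dom := C.dom
  overlap := C.overlap
  trans := C.trans
  field := C.field
  isOpen_dom := C.isOpen_dom
  dom_nonempty := C.dom_nonempty
  isOpen_overlap i j := by
    rcases index_cases i j with rfl | rfl | rfl | rfl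
    · rw [overlap_self]; exact C.isOpen_dom _
    · rw [overlap_next]; exact (C.exitStrip i).isOpen_side
    · rw [overlap_prev]; exact (C.entryStrip _).isOpen_side
    · rw [overlap_opposite]; exact isOpen_empty
  overlap_subset i j := by
    rcases index_cases i j with rfl | rfl | rfl | rfl
    · rw [overlap_self]
    · rw [overlap_next]; exact (C.exitStrip i).side_subset_dom
    · rw [overlap_prev]; exact (C.entryStrip _).side_subset_dom
    · rw [overlap_opposite]; exact empty_subset _
  overlap_self := C.overlap_self
  trans_self i p _ := by rw [trans_self]; rfl
  trans_mem i j p hp := (C.trans_mem_aux i j p hp).1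
  trans_trans_symm i j p hp := (C.trans_mem_aux i j p hp).2
  mem_overlap_of_mem i j k p hp hp' := (C.trans_trans_aux i j k p hp hp').1
  trans_trans i j k p hp hp' := (C.trans_trans_aux i j k p hp hp').2
  contDiffOn_trans i j := by
    rcases index_cases i j with rfl | rfl | rfl | rfl
    · rw [trans_self]; exact contDiffOn_id
    · rw [trans_next, overlap_next]; exact Strip.contDiffOn_param_coord _ _
    · rw [trans_prev, overlap_prev]; exact Strip.contDiffOn_param_coord _ _
    · rw [overlap_opposite]; exact fun _ h => h.elim
  isClosed_graph := C.isClosed_graph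
  contDiffOn_field := C.contDiffOn_field
  fderiv_trans i j p hp := by
    rcases index_cases i j with rfl | rfl | rfl | rfl
    · simp [trans_self]
    · rw [overlap_next] at hp; rw [trans_next]; exact Strip.fderiv_param_coord _ _ hp
    · rw [overlap_prev] at hp; rw [trans_prev]; exact Strip.fderiv_param_coord _ _ hp
    · simp [overlap_opposite] at hp

end StripCycle

/-! ### The boxes around the equilibria and their flow boxes -/

/-- The sign of the time direction: `1` for passages from the hyperbolic to the center side. -/
def timeSign (b : Bool) : ℝ := if b then 1 else -1

/-- The time before infinity that corresponds to the strip coordinate `τ`. -/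
noncomputable def stripTime (b : Bool) (m τ : ℝ) : ℝ := m - timeSign b * (τ - 3 / 2)

/-- The inverse of `stripTime`. -/
noncomputable def stripTau (b : Bool) (m T : ℝ) : ℝ := 3 / 2 - timeSign b * (T - m)

theorem stripTau_stripTime (b : Bool) (m τ : ℝ) : stripTau b m (stripTime b m τ) = τ := by
  cases b <;> simp [stripTau, stripTime, timeSign]

theorem stripTime_stripTau (b : Bool) (m T : ℝ) : stripTime b m (stripTau b m T) = T := by
  cases b <;> simp [stripTau, stripTime, timeSign]

theorem stripTime_mem {b : Bool} {m τ : ℝ} (h : τ ∈ Ioo (0 : ℝ) 3) :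
    stripTime b m τ ∈ Ioo (m - 3 / 2) (m + 3 / 2) := by
  cases b <;> simp only [stripTime, timeSign, mem_Ioo, if_true, Bool.false_eq_true, if_false] at * <;>
    constructor <;> linarith

theorem mem_of_stripTau_mem {b : Bool} {m T : ℝ} (h : stripTau b m T ∈ Ioo (0 : ℝ) 3) :
    T ∈ Ioo (m - 3 / 2) (m + 3 / 2) := by
  rw [← stripTime_stripTau b m T]
  exact stripTime_mem h

theorem stripTau_mem {b : Bool} {m T : ℝ} (h : T ∈ Ioo (m - 3 / 2) (m + 3 / 2)) :
    stripTau b m T ∈ Ioo (0 : ℝ) 3 := by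
  cases b <;> simp only [stripTau, timeSign, mem_Ioo, if_true, Bool.false_eq_true, if_false] at * <;>
    constructor <;> linarith

theorem hasDerivAt_stripTime (b : Bool) (m τ : ℝ) :
    HasDerivAt (stripTime b m) (-timeSign b) τ := by
  have := (((hasDerivAt_id τ).sub_const (3 / 2)).const_mul (timeSign b)).const_sub m
  exact this.congr_deriv (by simp)

theorem contDiff_stripTime (b : Bool) (m : ℝ) : ContDiff ℝ ω (stripTime b m) :=
  contDiff_const.sub (contDiff_const.mul (contDiff_id.sub contDiff_const))

theorem contDiff_stripTau (b : Bool) (m : ℝ) : ContDiff ℝ ω (stripTau b m) :=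
  contDiff_const.sub (contDiff_const.mul (contDiff_id.sub contDiff_const))

/-- The neighbourhood of an equilibrium and of the ends of its separatrices. -/
def box (k : ℕ) (b : Bool) : Set (ℝ × ℝ) :=
  -- The box is cut off at `T = 1` on the center side and at `log y = 8` on the hyperbolic side. The
  -- alternatives narrow the ends `log y ≥ 5` and `T ≤ 4` to the tubes where the strip coordinates
  -- are defined.
  {p | p.1 < centerX k 1 ∧ p.2 < Real.exp 8 ∧
    (p.2 < Real.exp 5 ∨ 0 < p.2 ∧ 0 < 1 / k - Real.log p.2 * p.1 ^ k ∧
      |hyperZ k p.1 (Real.log p.2)| < 1 / 8) ∧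
    (p.1 < centerX k 4 ∨ 0 < p.1 ∧ p.2 * Real.exp (-centerT k p.1) ∈ twistRange b)}

/-- The normal form in the time direction given by `b`. -/
noncomputable def boxField (k : ℕ) (b : Bool) (p : ℝ × ℝ) : ℝ × ℝ := timeSign b • normalField k p

theorem contDiff_boxField (k : ℕ) (b : Bool) : ContDiff ℝ ω (boxField k b) :=
  ContDiff.smul (f := fun _ : ℝ × ℝ => timeSign b) contDiff_const
    ((contDiff_fst.pow (k + 1)).prodMk contDiff_snd.neg)

theorem isOpen_box {k : ℕ} (hk : 1 ≤ k) (b : Bool) : IsOpen (box k b) := by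
  have h1 : IsOpen {p : ℝ × ℝ | p.1 < centerX k 1} := isOpen_lt continuous_fst continuous_const
  have h2 : IsOpen {p : ℝ × ℝ | p.2 < Real.exp 8} := isOpen_lt continuous_snd continuous_const
  have h3 : IsOpen {p : ℝ × ℝ | p.2 < Real.exp 5} := isOpen_lt continuous_snd continuous_const
  have h4 : IsOpen {p : ℝ × ℝ | p.1 < centerX k 4} := isOpen_lt continuous_fst continuous_const
  have h5 : IsOpen {p : ℝ × ℝ | 0 < p.1 ∧ p.2 * Real.exp (-centerT k p.1) ∈ twistRange b} := by
    have hc : ContinuousOn (fun p : ℝ × ℝ => p.2 * Real.exp (-centerT k p.1)) {p | 0 < p.1} := by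
      intro p hp
      have := (contDiffAt_centerT hk hp).continuousAt
      have h : ContinuousAt (fun p : ℝ × ℝ => centerT k p.1) p :=
        ContinuousAt.comp (f := fun p : ℝ × ℝ => p.1) this continuousAt_fst
      exact (continuousAt_snd.mul (Real.continuous_exp.continuousAt.comp h.neg)).continuousWithinAt
    exact hc.isOpen_inter_preimage (isOpen_lt continuous_const continuous_fst)
      (isOpen_twistRange b)
  have h6 : IsOpen {p : ℝ × ℝ | 0 < p.2 ∧ 0 < 1 / k - Real.log p.2 * p.1 ^ k} := by
    have hc : ContinuousOn (fun p : ℝ × ℝ => 1 / k - Real.log p.2 * p.1 ^ k) {p | 0 < p.2} := by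
      intro p hp
      exact (continuousAt_const.sub ((continuousAt_snd.log (ne_of_gt hp)).mul
        (continuousAt_fst.pow k))).continuousWithinAt
    exact hc.isOpen_inter_preimage (isOpen_lt continuous_const continuous_snd) isOpen_Ioi
  have h7 : IsOpen {p : ℝ × ℝ | 0 < p.2 ∧ 0 < 1 / k - Real.log p.2 * p.1 ^ k ∧
      |hyperZ k p.1 (Real.log p.2)| < 1 / 8} := by
    have hc : ContinuousOn (fun p : ℝ × ℝ => |hyperZ k p.1 (Real.log p.2)|)
        {p | 0 < p.2 ∧ 0 < 1 / k - Real.log p.2 * p.1 ^ k} := fun p hp =>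
      ((contDiffAt_hyperZ hp.1 hp.2).continuousAt.abs).continuousWithinAt
    convert hc.isOpen_inter_preimage h6 (isOpen_Iio (a := 1 / 8)) using 1
    ext p
    simp [and_assoc]
  exact h1.inter (h2.inter ((h3.union h7).inter (h4.union h5)))

theorem zero_mem_box {k : ℕ} (hk : 1 ≤ k) (b : Bool) : (0 : ℝ × ℝ) ∈ box k b :=
  ⟨centerX_pos hk (by norm_num), Real.exp_pos _, Or.inl (Real.exp_pos _),
    Or.inl (centerX_pos hk (by norm_num))⟩

theorem center_mem_box {k : ℕ} (hk : 1 ≤ k) {b : Bool} {T w : ℝ} (hT : 1 < T)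
    (h : T ≤ 4 → w ∈ twistRange b) (h' : Real.exp T * w < Real.exp 5) :
    (centerX k T, Real.exp T * w) ∈ box k b := by
  have hT0 : 0 < T := by linarith
  refine ⟨centerX_lt_centerX hk one_pos hT, h'.trans (Real.exp_lt_exp.2 (by norm_num)),
    Or.inl h', ?_⟩
  rcases le_or_gt T 4 with h4 | h4
  · refine Or.inr ⟨centerX_pos hk hT0, ?_⟩
    have : Real.exp T * w * Real.exp (-T) = w := by
      rw [mul_right_comm, ← Real.exp_add]
      simp
    simpa only [centerT_centerX hk hT0, this] using h h4
  · exact Or.inl (centerX_lt_centerX hk (by norm_num) h4)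

theorem exp_mul_lt {T w : ℝ} (hT : T ≤ 4) (h : |w| < 1) : Real.exp T * w < Real.exp 5 := by
  have h1 : Real.exp T < Real.exp 5 := Real.exp_lt_exp.2 (by linarith)
  nlinarith [(abs_lt.1 h).2, Real.exp_pos T, abs_nonneg w]

theorem centerT_mem {k : ℕ} (hk : 1 ≤ k) {b : Bool} {p : ℝ × ℝ} (hp : p ∈ box k b)
    (h : centerX k 4 ≤ p.1) : 0 < p.1 ∧ centerT k p.1 ∈ Ioc (1 : ℝ) 4 ∧
      p.2 * Real.exp (-centerT k p.1) ∈ twistRange b := by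
  have h0 : 0 < p.1 := (centerX_pos hk (by norm_num)).trans_le h
  refine ⟨h0, ⟨(lt_centerX_iff hk h0 one_pos).1 hp.1, ?_⟩, ?_⟩
  · by_contra! h4
    exact absurd ((lt_centerX_iff hk h0 (by norm_num)).2 h4) (not_lt.2 h)
  · exact (hp.2.2.2.resolve_left (not_lt.2 h)).2

theorem contDiffAt_centerCoord {k : ℕ} (hk : 1 ≤ k) {b : Bool} {p : ℝ × ℝ} (h0 : 0 < p.1)
    (hw : p.2 * Real.exp (-centerT k p.1) ∈ twistRange b) :
    ContDiffAt ℝ ω (fun p : ℝ × ℝ => (stripTau b (5 / 2) (centerT k p.1),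
      untwist b (p.2 * Real.exp (-centerT k p.1)))) p := by
  have hT : ContDiffAt ℝ ω (fun p : ℝ × ℝ => centerT k p.1) p :=
    ContDiffAt.comp (g := centerT k) p (contDiffAt_centerT hk h0) contDiffAt_fst
  refine ContDiffAt.prodMk ?_ ?_
  · exact (contDiff_stripTau b _).contDiffAt.comp p hT
  · exact ContDiffAt.comp p (contDiffAt_untwist b hw.1) (contDiffAt_snd.mul hT.neg.exp)

/-- The flow box around the end of the center separatrix. -/
noncomputable def centerStrip {k : ℕ} (hk : 1 ≤ k) (b : Bool) :
    Strip (box k b) (boxField k b) b where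
  -- `centerT` changes at unit speed along the flow and `y e^(-T)` is constant. The number `5/2` is
  -- the midpoint of the range `(1, 4)` of `T`.
  coord p := (stripTau b (5 / 2) (centerT k p.1), untwist b (p.2 * Real.exp (-centerT k p.1)))
  param r := (centerX k (stripTime b (5 / 2) r.1),
    Real.exp (stripTime b (5 / 2) r.1) * twist b r.2)
  side := {p | p ∈ box k b ∧ centerX k 4 < p.1}
  closedSide := {p | p ∈ box k b ∧ centerX k 4 ≤ p.1}
  isOpen_side := (isOpen_box hk b).inter (isOpen_lt continuous_const continuous_fst)
  exists_isClosed := ⟨_, isClosed_le continuous_const continuous_fst, rfl⟩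
  side_subset p hp := ⟨hp.1, le_of_lt hp.2⟩
  mem_side p hp h := by
    obtain ⟨h0, h1, h2⟩ := centerT_mem hk hp.1 hp.2
    have := (mem_of_stripTau_mem h).2
    -- On the boundary of the closed side `T = 4`, which corresponds to an end of the interval `(0,
    -- 3)` of `τ`.
    refine ⟨hp.1, lt_of_le_of_ne hp.2 fun h4 => ?_⟩
    rw [← h4, centerT_centerX hk (by norm_num)] at this
    norm_num at this
  continuousOn_coord p hp := by
    obtain ⟨h0, h1, h2⟩ := centerT_mem hk hp.1 hp.2
    exact (contDiffAt_centerCoord hk h0 h2).continuousAt.continuousWithinAt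
  coord_fst_mem p hp := by
    obtain ⟨h0, h1, h2⟩ := centerT_mem hk hp.1 hp.2
    cases b <;> simp only [stripTau, timeSign, mem_Ico, mem_Ioc, if_true, Bool.false_eq_true,
      if_false] at * <;> constructor <;> linarith
  coord_mem p hp := by
    obtain ⟨h0, h1, h2⟩ := centerT_mem hk hp.1 (le_of_lt hp.2)
    refine ⟨stripTau_mem ⟨by linarith [h1.1], ?_⟩, untwist_mem h2⟩
    have : centerT k p.1 < 4 := by
      by_contra! h4
      exact absurd ((le_centerX_iff hk h0 (by norm_num)).2 h4) (not_le.2 hp.2)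
    linarith
  param_mem r hr := by
    have hT := stripTime_mem (b := b) (m := 5 / 2) hr.1
    have hw := twist_mem b (c := r.2) (abs_lt.2 ⟨by linarith [hr.2.1], hr.2.2⟩)
    have h4 : stripTime b (5 / 2) r.1 < 4 := by linarith [hT.2]
    have h1 : 1 < stripTime b (5 / 2) r.1 := by linarith [hT.1]
    exact ⟨center_mem_box hk h1 (fun _ => hw)
      (exp_mul_lt h4.le (abs_lt_one_of_mem_twistRange hw)),
      centerX_lt_centerX hk (by linarith) h4⟩
  coord_param r hr := by
    have hT := stripTime_mem (b := b) (m := 5 / 2) hr.1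
    have h0 : 0 < stripTime b (5 / 2) r.1 := by linarith [hT.1]
    have : ∀ T w : ℝ, Real.exp T * w * Real.exp (-T) = w := fun T w => by
      rw [mul_right_comm, ← Real.exp_add]
      simp
    simp only [centerT_centerX hk h0, stripTau_stripTime, this]
    rw [untwist_twist b (abs_lt.2 ⟨by linarith [hr.2.1], hr.2.2⟩)]
  param_coord p hp := by
    obtain ⟨h0, h1, h2⟩ := centerT_mem hk hp.1 (le_of_lt hp.2)
    simp only [stripTime_stripTau, centerX_centerT hk h0, twist_untwist b h2]
    rw [mul_left_comm, ← Real.exp_add]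
    simp
  contDiffOn_coord p hp := by
    obtain ⟨h0, h1, h2⟩ := centerT_mem hk hp.1 (le_of_lt hp.2)
    exact (contDiffAt_centerCoord hk h0 h2).contDiffWithinAt
  contDiffOn_param r hr := by
    have hT := stripTime_mem (b := b) (m := 5 / 2) hr.1
    have h0 : 0 < stripTime b (5 / 2) r.1 := by linarith [hT.1]
    have hs : ContDiffAt ℝ ω (fun r : ℝ × ℝ => stripTime b (5 / 2) r.1) r :=
      (contDiff_stripTime b _).contDiffAt.comp r contDiffAt_fst
    exact ((ContDiffAt.comp r (contDiffAt_centerX hk h0) hs).prodMk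
      (hs.exp.mul ((contDiff_twist b).contDiffAt.comp r contDiffAt_snd))).contDiffWithinAt
  hasDerivAt_param r hr := by
    have hT := stripTime_mem (b := b) (m := 5 / 2) hr.1
    have h0 : 0 < stripTime b (5 / 2) r.1 := by linarith [hT.1]
    have hs := hasDerivAt_stripTime b (5 / 2) r.1
    have h1 := (hasDerivAt_centerX hk h0).comp r.1 hs
    have h2 := hs.exp.mul_const (twist b r.2)
    refine (h1.prodMk h2).congr_deriv ?_
    simp only [boxField, normalField, Prod.smul_mk, smul_eq_mul, Prod.mk.injEq]
    constructor <;> ring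

theorem hyper_mem_box {k : ℕ} (hk : 1 ≤ k) {b : Bool} {T z : ℝ} (hT : T ∈ Ioo (5 : ℝ) 8)
    (hz : |z| < 1 / 8) : (hyperX k z T, Real.exp T) ∈ box k b := by
  have h := one_add_mul_pow_pos hk hT hz
  have h4 := hyperX_lt hk hT hz
  refine ⟨h4.trans (centerX_lt_centerX hk one_pos (by norm_num)), Real.exp_lt_exp.2 hT.2,
    Or.inr ⟨Real.exp_pos _, ?_, ?_⟩, Or.inl h4⟩
  · simp only [Real.log_exp, hyperX_aux hk h]
    positivity
  · simpa only [Real.log_exp, hyperZ_hyperX hk h] using hz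

theorem hyperZ_mem {k : ℕ} {b : Bool} {p : ℝ × ℝ} (hp : p ∈ box k b)
    (h : Real.exp 5 ≤ p.2) : 0 < p.2 ∧ Real.log p.2 ∈ Ico (5 : ℝ) 8 ∧
      0 < 1 / k - Real.log p.2 * p.1 ^ k ∧ |hyperZ k p.1 (Real.log p.2)| < 1 / 8 := by
  have h0 : 0 < p.2 := (Real.exp_pos _).trans_le h
  obtain ⟨-, h1, h2⟩ := hp.2.2.1.resolve_left (not_lt.2 h)
  exact ⟨h0, ⟨(Real.le_log_iff_exp_le h0).2 h, (Real.log_lt_iff_lt_exp h0).2 hp.2.1⟩, h1, h2⟩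

theorem contDiffAt_hyperCoord {k : ℕ} {b : Bool} {p : ℝ × ℝ} (hp : 0 < p.2)
    (h : 0 < 1 / k - Real.log p.2 * p.1 ^ k) :
    ContDiffAt ℝ ω (fun p : ℝ × ℝ => (stripTau b (13 / 2) (Real.log p.2),
      hyperZ k p.1 (Real.log p.2))) p :=
  ((contDiff_stripTau b _).contDiffAt.comp p (contDiffAt_snd.log hp.ne')).prodMk
    (contDiffAt_hyperZ hp h)

/-- The flow box around the end of the hyperbolic separatrix. -/
noncomputable def hyperStrip {k : ℕ} (hk : 1 ≤ k) (b : Bool) :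
    Strip (box k b) (boxField k b) (!b) where
  -- Here the time variable is `log y`, the first integral is the `z` of `hyperX`, and `13/2` is the
  -- midpoint of `(5, 8)`.
  coord p := (stripTau b (13 / 2) (Real.log p.2), hyperZ k p.1 (Real.log p.2))
  param r := (hyperX k r.2 (stripTime b (13 / 2) r.1), Real.exp (stripTime b (13 / 2) r.1))
  side := {p | p ∈ box k b ∧ Real.exp 5 < p.2}
  closedSide := {p | p ∈ box k b ∧ Real.exp 5 ≤ p.2}
  isOpen_side := (isOpen_box hk b).inter (isOpen_lt continuous_const continuous_snd)
  exists_isClosed := ⟨_, isClosed_le continuous_const continuous_snd, rfl⟩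
  side_subset p hp := ⟨hp.1, le_of_lt hp.2⟩
  mem_side p hp h := by
    have := (mem_of_stripTau_mem h).1
    refine ⟨hp.1, lt_of_le_of_ne hp.2 fun h4 => ?_⟩
    rw [← h4, Real.log_exp] at this
    norm_num at this
  continuousOn_coord p hp := by
    obtain ⟨h0, h1, h2, h3⟩ := hyperZ_mem hp.1 hp.2
    exact (contDiffAt_hyperCoord h0 h2).continuousAt.continuousWithinAt
  coord_fst_mem p hp := by
    obtain ⟨h0, h1, h2⟩ := hyperZ_mem hp.1 hp.2
    cases b <;> simp only [stripTau, timeSign, mem_Ico, mem_Ioc, if_true, Bool.false_eq_true,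
      if_false, Bool.not_true, Bool.not_false] at * <;> constructor <;> linarith
  coord_mem p hp := by
    obtain ⟨h0, h1, h2, h3⟩ := hyperZ_mem hp.1 (le_of_lt hp.2)
    have h5 : 5 < Real.log p.2 := (Real.lt_log_iff_exp_lt h0).2 hp.2
    have h6 := abs_lt.1 h3
    exact ⟨stripTau_mem ⟨by linarith, by linarith [h1.2]⟩, by linarith, h6.2⟩
  param_mem r hr := by
    have hT := stripTime_mem (b := b) (m := 13 / 2) hr.1
    have h8 : stripTime b (13 / 2) r.1 < 8 := by linarith [hT.2]
    have h5 : 5 < stripTime b (13 / 2) r.1 := by linarith [hT.1]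
    exact ⟨hyper_mem_box hk ⟨h5, h8⟩ (abs_lt.2 ⟨by linarith [hr.2.1], hr.2.2⟩),
      Real.exp_lt_exp.2 h5⟩
  coord_param r hr := by
    have hT := stripTime_mem (b := b) (m := 13 / 2) hr.1
    have h := one_add_mul_pow_pos hk (T := stripTime b (13 / 2) r.1)
      ⟨by linarith [hT.1], by linarith [hT.2]⟩ (abs_lt.2 ⟨by linarith [hr.2.1], hr.2.2⟩)
    simp only [Real.log_exp, stripTau_stripTime, hyperZ_hyperX hk h]
  param_coord p hp := by
    obtain ⟨h0, h1, h2, h3⟩ := hyperZ_mem hp.1 (le_of_lt hp.2)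
    simp only [stripTime_stripTau, hyperX_hyperZ hk h2, Real.exp_log h0]
  contDiffOn_coord p hp := by
    obtain ⟨h0, h1, h2, h3⟩ := hyperZ_mem hp.1 (le_of_lt hp.2)
    exact (contDiffAt_hyperCoord h0 h2).contDiffWithinAt
  contDiffOn_param r hr := by
    have hT := stripTime_mem (b := b) (m := 13 / 2) hr.1
    have h := one_add_mul_pow_pos hk (T := stripTime b (13 / 2) r.1)
      ⟨by linarith [hT.1], by linarith [hT.2]⟩ (abs_lt.2 ⟨by linarith [hr.2.1], hr.2.2⟩)
    have hs : ContDiffAt ℝ ω (fun r : ℝ × ℝ => stripTime b (13 / 2) r.1) r :=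
      (contDiff_stripTime b _).contDiffAt.comp r contDiffAt_fst
    exact ((ContDiffAt.comp r (contDiffAt_hyperX hk (r := (stripTime b (13 / 2) r.1, r.2)) h)
      (hs.prodMk contDiffAt_snd)).prodMk hs.exp).contDiffWithinAt
  hasDerivAt_param r hr := by
    have hT := stripTime_mem (b := b) (m := 13 / 2) hr.1
    have h := one_add_mul_pow_pos hk (T := stripTime b (13 / 2) r.1)
      ⟨by linarith [hT.1], by linarith [hT.2]⟩ (abs_lt.2 ⟨by linarith [hr.2.1], hr.2.2⟩)
    have hs := hasDerivAt_stripTime b (13 / 2) r.1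
    have h1 := (hasDerivAt_hyperX hk h).comp r.1 hs
    refine (h1.prodMk hs.exp).congr_deriv ?_
    simp only [boxField, normalField, Prod.smul_mk, smul_eq_mul, Prod.mk.injEq]
    constructor <;> ring

/-- In the center strip `y = e^T w` with `T ≤ 4` and `|w| < 1`, so `y` does not reach `e^5`. -/
theorem disjoint_strips {k : ℕ} (hk : 1 ≤ k) (b : Bool) :
    Disjoint (centerStrip hk b).side (hyperStrip hk b).side := by
  rw [Set.disjoint_left]
  intro p hp' hp''
  obtain ⟨hp, h4⟩ : p ∈ box k b ∧ centerX k 4 < p.1 := hp'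
  obtain ⟨-, h5⟩ : p ∈ box k b ∧ Real.exp 5 < p.2 := hp''
  obtain ⟨h0, h1, h2⟩ := centerT_mem hk hp (le_of_lt h4)
  have h3 := exp_mul_lt h1.2 (abs_lt_one_of_mem_twistRange h2)
  rw [mul_left_comm, ← Real.exp_add] at h3
  simp only [add_neg_cancel, Real.exp_zero, mul_one] at h3
  exact absurd h3 (not_lt.2 (le_of_lt h5))

/-- The strip through which the flow leaves the box. -/
noncomputable def boxExit {k : ℕ} (hk : 1 ≤ k) : ∀ b, Strip (box k b) (boxField k b) true
  | true => centerStrip hk true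
  | false => hyperStrip hk false

/-- The strip through which the flow enters the box. -/
noncomputable def boxEntry {k : ℕ} (hk : 1 ≤ k) : ∀ b, Strip (box k b) (boxField k b) false
  | true => hyperStrip hk true
  | false => centerStrip hk false

/-- The orbit on the axis through the exit strip. -/
noncomputable def exitAxis (k : ℕ) (b : Bool) (τ : ℝ) : ℝ × ℝ :=
  if b then (centerX k (stripTime b (5 / 2) τ), 0) else (0, Real.exp (stripTime b (13 / 2) τ))

/-- The orbit on the axis through the entry strip. -/
noncomputable def entryAxis (k : ℕ) (b : Bool) (τ : ℝ) : ℝ × ℝ :=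
  if b then (0, Real.exp (stripTime b (13 / 2) τ)) else (centerX k (stripTime b (5 / 2) τ), 0)

theorem zero_mem_twistRange (b : Bool) : (0 : ℝ) ∈ twistRange b :=
  mem_of_mem_nhds (twistRange_mem_nhds_zero b)

theorem centerAxis_mem_box {k : ℕ} (hk : 1 ≤ k) (b : Bool) {T : ℝ} (hT : 1 < T) :
    (centerX k T, (0 : ℝ)) ∈ box k b := by
  simpa using center_mem_box hk (b := b) (w := 0) hT (fun _ => zero_mem_twistRange b)
    (by simpa using Real.exp_pos 5)

theorem hyperAxis_mem_box {k : ℕ} (hk : 1 ≤ k) (b : Bool) {T : ℝ} (hT : T < 8) :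
    ((0 : ℝ), Real.exp T) ∈ box k b := by
  have hk0 : (0 : ℝ) < k := by positivity
  refine ⟨centerX_pos hk one_pos, Real.exp_lt_exp.2 hT, Or.inr ⟨Real.exp_pos _, ?_, ?_⟩,
    Or.inl (centerX_pos hk (by norm_num))⟩
  · simp [zero_pow (show k ≠ 0 by omega), hk0]
  · simp [hyperZ]

theorem hasDerivAt_hyperAxis (k : ℕ) (b : Bool) (m τ : ℝ) :
    HasDerivAt (fun τ => ((0 : ℝ), Real.exp (stripTime b m τ)))
      (boxField k b (0, Real.exp (stripTime b m τ))) τ := by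
  refine ((hasDerivAt_const τ (0 : ℝ)).prodMk (hasDerivAt_stripTime b m τ).exp).congr_deriv ?_
  simp only [boxField, normalField, Prod.smul_mk, smul_eq_mul, Prod.mk.injEq]
  constructor
  · simp
  · ring

theorem hasDerivAt_centerAxis {k : ℕ} (hk : 1 ≤ k) {b : Bool} {m τ : ℝ}
    (h : 0 < stripTime b m τ) :
    HasDerivAt (fun τ => (centerX k (stripTime b m τ), (0 : ℝ)))
      (boxField k b (centerX k (stripTime b m τ), 0)) τ := by
  refine (((hasDerivAt_centerX hk h).comp τ (hasDerivAt_stripTime b m τ)).prodMk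
    (hasDerivAt_const τ (0 : ℝ))).congr_deriv ?_
  simp only [boxField, normalField, Prod.smul_mk, smul_eq_mul, Prod.mk.injEq]
  constructor
  · ring
  · simp

theorem exitAxis_mem {k : ℕ} (hk : 1 ≤ k) (b : Bool) {τ : ℝ} (hτ : τ < 3) :
    exitAxis k b τ ∈ box k b := by
  cases b
  · exact hyperAxis_mem_box hk false (by simp [stripTime, timeSign]; linarith)
  · exact centerAxis_mem_box hk true (by simp [stripTime, timeSign]; linarith)

theorem entryAxis_mem {k : ℕ} (hk : 1 ≤ k) (b : Bool) {τ : ℝ} (hτ : 0 < τ) :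
    entryAxis k b τ ∈ box k b := by
  cases b
  · exact centerAxis_mem_box hk false (by simp [stripTime, timeSign]; linarith)
  · exact hyperAxis_mem_box hk true (by simp [stripTime, timeSign]; linarith)

theorem hasDerivAt_exitAxis {k : ℕ} (hk : 1 ≤ k) (b : Bool) {τ : ℝ} (hτ : τ < 3) :
    HasDerivAt (exitAxis k b) (boxField k b (exitAxis k b τ)) τ := by
  cases b
  · exact hasDerivAt_hyperAxis k false _ τ
  · exact hasDerivAt_centerAxis hk (by simp [stripTime, timeSign]; linarith)

theorem hasDerivAt_entryAxis {k : ℕ} (hk : 1 ≤ k) (b : Bool) {τ : ℝ} (hτ : 0 < τ) :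
    HasDerivAt (entryAxis k b) (boxField k b (entryAxis k b τ)) τ := by
  cases b
  · exact hasDerivAt_centerAxis hk (by simp [stripTime, timeSign]; linarith)
  · exact hasDerivAt_hyperAxis k true _ τ

theorem tendsto_exitAxis {k : ℕ} (hk : 1 ≤ k) (b : Bool) :
    Tendsto (exitAxis k b) atBot (𝓝 0) := by
  cases b
  · refine Tendsto.prodMk_nhds tendsto_const_nhds (Real.tendsto_exp_atBot.comp ?_)
    have : stripTime false (13 / 2) = fun τ => τ + 5 := by
      ext τ; simp [stripTime, timeSign]; ring
    rw [this]
    exact tendsto_atBot_add_const_right _ _ tendsto_id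
  · refine Tendsto.prodMk_nhds ((tendsto_centerX hk).comp ?_) tendsto_const_nhds
    have : stripTime true (5 / 2) = fun τ => -τ + 4 := by
      ext τ; simp [stripTime, timeSign]; ring
    rw [this]
    exact tendsto_atTop_add_const_right _ _ tendsto_neg_atBot_atTop

theorem tendsto_entryAxis {k : ℕ} (hk : 1 ≤ k) (b : Bool) :
    Tendsto (entryAxis k b) atTop (𝓝 0) := by
  cases b
  · refine Tendsto.prodMk_nhds ((tendsto_centerX hk).comp ?_) tendsto_const_nhds
    have : stripTime false (5 / 2) = fun τ => τ + 1 := by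
      ext τ; simp [stripTime, timeSign]; ring
    rw [this]
    exact tendsto_atTop_add_const_right _ _ tendsto_id
  · refine Tendsto.prodMk_nhds tendsto_const_nhds (Real.tendsto_exp_atBot.comp ?_)
    have : stripTime true (13 / 2) = fun τ => -τ + 8 := by
      ext τ; simp [stripTime, timeSign]; ring
    rw [this]
    exact tendsto_atBot_add_const_right _ _ tendsto_neg_atTop_atBot

theorem mk_zero_mem_stripRect {τ : ℝ} (hτ : τ ∈ Ioo (0 : ℝ) 3) : (τ, (0 : ℝ)) ∈ stripRect :=
  ⟨hτ, by norm_num, by norm_num⟩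

theorem boxExit_param_zero {k : ℕ} (hk : 1 ≤ k) (b : Bool) (τ : ℝ) :
    (boxExit hk b).param (τ, 0) = exitAxis k b τ := by
  cases b
  · simp [boxExit, hyperStrip, exitAxis, hyperX]
  · simp [boxExit, centerStrip, exitAxis, twist_zero]

theorem boxEntry_param_zero {k : ℕ} (hk : 1 ≤ k) (b : Bool) (τ : ℝ) :
    (boxEntry hk b).param (τ, 0) = entryAxis k b τ := by
  cases b
  · simp [boxEntry, centerStrip, entryAxis, twist_zero]
  · simp [boxEntry, hyperStrip, entryAxis, hyperX]

theorem boxExit_disjoint {k : ℕ} (hk : 1 ≤ k) (b : Bool) :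
    Disjoint (boxExit hk b).side (boxEntry hk b).side := by
  cases b
  · exact (disjoint_strips hk false).symm
  · exact disjoint_strips hk true

/-! ### The surface and the polycycle of the example -/

/-- The exponents of the four equilibria. -/
def cycleExponent : Fin 4 → ℕ := ![2, 2, 1, 1]

/-- The time directions of the four passages. -/
def cycleForward : Fin 4 → Bool := ![true, false, true, false]

theorem one_le_cycleExponent (i : Fin 4) : 1 ≤ cycleExponent i := by revert i; decide

theorem cycleForward_succ (i : Fin 4) : cycleForward (i + 1) = !cycleForward i := by
  revert i; decide

/-- The four boxes of the example. -/
noncomputable def boxCycle : StripCycle where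
  dom i := box (cycleExponent i) (cycleForward i)
  field i := boxField (cycleExponent i) (cycleForward i)
  isOpen_dom i := isOpen_box (one_le_cycleExponent i) _
  dom_nonempty i := ⟨0, zero_mem_box (one_le_cycleExponent i) _⟩
  contDiffOn_field _ := (contDiff_boxField _ _).contDiffOn
  exitStrip i := boxExit (one_le_cycleExponent i) _
  entryStrip i := boxEntry (one_le_cycleExponent i) _
  disjoint_side _ := boxExit_disjoint _ _

/-- The surface of the example. -/
noncomputable abbrev boxGluing : ChartGluing (Fin 4) := boxCycle.gluing

/-- The two strips share the coordinate rectangle, so each connection lies in one flow box that is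
described in the same way from both of its boxes. -/
theorem pt_exit_eq_pt_entry (i : Fin 4) {r : ℝ × ℝ} (hr : r ∈ stripRect) :
    boxGluing.pt i ((boxCycle.exitStrip i).param r) =
      boxGluing.pt (i + 1) ((boxCycle.entryStrip (i + 1)).param r) := by
  have h1 : (boxCycle.exitStrip i).param r ∈ boxGluing.overlap i (i + 1) := by
    change _ ∈ boxCycle.overlap i (i + 1)
    rw [StripCycle.overlap_next]
    exact (boxCycle.exitStrip i).param_mem r hr
  rw [← boxGluing.pt_trans h1]
  change boxGluing.pt (i + 1) (boxCycle.trans i (i + 1) _) = _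
  rw [StripCycle.trans_next]
  exact congrArg (fun r => boxGluing.pt (i + 1) ((boxCycle.entryStrip (i + 1)).param r))
    ((boxCycle.exitStrip i).coord_param r hr)

/-- The connection from the equilibrium `i` to the next one. -/
noncomputable def boxConnection (i : Fin 4) (τ : ℝ) : boxGluing.Space :=
  -- Any switching time in `(0, 3)` would do: both descriptions agree there by `pt_axis_eq`.
  if τ < 3 / 2 then boxGluing.pt i (exitAxis (cycleExponent i) (cycleForward i) τ)
  else boxGluing.pt (i + 1) (entryAxis (cycleExponent (i + 1)) (cycleForward (i + 1)) τ)

theorem pt_axis_eq (i : Fin 4) {τ : ℝ} (hτ : τ ∈ Ioo (0 : ℝ) 3) :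
    boxGluing.pt i (exitAxis (cycleExponent i) (cycleForward i) τ) =
      boxGluing.pt (i + 1) (entryAxis (cycleExponent (i + 1)) (cycleForward (i + 1)) τ) := by
  rw [← boxExit_param_zero (one_le_cycleExponent i), ← boxEntry_param_zero
    (one_le_cycleExponent (i + 1))]
  exact pt_exit_eq_pt_entry i (mk_zero_mem_stripRect hτ)

theorem boxConnection_eq_exit (i : Fin 4) {τ : ℝ} (hτ : τ < 3) : boxConnection i τ =
    boxGluing.pt i (exitAxis (cycleExponent i) (cycleForward i) τ) := by
  unfold boxConnection
  split_ifs with h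
  · rfl
  · exact (pt_axis_eq i ⟨by linarith, hτ⟩).symm

theorem boxConnection_eq_entry (i : Fin 4) {τ : ℝ} (hτ : 0 < τ) : boxConnection i τ =
    boxGluing.pt (i + 1) (entryAxis (cycleExponent (i + 1)) (cycleForward (i + 1)) τ) := by
  unfold boxConnection
  split_ifs with h
  · exact pt_axis_eq i ⟨hτ, by linarith⟩
  · rfl

theorem hasMFDerivAt_pt_comp (G : ChartGluing (Fin 4)) {i : Fin 4} {c : ℝ → ℝ × ℝ} {t : ℝ}
    (ht : c t ∈ G.dom i) (hc : HasDerivAt c (G.field i (c t)) t) :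
    HasMFDerivAt 𝓘(ℝ, ℝ) 𝓘(ℝ, ℝ × ℝ) (fun t => G.pt i (c t)) t
      ((1 : ℝ →L[ℝ] ℝ).smulRight (G.vectorField (G.pt i (c t)))) := by
  exact hasMFDerivWithinAt_univ.1 (G.hasMFDerivWithinAt_pt_comp ht hc.hasDerivWithinAt)

theorem boxConnection_integral (i : Fin 4) :
    IsMIntegralCurve (boxConnection i) boxGluing.vectorField := by
  intro τ
  rcases lt_or_ge τ 3 with h | h
  · rw [boxConnection_eq_exit i h]
    refine (hasMFDerivAt_pt_comp boxGluing (exitAxis_mem (one_le_cycleExponent i) _ h)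
      (hasDerivAt_exitAxis (one_le_cycleExponent i) _ h)).congr_of_eventuallyEq ?_
    filter_upwards [Iio_mem_nhds h] with t ht
    exact boxConnection_eq_exit i ht
  · have h : 0 < τ := by linarith
    rw [boxConnection_eq_entry i h]
    refine (hasMFDerivAt_pt_comp boxGluing (entryAxis_mem (one_le_cycleExponent (i + 1)) _ h)
      (hasDerivAt_entryAxis (one_le_cycleExponent (i + 1)) _ h)).congr_of_eventuallyEq ?_
    filter_upwards [Ioi_mem_nhds h] with t ht
    exact boxConnection_eq_entry i ht

theorem chart_boxConnection_exit (i : Fin 4) {τ : ℝ} (hτ : τ < 3) :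
    boxGluing.chart i (boxConnection i τ) = exitAxis (cycleExponent i) (cycleForward i) τ := by
  rw [boxConnection_eq_exit i hτ]
  exact boxGluing.chart_pt (exitAxis_mem (one_le_cycleExponent i) _ hτ)

theorem chart_boxConnection_entry (i : Fin 4) {τ : ℝ} (hτ : 0 < τ) :
    boxGluing.chart (i + 1) (boxConnection i τ) =
      entryAxis (cycleExponent (i + 1)) (cycleForward (i + 1)) τ := by
  rw [boxConnection_eq_entry i hτ]
  exact boxGluing.chart_pt (entryAxis_mem (one_le_cycleExponent (i + 1)) _ hτ)

theorem zero_mem_dom (i : Fin 4) : (0 : ℝ × ℝ) ∈ boxGluing.dom i :=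
  zero_mem_box (one_le_cycleExponent i) _

/-- The origin of a box lies in neither of its strips, so it is not identified with a point of
another box. -/
theorem pt_zero_injective : Function.Injective fun i => boxGluing.pt i 0 := by
  intro i j h
  obtain ⟨h1, -⟩ := (boxGluing.pt_eq_pt_iff (zero_mem_dom i) (zero_mem_dom j)).1 h
  have hc : ∀ k b (hk : 1 ≤ k), (0 : ℝ × ℝ) ∉ (centerStrip hk b).side := fun k b hk h =>
    absurd (show centerX k 4 < 0 from h.2) (centerX_pos hk (by norm_num)).le.not_gt
  have hh : ∀ k b (hk : 1 ≤ k), (0 : ℝ × ℝ) ∉ (hyperStrip hk b).side := fun k b hk h =>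
    absurd (show Real.exp 5 < 0 from h.2) (Real.exp_pos 5).le.not_gt
  have hout : ∀ k b (hk : 1 ≤ k), (0 : ℝ × ℝ) ∉ (boxExit hk b).side := by
    intro k b hk
    cases b
    · exact hh _ _ hk
    · exact hc _ _ hk
  have hin : ∀ k b (hk : 1 ≤ k), (0 : ℝ × ℝ) ∉ (boxEntry hk b).side := by
    intro k b hk
    cases b
    · exact hc _ _ hk
    · exact hh _ _ hk
  change (0 : ℝ × ℝ) ∈ boxCycle.overlap i j at h1
  rcases StripCycle.index_cases i j with rfl | rfl | rfl | rfl
  · rfl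
  · rw [StripCycle.overlap_next] at h1
    exact absurd h1 (hout _ _ _)
  · rw [StripCycle.overlap_prev] at h1
    exact absurd h1 (hin _ _ _)
  · rw [StripCycle.overlap_opposite] at h1
    exact h1.elim

theorem tendsto_pt_zero (i : Fin 4) : Tendsto (boxGluing.pt i) (𝓝 0) (𝓝 (boxGluing.pt i 0)) :=
  (boxGluing.contMDiffAt_pt (zero_mem_dom i)).continuousAt

/-- The polycycle of the example. -/
noncomputable def boxPolycycle : SimpleAlternantPolycycle boxGluing.vectorField 4 where
  equilibrium i := boxGluing.pt i 0
  equilibrium_injective := pt_zero_injective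
  exponent := cycleExponent
  one_le_exponent := one_le_cycleExponent
  fromHyperbolic i := cycleForward i = true
  chart := boxGluing.chart
  chart_mem := boxGluing.chart_mem_maximalAtlas
  mem_source i := boxGluing.pt_mem_source (zero_mem_dom i)
  chart_equilibrium i := boxGluing.chart_pt (zero_mem_dom i)
  factor i _ := timeSign (cycleForward i)
  factor_analytic _ := analyticOnNhd_const
  factor_pos i h p _ := by simp [h, timeSign]
  factor_neg i h p _ := by simp [h, timeSign]
  mfderiv_chart i x hx := boxGluing.mfderiv_chart i hx
  connection := boxConnection
  connection_integral := boxConnection_integral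
  connection_atBot i := by
    refine ((tendsto_pt_zero i).comp (tendsto_exitAxis (one_le_cycleExponent i) (cycleForward i))).congr' ?_
    filter_upwards [Iio_mem_atBot 3] with τ hτ
    exact (boxConnection_eq_exit i hτ).symm
  connection_atTop i := by
    refine ((tendsto_pt_zero (i + 1)).comp
      (tendsto_entryAxis (one_le_cycleExponent (i + 1)) (cycleForward (i + 1)))).congr' ?_
    filter_upwards [Ioi_mem_atTop 0] with τ hτ
    exact (boxConnection_eq_entry i hτ).symm
  leaves_center i h := by
    filter_upwards [Iio_mem_atBot 3] with τ hτ
    rw [chart_boxConnection_exit i hτ, h]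
    exact ⟨centerX_pos (one_le_cycleExponent i)
      (by simp [stripTime, timeSign]; linarith [show τ < 3 from hτ]), rfl⟩
  leaves_hyperbolic i h := by
    filter_upwards [Iio_mem_atBot 3] with τ hτ
    rw [chart_boxConnection_exit i hτ, Bool.eq_false_iff.2 h]
    exact ⟨rfl, Real.exp_pos _⟩
  arrives_hyperbolic i h := by
    filter_upwards [Ioi_mem_atTop 0] with τ hτ
    rw [chart_boxConnection_entry i hτ, h]
    exact ⟨rfl, Real.exp_pos _⟩
  arrives_center i h := by
    filter_upwards [Ioi_mem_atTop 0] with τ hτ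
    rw [chart_boxConnection_entry i hτ, Bool.eq_false_iff.2 h]
    exact ⟨centerX_pos (one_le_cycleExponent (i + 1))
      (by simp [stripTime, timeSign]; linarith [show 0 < τ from hτ]), rfl⟩
  alternates i := by
    rw [cycleForward_succ]
    cases cycleForward i <;> simp

/-! ### Sections -/

/-- Transversality may be tested in the chart: vectors with linearly independent images under its
derivative are linearly independent. -/
theorem ChartGluing.isSection_pt (G : ChartGluing (Fin 4)) {i : Fin 4} {s : ℝ → ℝ × ℝ}
    {γ : ℝ → G.Space} {s' : ℝ × ℝ} (hs : ContDiffAt ℝ ω s 0) (hs0 : s 0 ∈ G.dom i)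
    (hs' : HasDerivAt s s' 0) (hli : LinearIndependent ℝ ![s', G.field i (s 0)])
    (hγ : G.pt i (s 0) ∈ range γ) (hpos : ∀ᶠ z in 𝓝[>] (0 : ℝ), 0 < (s z).1 ∧ 0 < (s z).2) :
    IsSection G.vectorField (G.chart i) γ (fun z => G.pt i (s z)) := by
  have hc : ContMDiffAt 𝓘(ℝ, ℝ) 𝓘(ℝ, ℝ × ℝ) ω (fun z => G.pt i (s z)) 0 :=
    (G.contMDiffAt_pt hs0).comp 0 hs.contMDiffAt
  have hmem : ∀ᶠ z in 𝓝 (0 : ℝ), s z ∈ G.dom i :=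
    hs.continuousAt.eventually_mem ((G.isOpen_dom i).mem_nhds hs0)
  refine ⟨hc, ?_, hγ, G.pt_mem_source hs0, ?_⟩
  · have hsrc := G.pt_mem_source hs0
    have h1 := (G.contMDiffAt_chart hsrc).mdifferentiableAt (by simp)
    have h2 := hc.mdifferentiableAt (by simp)
    have h3 := mfderiv_comp (0 : ℝ) h1 h2
    have h4 : (G.chart i ∘ fun z => G.pt i (s z)) =ᶠ[𝓝 0] s := by
      filter_upwards [hmem] with z hz
      exact G.chart_pt hz
    rw [h4.mfderiv_eq, mfderiv_eq_fderiv] at h3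
    have h5 : mfderiv 𝓘(ℝ, ℝ × ℝ) 𝓘(ℝ, ℝ × ℝ) (G.chart i) (G.pt i (s 0))
        (mfderiv 𝓘(ℝ, ℝ) 𝓘(ℝ, ℝ × ℝ) (fun z => G.pt i (s z)) 0 (1 : ℝ)) = s' := by
      have h6 := congrArg (fun L : ℝ →L[ℝ] ℝ × ℝ => L 1) h3
      have h7 : fderiv ℝ s 0 1 = s' := by rw [fderiv_apply_one_eq_deriv]; exact hs'.deriv
      exact h6.symm.trans h7
    have h6 := G.mfderiv_chart i hsrc
    rw [G.chart_pt hs0] at h6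
    refine LinearIndependent.of_comp (mfderiv 𝓘(ℝ, ℝ × ℝ) 𝓘(ℝ, ℝ × ℝ) (G.chart i)
      (G.pt i (s 0))).toLinearMap ?_
    have h7 : (mfderiv 𝓘(ℝ, ℝ × ℝ) 𝓘(ℝ, ℝ × ℝ) (G.chart i) (G.pt i (s 0))).toLinearMap ∘
        ![mfderiv 𝓘(ℝ, ℝ) 𝓘(ℝ, ℝ × ℝ) (fun z => G.pt i (s z)) 0 (1 : ℝ),
          G.vectorField (G.pt i (s 0))] = ![s', G.field i (s 0)] := by
      funext j
      fin_cases j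
      · exact h5
      · exact h6
    exact h7 ▸ hli
  · filter_upwards [hpos, nhdsWithin_le_nhds hmem] with z hz hz'
    rwa [G.chart_pt hz']

/-- The section transverse to the center axis. -/
noncomputable def centerSection (k : ℕ) (w : ℝ) : ℝ × ℝ := (centerX k 3, Real.exp 3 * w)

/-- The section transverse to the hyperbolic axis. -/
noncomputable def hyperSection (k : ℕ) (z : ℝ) : ℝ × ℝ := (hyperX k z 6, Real.exp 6)

/-- The exit section of a box. -/
noncomputable def exitSection (k : ℕ) (b : Bool) : ℝ → ℝ × ℝ :=
  if b then centerSection k else hyperSection k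

/-- The entry section of a box. -/
noncomputable def entrySection (k : ℕ) (b : Bool) : ℝ → ℝ × ℝ :=
  if b then hyperSection k else centerSection k

/-- Exit sections are `τ = 1` and entry sections `τ = 2`. In both time directions this is `T = 3` on
the center side and `log y = 6` on the hyperbolic side. -/
theorem boxExit_param_section {k : ℕ} (hk : 1 ≤ k) (b : Bool) (z : ℝ) :
    (boxExit hk b).param (1, z) = exitSection k b z := by
  cases b
  · have h : stripTime false (13 / 2) 1 = 6 := by norm_num [stripTime, timeSign]
    simp [boxExit, hyperStrip, exitSection, hyperSection, h]
  · have h : stripTime true (5 / 2) 1 = 3 := by norm_num [stripTime, timeSign]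
    simp [boxExit, centerStrip, exitSection, centerSection, h, twist]

/-- The natural parameter of the entry section is `twist b c` and not `c`; this is how `z + z²`
becomes a transit map. -/
theorem boxEntry_param_section {k : ℕ} (hk : 1 ≤ k) (b : Bool) (c : ℝ) :
    (boxEntry hk b).param (2, c) = entrySection k b (twist b c) := by
  cases b
  · have h : stripTime false (5 / 2) 2 = 3 := by norm_num [stripTime, timeSign]
    simp [boxEntry, centerStrip, entrySection, centerSection, h]
  · have h : stripTime true (13 / 2) 2 = 6 := by norm_num [stripTime, timeSign]
    simp [boxEntry, hyperStrip, entrySection, hyperSection, h, twist]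

theorem contDiffAt_centerSection (k : ℕ) : ContDiffAt ℝ ω (centerSection k) 0 :=
  contDiffAt_const.prodMk (contDiffAt_const.mul contDiffAt_id)

theorem contDiffAt_hyperSection {k : ℕ} (hk : 1 ≤ k) : ContDiffAt ℝ ω (hyperSection k) 0 := by
  have h : (0 : ℝ) < 1 + (6 : ℝ) * (0 : ℝ) ^ k := by simp [zero_pow (show k ≠ 0 by omega)]
  exact (ContDiffAt.comp (g := fun r : ℝ × ℝ => hyperX k r.2 r.1) (f := fun z : ℝ => ((6 : ℝ), z))
    (0 : ℝ) (contDiffAt_hyperX hk (r := (6, 0)) h)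
    (contDiffAt_const.prodMk contDiffAt_id)).prodMk contDiffAt_const

theorem hasDerivAt_centerSection (k : ℕ) :
    HasDerivAt (centerSection k) ((0 : ℝ), Real.exp 3) 0 := by
  refine ((hasDerivAt_const (0 : ℝ) (centerX k 3)).prodMk
    ((hasDerivAt_id (0 : ℝ)).const_mul (Real.exp 3))).congr_deriv ?_
  simp

theorem hasDerivAt_hyperSection {k : ℕ} (hk : 1 ≤ k) :
    HasDerivAt (hyperSection k) (invRoot k k, (0 : ℝ)) 0 := by
  have hk0 : k ≠ 0 := by omega
  have hkk : (0 : ℝ) < k := by positivity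
  have h1 : ContDiffAt ℝ ω (fun z : ℝ => invRoot k (k * (1 + 6 * z ^ k))) 0 :=
    ContDiffAt.comp (0 : ℝ) (contDiffAt_invRoot k (by simp [zero_pow hk0, hkk]))
      (contDiffAt_const.mul (contDiffAt_const.add (contDiffAt_const.mul (contDiffAt_id.pow k))))
  have h2 := (hasDerivAt_id (0 : ℝ)).mul (h1.differentiableAt (by simp)).hasDerivAt
  refine (h2.prodMk (hasDerivAt_const (0 : ℝ) (Real.exp 6))).congr_deriv ?_
  simp [zero_pow hk0]

theorem hyperX_pos {k : ℕ} (hk : 1 ≤ k) {z T : ℝ} (hz : 0 < z) (hT : 0 < T) :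
    0 < hyperX k z T := mul_pos hz (invRoot_pos _ (by positivity))

theorem sections_pos {k : ℕ} (hk : 1 ≤ k) {z : ℝ} (hz : 0 < z) :
    (0 < (centerSection k z).1 ∧ 0 < (centerSection k z).2) ∧
      0 < (hyperSection k z).1 ∧ 0 < (hyperSection k z).2 :=
  ⟨⟨centerX_pos hk (by norm_num), mul_pos (Real.exp_pos _) hz⟩,
    hyperX_pos hk hz (by norm_num), Real.exp_pos _⟩

theorem linearIndependent_centerSection {k : ℕ} (hk : 1 ≤ k) (b : Bool) :
    LinearIndependent ℝ ![((0 : ℝ), Real.exp 3), boxField k b (centerSection k 0)] := by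
  have h1 : 0 < centerX k 3 := centerX_pos hk (by norm_num)
  rw [LinearIndependent.pair_iff]
  intro s t h
  simp only [boxField, normalField, centerSection, Prod.smul_mk, Prod.mk_add_mk, Prod.mk_eq_zero,
    smul_eq_mul, mul_zero, neg_zero, zero_add, add_zero, mul_eq_zero, (Real.exp_pos 3).ne',
    or_false] at h
  refine ⟨h.2, h.1.resolve_right ?_⟩
  rintro (h | h)
  · cases b <;> simp [timeSign] at h
  · exact absurd h (by positivity)

theorem linearIndependent_hyperSection {k : ℕ} (hk : 1 ≤ k) (b : Bool) :
    LinearIndependent ℝ ![(invRoot k k, (0 : ℝ)), boxField k b (hyperSection k 0)] := by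
  have h1 : 0 < invRoot k k := invRoot_pos _ (by positivity)
  rw [LinearIndependent.pair_iff]
  intro s t h
  have h0 : hyperX k 0 6 = 0 := by simp [hyperX]
  simp only [boxField, normalField, hyperSection, Prod.smul_mk, Prod.mk_add_mk, Prod.mk_eq_zero,
    smul_eq_mul, mul_zero, zero_add, add_zero, mul_eq_zero, h1.ne', h0, neg_eq_zero, ne_eq,
    Nat.add_eq_zero_iff, one_ne_zero, and_false, not_false_eq_true, zero_pow,
    or_false, (Real.exp_pos 6).ne'] at h
  refine ⟨h.1, h.2.resolve_right ?_⟩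
  intro h
  cases b <;> simp [timeSign] at h

/-- The exit sections on the surface. -/
noncomputable def surfaceExit (i : Fin 4) (z : ℝ) : boxGluing.Space :=
  boxGluing.pt i (exitSection (cycleExponent i) (cycleForward i) z)

/-- The entry sections on the surface. -/
noncomputable def surfaceEntry (i : Fin 4) (z : ℝ) : boxGluing.Space :=
  boxGluing.pt i (entrySection (cycleExponent i) (cycleForward i) z)

theorem exitSection_zero {k : ℕ} (hk : 1 ≤ k) (b : Bool) :
    exitSection k b 0 = exitAxis k b 1 := by
  rw [← boxExit_param_section hk, boxExit_param_zero]

theorem entrySection_zero {k : ℕ} (hk : 1 ≤ k) (b : Bool) :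
    entrySection k b 0 = entryAxis k b 2 := by
  rw [← boxEntry_param_zero hk, boxEntry_param_section, twist_zero]

theorem isSection_surfaceExit (i : Fin 4) :
    IsSection boxGluing.vectorField (boxPolycycle.chart i) (boxPolycycle.connection i)
      (surfaceExit i) := by
  have hk := one_le_cycleExponent i
  have h0 := exitSection_zero hk (cycleForward i)
  have hmem := exitAxis_mem hk (cycleForward i) (τ := 1) (by norm_num)
  have hγ : boxGluing.pt i (exitSection (cycleExponent i) (cycleForward i) 0) ∈
      range (boxConnection i) := ⟨1, by rw [h0, boxConnection_eq_exit i (by norm_num)]⟩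
  rw [← h0] at hmem
  have hf : boxGluing.field i = boxField (cycleExponent i) (cycleForward i) := rfl
  have hd : boxGluing.dom i = box (cycleExponent i) (cycleForward i) := rfl
  unfold surfaceExit
  generalize cycleForward i = b at *
  cases b
  · exact boxGluing.isSection_pt (contDiffAt_hyperSection hk) (hd ▸ hmem) (hasDerivAt_hyperSection hk)
      (by rw [hf]; exact linearIndependent_hyperSection hk false) hγ
      (by filter_upwards [self_mem_nhdsWithin] with z hz using (sections_pos hk hz).2)
  · exact boxGluing.isSection_pt (contDiffAt_centerSection _) (hd ▸ hmem) (hasDerivAt_centerSection _)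
      (by rw [hf]; exact linearIndependent_centerSection hk true) hγ
      (by filter_upwards [self_mem_nhdsWithin] with z hz using (sections_pos hk hz).1)

theorem isSection_surfaceEntry (i : Fin 4) :
    IsSection boxGluing.vectorField (boxPolycycle.chart (i + 1)) (boxPolycycle.connection i)
      (surfaceEntry (i + 1)) := by
  have hk := one_le_cycleExponent (i + 1)
  have h0 := entrySection_zero hk (cycleForward (i + 1))
  have hmem := entryAxis_mem hk (cycleForward (i + 1)) (τ := 2) (by norm_num)
  have hγ : boxGluing.pt (i + 1) (entrySection (cycleExponent (i + 1)) (cycleForward (i + 1)) 0) ∈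
      range (boxConnection i) := ⟨2, by rw [h0, boxConnection_eq_entry i (by norm_num)]⟩
  rw [← h0] at hmem
  have hf : boxGluing.field (i + 1) = boxField (cycleExponent (i + 1)) (cycleForward (i + 1)) := rfl
  have hd : boxGluing.dom (i + 1) = box (cycleExponent (i + 1)) (cycleForward (i + 1)) := rfl
  unfold surfaceEntry
  generalize cycleForward (i + 1) = b at *
  cases b
  · exact boxGluing.isSection_pt (contDiffAt_centerSection _) (hd ▸ hmem) (hasDerivAt_centerSection _)
      (by rw [hf]; exact linearIndependent_centerSection hk false) hγ
      (by filter_upwards [self_mem_nhdsWithin] with z hz using (sections_pos hk hz).1)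
  · exact boxGluing.isSection_pt (contDiffAt_hyperSection hk) (hd ▸ hmem) (hasDerivAt_hyperSection hk)
      (by rw [hf]; exact linearIndependent_hyperSection hk true) hγ
      (by filter_upwards [self_mem_nhdsWithin] with z hz using (sections_pos hk hz).2)

/-! ### Transit maps -/

section FlowsTo

variable {M : Type*} [TopologicalSpace M] [ChartedSpace (ℝ × ℝ) M]
  {V : (x : M) → TangentSpace 𝓘(ℝ, ℝ × ℝ) x} {S A : Set M} {σ τ ρ : ℝ → M} {T T' : ℝ → ℝ}

/-- For small `z > 0` the orbit of `σ z` reaches `τ (T z)`, close to `S` and avoiding `A` in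
between. -/
def FlowsTo (V : (x : M) → TangentSpace 𝓘(ℝ, ℝ × ℝ) x) (S A : Set M) (σ τ : ℝ → M)
    (T : ℝ → ℝ) : Prop :=
  ∀ U ∈ 𝓝ˢ S, ∀ᶠ z in 𝓝[>] (0 : ℝ), ∃ s > 0, ∃ γ : ℝ → M, IsMIntegralCurveOn γ V (Icc 0 s) ∧
    γ 0 = σ z ∧ γ s = τ (T z) ∧ (∀ t ∈ Ioo 0 s, γ t ∉ A) ∧ ∀ t ∈ Icc 0 s, γ t ∈ U

theorem FlowsTo.isTransitMap {ε : ℝ} (hε : 0 < ε) (hinj : InjOn τ (Ico 0 ε))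
    (h : FlowsTo V S (τ '' Ioo 0 ε) σ τ T) (hT : Tendsto T (𝓝[>] 0) (𝓝[>] 0)) :
    IsTransitMap V S σ τ T := by
  refine ⟨ε, hε, hinj, fun U hU => ?_⟩
  filter_upwards [h U hU, hT.eventually (Ioo_mem_nhdsGT hε)] with z hz hz'
  exact ⟨hz', hz⟩

/-- At the junction the derivatives within the two adjacent intervals coincide, as both are the
field at the same point, and they combine to a derivative within the union. -/
theorem IsMIntegralCurveOn.append {γ₁ γ₂ : ℝ → M} {s₁ s₂ : ℝ} (hs₁ : 0 < s₁) (hs₂ : 0 < s₂)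
    (h₁ : IsMIntegralCurveOn γ₁ V (Icc 0 s₁)) (h₂ : IsMIntegralCurveOn γ₂ V (Icc 0 s₂))
    (h : γ₁ s₁ = γ₂ 0) :
    IsMIntegralCurveOn (fun t => if t ≤ s₁ then γ₁ t else γ₂ (t - s₁)) V (Icc 0 (s₁ + s₂)) := by
  set γ : ℝ → M := fun t => if t ≤ s₁ then γ₁ t else γ₂ (t - s₁) with hγ
  have h₂' : IsMIntegralCurveOn (fun t => γ₂ (t - s₁)) V (Icc s₁ (s₁ + s₂)) := by
    refine ((isMIntegralCurveOn_comp_sub (dt := s₁)).2 h₂).mono fun t ht => ?_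
    exact ⟨by linarith [ht.1], by linarith [ht.2]⟩
  have e₁ : EqOn γ γ₁ (Icc 0 s₁) := fun t ht => by simp [hγ, ht.2]
  have e₂ : EqOn γ (fun t => γ₂ (t - s₁)) (Icc s₁ (s₁ + s₂)) := fun t ht => by
    rcases ht.1.eq_or_lt with rfl | hlt
    · simp [hγ, h]
    · simp [hγ, hlt]
  have d₁ : ∀ t ∈ Icc 0 s₁, HasMFDerivWithinAt 𝓘(ℝ, ℝ) 𝓘(ℝ, ℝ × ℝ) γ (Icc 0 s₁) t
      ((1 : ℝ →L[ℝ] ℝ).smulRight (V (γ t))) := by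
    intro t ht
    rw [e₁ ht]
    exact (h₁ t ht).congr_of_eventuallyEq (e₁.eventuallyEq_nhdsWithin) (e₁ ht)
  have d₂ : ∀ t ∈ Icc s₁ (s₁ + s₂),
      HasMFDerivWithinAt 𝓘(ℝ, ℝ) 𝓘(ℝ, ℝ × ℝ) γ (Icc s₁ (s₁ + s₂)) t
        ((1 : ℝ →L[ℝ] ℝ).smulRight (V (γ t))) := by
    intro t ht
    rw [e₂ ht]
    exact (h₂' t ht).congr_of_eventuallyEq (e₂.eventuallyEq_nhdsWithin) (e₂ ht)
  intro t ht
  rcases lt_trichotomy t s₁ with hlt | rfl | hlt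
  · refine (d₁ t ⟨ht.1, hlt.le⟩).mono_of_mem_nhdsWithin ?_
    filter_upwards [self_mem_nhdsWithin, nhdsWithin_le_nhds (Iio_mem_nhds hlt)] with x hx hx'
    exact ⟨hx.1, le_of_lt hx'⟩
  · rw [← Icc_union_Icc_eq_Icc hs₁.le (by linarith : t ≤ t + s₂)]
    exact (d₁ t ⟨hs₁.le, le_rfl⟩).union (d₂ t ⟨le_rfl, by linarith⟩)
  · refine (d₂ t ⟨hlt.le, ht.2⟩).mono_of_mem_nhdsWithin ?_
    filter_upwards [self_mem_nhdsWithin, nhdsWithin_le_nhds (Ioi_mem_nhds hlt)] with x hx hx'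
    exact ⟨le_of_lt hx', hx.2⟩

/-- The avoided set `A` is the same for all pieces, so that a first return can be composed from
transits. Each piece avoids `A` at interior times only, so the junction points need `hA`. -/
theorem FlowsTo.comp (h₁ : FlowsTo V S A σ τ T) (h₂ : FlowsTo V S A τ ρ T')
    (hT : Tendsto T (𝓝[>] 0) (𝓝[>] 0)) (hA : ∀ᶠ z in 𝓝[>] 0, τ z ∉ A) :
    FlowsTo V S A σ ρ (T' ∘ T) := by
  intro U hU
  filter_upwards [h₁ U hU, hT.eventually (h₂ U hU), hT.eventually hA] with z hz hz' hzA
  obtain ⟨s₁, hs₁, γ₁, hi₁, h0₁, hs₁', hA₁, hU₁⟩ := hz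
  obtain ⟨s₂, hs₂, γ₂, hi₂, h0₂, hs₂', hA₂, hU₂⟩ := hz'
  refine ⟨s₁ + s₂, by linarith, _, hi₁.append hs₁ hs₂ hi₂ (hs₁'.trans h0₂.symm), ?_, ?_, ?_, ?_⟩
  · simp [hs₁.le, h0₁]
  · simp [hs₂, hs₂']
  · intro t ht
    split_ifs with h
    · rcases h.eq_or_lt with rfl | h
      · rwa [hs₁']
      · exact hA₁ t ⟨ht.1, h⟩
    · exact hA₂ _ ⟨by linarith, by linarith [ht.2]⟩
  · intro t ht
    split_ifs with h
    · exact hU₁ t ⟨ht.1, h⟩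
    · exact hU₂ _ ⟨by linarith, by linarith [ht.2]⟩

end FlowsTo

theorem isOpen_preimage_pt (i : Fin 4) {U : Set boxGluing.Space} (hU : IsOpen U) :
    IsOpen (boxGluing.dom i ∩ boxGluing.pt i ⁻¹' U) :=
  (boxGluing.contMDiffOn_pt i).continuousOn.isOpen_inter_preimage (boxGluing.isOpen_dom i) hU

theorem pt_exitAxis_mem_carrier (i : Fin 4) {τ : ℝ} (hτ : τ < 3) :
    boxGluing.pt i (exitAxis (cycleExponent i) (cycleForward i) τ) ∈ boxPolycycle.carrier :=
  Or.inr (mem_iUnion.2 ⟨i, τ, boxConnection_eq_exit i hτ⟩)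

theorem pt_entryAxis_mem_carrier (i : Fin 4) {τ : ℝ} (hτ : 0 < τ) :
    boxGluing.pt i (entryAxis (cycleExponent i) (cycleForward i) τ) ∈ boxPolycycle.carrier := by
  obtain ⟨j, rfl⟩ : ∃ j, i = j + 1 := ⟨i - 1, by simp⟩
  exact Or.inr (mem_iUnion.2 ⟨j, τ, boxConnection_eq_entry j hτ⟩)

theorem pt_zero_mem_carrier (i : Fin 4) : boxGluing.pt i 0 ∈ boxPolycycle.carrier :=
  Or.inl ⟨i, rfl⟩

theorem pt_axes_mem_carrier (i : Fin 4) :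
    (∀ T > 1, boxGluing.pt i (centerX (cycleExponent i) T, 0) ∈ boxPolycycle.carrier) ∧
      ∀ T < 8, boxGluing.pt i (0, Real.exp T) ∈ boxPolycycle.carrier := by
  have h1 := fun τ h => pt_exitAxis_mem_carrier i (τ := τ) h
  have h2 := fun τ h => pt_entryAxis_mem_carrier i (τ := τ) h
  generalize cycleForward i = b at *
  cases b
  · constructor
    · intro T hT
      have := h2 (stripTau false (5 / 2) T) (by simp [stripTau, timeSign]; linarith)
      simpa [entryAxis, stripTime_stripTau] using this
    · intro T hT
      have := h1 (stripTau false (13 / 2) T) (by simp [stripTau, timeSign]; linarith)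
      simpa [exitAxis, stripTime_stripTau] using this
  · constructor
    · intro T hT
      have := h1 (stripTau true (5 / 2) T) (by simp [stripTau, timeSign]; linarith)
      simpa [exitAxis, stripTime_stripTau] using this
    · intro T hT
      have := h2 (stripTau true (13 / 2) T) (by simp [stripTau, timeSign]; linarith)
      simpa [entryAxis, stripTime_stripTau] using this

theorem center_axis_mem (i : Fin 4) {U : Set boxGluing.Space} (hU : boxPolycycle.carrier ⊆ U) :
    Icc 0 (centerX (cycleExponent i) 3) ×ˢ {(0 : ℝ)} ⊆
      boxGluing.dom i ∩ boxGluing.pt i ⁻¹' U := by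
  rintro ⟨x, y⟩ ⟨hx, hy⟩
  obtain rfl : y = 0 := hy
  have hk := one_le_cycleExponent i
  rcases hx.1.eq_or_lt with h | h
  · obtain rfl : (0 : ℝ) = x := h
    exact ⟨zero_mem_dom i, hU (pt_zero_mem_carrier i)⟩
  · have h3 : 1 < centerT (cycleExponent i) x := by
      have := (le_centerX_iff hk h (by norm_num)).1 hx.2
      linarith
    have := hU ((pt_axes_mem_carrier i).1 _ h3)
    have h4 := centerAxis_mem_box hk (cycleForward i) h3
    rw [centerX_centerT hk h] at this h4
    exact ⟨h4, this⟩

theorem hyper_axis_mem (i : Fin 4) {U : Set boxGluing.Space} (hU : boxPolycycle.carrier ⊆ U) :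
    {(0 : ℝ)} ×ˢ Icc 0 (Real.exp 6) ⊆ boxGluing.dom i ∩ boxGluing.pt i ⁻¹' U := by
  rintro ⟨x, y⟩ ⟨hx, hy⟩
  obtain rfl : x = 0 := hx
  have hk := one_le_cycleExponent i
  rcases hy.1.eq_or_lt with h | h
  · obtain rfl : (0 : ℝ) = y := h
    exact ⟨zero_mem_dom i, hU (pt_zero_mem_carrier i)⟩
  · have h3 : Real.log y < 8 := (Real.log_lt_iff_lt_exp h).2
      (hy.2.trans_lt (Real.exp_lt_exp.2 (by norm_num)))
    have := hU ((pt_axes_mem_carrier i).2 _ h3)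
    have h4 := hyperAxis_mem_box hk (cycleForward i) h3
    rw [Real.exp_log h] at this h4
    exact ⟨h4, this⟩

/-- Orbits through the corner stay close to the axes. -/
theorem eventually_corner_mem (i : Fin 4) {U : Set boxGluing.Space}
    (hU : U ∈ 𝓝ˢ boxPolycycle.carrier) : ∀ᶠ w in 𝓝[>] (0 : ℝ), ∀ T ∈ Icc 3 (6 - Real.log w),
      (centerX (cycleExponent i) T, Real.exp T * w) ∈ boxGluing.dom i ∧
        boxGluing.pt i (centerX (cycleExponent i) T, Real.exp T * w) ∈ U := by
  have hk := one_le_cycleExponent i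
  obtain ⟨U', hU', hSU', hUU'⟩ := mem_nhdsSet_iff_exists.1 hU
  set W := boxGluing.dom i ∩ boxGluing.pt i ⁻¹' U' with hW
  have hWo : IsOpen W := isOpen_preimage_pt i hU'
  -- Two tubes cover the orbit. For `T ≥ T₀` the coordinate `x` is small and the tube around the
  -- hyperbolic axis applies; for `T < T₀` one has `y ≤ e^(T₀) w`, which is small with `w`, and the
  -- tube around the center axis applies.
  obtain ⟨u, v, hu, hv, hu', hv', huv⟩ := generalized_tube_lemma isCompact_singleton isCompact_Icc
    hWo (hyper_axis_mem i hSU')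
  obtain ⟨u2, v2, hu2, hv2, hu2', hv2', huv2⟩ := generalized_tube_lemma isCompact_Icc
    isCompact_singleton hWo (center_axis_mem i hSU')
  have h1 : ∀ᶠ T in atTop, centerX (cycleExponent i) T ∈ u :=
    (tendsto_centerX hk).eventually (hu.mem_nhds (hu' rfl))
  obtain ⟨T₀, hT₀⟩ := eventually_atTop.1 h1
  obtain ⟨δ, hδ, hδv⟩ := Metric.isOpen_iff.1 hv2 0 (hv2' rfl)
  have h2 : ∀ᶠ w in 𝓝[>] (0 : ℝ), Real.exp T₀ * w < δ := by
    have : Tendsto (fun w => Real.exp T₀ * w) (𝓝[>] (0 : ℝ)) (𝓝 0) := by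
      have : Tendsto (fun w => Real.exp T₀ * w) (𝓝 (0 : ℝ)) (𝓝 (Real.exp T₀ * 0)) :=
        (continuous_const.mul continuous_id).tendsto 0
      rw [mul_zero] at this
      exact this.mono_left nhdsWithin_le_nhds
    exact this.eventually (gt_mem_nhds hδ)
  filter_upwards [h2, self_mem_nhdsWithin] with w hw hw0 T hT
  have hw0 : 0 < w := hw0
  have h3 : (centerX (cycleExponent i) T, Real.exp T * w) ∈ W := by
    have hy : 0 < Real.exp T * w := by positivity
    rcases le_or_gt T₀ T with h | h
    · refine huv ⟨hT₀ T h, hv' ⟨hy.le, ?_⟩⟩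
      calc Real.exp T * w ≤ Real.exp (6 - Real.log w) * w := by
            gcongr; exact hT.2
        _ = Real.exp 6 := by
            rw [Real.exp_sub, Real.exp_log hw0]; field_simp
    · refine huv2 ⟨hu2' ⟨(centerX_pos hk (by linarith [hT.1])).le,
        centerX_le_centerX hk (by norm_num) hT.1⟩, hδv ?_⟩
      rw [Metric.mem_ball, Real.dist_eq, sub_zero, abs_of_pos hy]
      refine lt_of_le_of_lt ?_ hw
      gcongr
  exact ⟨h3.1, hUU' h3.2⟩

theorem hasDerivAt_corner {k : ℕ} (hk : 1 ≤ k) (w : ℝ) {T : ℝ} (hT : 0 < T) :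
    HasDerivAt (fun T => (centerX k T, Real.exp T * w))
      (-normalField k (centerX k T, Real.exp T * w)) T := by
  refine ((hasDerivAt_centerX hk hT).prodMk ((Real.hasDerivAt_exp T).mul_const w)).congr_deriv ?_
  simp [normalField]

/-- The orbit with the first integral `w` reaches `y = e^6` at `T = 6 - log w`. Comparison with `T =
z^(-k) + 6` gives `z^(-k) = -log w`: the corner passage has a closed form. -/
theorem hyperSection_eq {k : ℕ} (hk : 1 ≤ k) {w : ℝ} (hw : 0 < w) (hw1 : w < 1) :
    hyperSection k (invRoot k (-Real.log w)) =
      (centerX k (6 - Real.log w), Real.exp (6 - Real.log w) * w) := by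
  have hL : 0 < -Real.log w := by have := Real.log_neg hw hw1; linarith
  have hL' : 0 < 6 - Real.log w := by linarith
  have hz := invRoot_pos k hL
  have hk0 : (0 : ℝ) < k := by positivity
  rw [hyperSection, Prod.mk.injEq]
  constructor
  · refine eq_invRoot hk (hyperX_pos hk hz (by norm_num)) (by positivity) ?_
    rw [hyperX_pow hk (by positivity), invRoot_pow hk hL, sub_eq_add_neg]
    generalize -Real.log w = L at *
    have : L + 6 ≠ 0 := by linarith
    field_simp
    rw [add_comm]
  · rw [Real.exp_sub, Real.exp_log hw]; field_simp

/-- The passage through the box with the exponent `k`. -/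
noncomputable def cornerMap (k : ℕ) (b : Bool) (z : ℝ) : ℝ :=
  if b then Real.exp (-(z ^ k)⁻¹) else invRoot k (-Real.log z)

theorem tendsto_cornerMap_true {k : ℕ} (hk : 1 ≤ k) :
    Tendsto (cornerMap k true) (𝓝[>] 0) (𝓝[>] 0) := by
  have h1 : Tendsto (fun z : ℝ => z ^ k) (𝓝[>] 0) (𝓝[>] 0) := by
    refine tendsto_nhdsWithin_iff.2 ⟨?_, ?_⟩
    · have := ((continuous_pow k).tendsto (0 : ℝ)).mono_left (nhdsWithin_le_nhds (s := Ioi 0))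
      rwa [zero_pow (by omega)] at this
    · filter_upwards [self_mem_nhdsWithin] with z hz using pow_pos (mem_Ioi.1 hz) k
  refine tendsto_nhdsWithin_iff.2 ⟨?_, Eventually.of_forall fun z => Real.exp_pos _⟩
  exact Real.tendsto_exp_atBot.comp (tendsto_neg_atTop_atBot.comp
    (tendsto_inv_nhdsGT_zero.comp h1))

theorem tendsto_cornerMap_false {k : ℕ} (hk : 1 ≤ k) :
    Tendsto (cornerMap k false) (𝓝[>] 0) (𝓝[>] 0) := by
  refine tendsto_nhdsWithin_iff.2 ⟨?_, ?_⟩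
  · exact (tendsto_rpow_neg_atTop (y := 1 / (k : ℝ)) (by positivity)).comp
      (tendsto_neg_atBot_atTop.comp Real.tendsto_log_nhdsGT_zero)
  · filter_upwards [Ioo_mem_nhdsGT one_pos] with z hz
    exact invRoot_pos k (by have := Real.log_neg hz.1 hz.2; linarith)

theorem tendsto_cornerMap {k : ℕ} (hk : 1 ≤ k) (b : Bool) :
    Tendsto (cornerMap k b) (𝓝[>] 0) (𝓝[>] 0) := by
  cases b
  · exact tendsto_cornerMap_false hk
  · exact tendsto_cornerMap_true hk

theorem tendsto_twist (b : Bool) : Tendsto (twist b) (𝓝[>] 0) (𝓝[>] 0) := by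
  refine tendsto_nhdsWithin_iff.2 ⟨?_, ?_⟩
  · have := ((contDiff_twist b).continuous.tendsto 0).mono_left (nhdsWithin_le_nhds (s := Ioi 0))
    rwa [twist_zero] at this
  · filter_upwards [self_mem_nhdsWithin] with z hz
    have hz : 0 < z := hz
    cases b
    · change 0 < z + z ^ 2; positivity
    · exact hz

/-- The points between the entry and the exit section of a box. -/
def cornerRegion (k : ℕ) : Set (ℝ × ℝ) :=
  {p | 0 < p.1 ∧ p.1 < centerX k 3 ∧ 0 < p.2 ∧ p.2 < Real.exp 6}

theorem corner_mem_cornerRegion {k : ℕ} (hk : 1 ≤ k) {w T : ℝ} (hw : 0 < w)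
    (hT : T ∈ Ioo 3 (6 - Real.log w)) : (centerX k T, Real.exp T * w) ∈ cornerRegion k := by
  refine ⟨centerX_pos hk (by linarith [hT.1]), centerX_lt_centerX hk (by norm_num) hT.1,
    by positivity, ?_⟩
  calc Real.exp T * w < Real.exp (6 - Real.log w) * w := by
        gcongr; exact hT.2
    _ = Real.exp 6 := by
        rw [Real.exp_sub, Real.exp_log hw]; field_simp

/-- Both time directions use the same arc, `T` between `3` and `6 - log w`; only the direction in
which it is traversed differs. -/
theorem flowsTo_corner (i : Fin 4) {A : Set boxGluing.Space}
    (hA : ∀ p ∈ cornerRegion (cycleExponent i), p ∈ boxGluing.dom i → boxGluing.pt i p ∉ A) :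
    FlowsTo boxGluing.vectorField boxPolycycle.carrier A (surfaceEntry i) (surfaceExit i)
      (cornerMap (cycleExponent i) (cycleForward i)) := by
  have hk := one_le_cycleExponent i
  intro U hU
  have h1 := eventually_corner_mem i hU
  have hf : boxGluing.field i = boxField (cycleExponent i) (cycleForward i) := rfl
  have hdom : boxGluing.dom i = box (cycleExponent i) (cycleForward i) := rfl
  unfold surfaceEntry surfaceExit
  generalize cycleExponent i = k at *
  generalize cycleForward i = b at *
  cases b
  · filter_upwards [h1, Ioo_mem_nhdsGT one_pos] with w hw hw1
    have hL := Real.log_neg hw1.1 hw1.2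
    refine ⟨6 - Real.log w - 3, by linarith, fun t => boxGluing.pt i
      (centerX k (t + 3), Real.exp (t + 3) * w), ?_, ?_, ?_, ?_, ?_⟩
    · intro t ht
      have ht' : t + 3 ∈ Icc 3 (6 - Real.log w) := ⟨by linarith [ht.1], by linarith [ht.2]⟩
      refine boxGluing.hasMFDerivWithinAt_pt_comp (hw _ ht').1 (HasDerivAt.hasDerivWithinAt ?_)
      have := (hasDerivAt_corner hk w (T := t + 3) (by linarith [ht.1])).comp_add_const t 3
      rw [hf]
      simpa [boxField, timeSign] using this
    · simp [entrySection, centerSection]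
    · simp only [exitSection, cornerMap, Bool.false_eq_true, if_false, sub_add_cancel]
      rw [hyperSection_eq hk hw1.1 hw1.2]
    · intro t ht
      have ht' : t + 3 ∈ Ioo 3 (6 - Real.log w) := ⟨by linarith [ht.1], by linarith [ht.2]⟩
      exact hA _ (corner_mem_cornerRegion hk hw1.1 ht') (hw _ ⟨ht'.1.le, ht'.2.le⟩).1
    · intro t ht
      exact (hw (t + 3) ⟨by linarith [ht.1], by linarith [ht.2]⟩).2
  · have h2 := (tendsto_cornerMap_true hk).eventually h1
    filter_upwards [h2, Ioo_mem_nhdsGT one_pos] with z hw hz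
    set w := cornerMap k true z with hwdef
    have hw0 : 0 < w := Real.exp_pos _
    have hzk : 0 < (z ^ k)⁻¹ := inv_pos.2 (pow_pos hz.1 k)
    have hlog : Real.log w = -(z ^ k)⁻¹ := by simp [hwdef, cornerMap]
    have hL : Real.log w < 0 := by linarith
    have hw1 : w < 1 := (Real.log_neg_iff hw0).1 hL
    have hz' : z = invRoot k (-Real.log w) :=
      eq_invRoot hk hz.1 (by linarith) (by rw [hlog]; simp)
    refine ⟨6 - Real.log w - 3, by linarith, fun t => boxGluing.pt i
      (centerX k (6 - Real.log w - t), Real.exp (6 - Real.log w - t) * w), ?_, ?_, ?_, ?_, ?_⟩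
    · intro t ht
      have ht' : 6 - Real.log w - t ∈ Icc 3 (6 - Real.log w) :=
        ⟨by linarith [ht.2], by linarith [ht.1]⟩
      refine boxGluing.hasMFDerivWithinAt_pt_comp (hw _ ht').1 (HasDerivAt.hasDerivWithinAt ?_)
      have := (hasDerivAt_corner hk w (T := 6 - Real.log w - t)
        (by linarith [ht'.1])).comp_const_sub (6 - Real.log w) t
      rw [hf]
      simpa [boxField, timeSign] using this
    · simp only [entrySection, if_true, sub_zero]
      rw [← hyperSection_eq hk hw0 hw1, ← hz']
    · simp [exitSection, centerSection]
    · intro t ht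
      have ht' : 6 - Real.log w - t ∈ Ioo 3 (6 - Real.log w) :=
        ⟨by linarith [ht.2], by linarith [ht.1]⟩
      exact hA _ (corner_mem_cornerRegion hk hw0 ht') (hw _ ⟨ht'.1.le, ht'.2.le⟩).1
    · intro t ht
      exact (hw _ ⟨by linarith [ht.2], by linarith [ht.1]⟩).2

/-- In strip coordinates the orbits are the lines of constant second coordinate, run through from `τ
= 1` to `τ = 2`; a tube around the segment `[1, 2] × {0}` keeps them close to the polycycle. -/
theorem flowsTo_connection (i : Fin 4) {A : Set boxGluing.Space}
    (hA : ∀ r ∈ stripRect, r.1 ∈ Ioo (1 : ℝ) 2 →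
      boxGluing.pt i ((boxCycle.exitStrip i).param r) ∉ A) :
    FlowsTo boxGluing.vectorField boxPolycycle.carrier A (surfaceExit i) (surfaceEntry (i + 1))
      (twist (cycleForward (i + 1))) := by
  have hk := one_le_cycleExponent i
  have hk' := one_le_cycleExponent (i + 1)
  intro U hU
  obtain ⟨U', hU', hSU', hUU'⟩ := mem_nhdsSet_iff_exists.1 hU
  have hpo : IsOpen (stripRect ∩ (boxCycle.exitStrip i).param ⁻¹'
      (boxGluing.dom i ∩ boxGluing.pt i ⁻¹' U')) :=
    (boxCycle.exitStrip i).contDiffOn_param.continuousOn.isOpen_inter_preimage isOpen_stripRect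
      (isOpen_preimage_pt i hU')
  have hsub : Icc (1 : ℝ) 2 ×ˢ {(0 : ℝ)} ⊆ stripRect ∩ (boxCycle.exitStrip i).param ⁻¹'
      (boxGluing.dom i ∩ boxGluing.pt i ⁻¹' U') := by
    rintro ⟨τ, c⟩ ⟨hτ, hc⟩
    obtain rfl : c = 0 := hc
    have h3 : τ < 3 := by have : τ ≤ 2 := hτ.2; linarith
    have h0 : 0 < τ := by have : 1 ≤ τ := hτ.1; linarith
    have h4 : (boxCycle.exitStrip i).param (τ, 0) =
        exitAxis (cycleExponent i) (cycleForward i) τ := boxExit_param_zero hk _ τ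
    refine ⟨mk_zero_mem_stripRect ⟨h0, h3⟩, ?_⟩
    rw [mem_preimage, h4]
    exact ⟨exitAxis_mem hk _ h3, hSU' (pt_exitAxis_mem_carrier i h3)⟩
  obtain ⟨u, v, hu, hv, hu', hv', huv⟩ := generalized_tube_lemma isCompact_Icc
    isCompact_singleton hpo hsub
  filter_upwards [nhdsWithin_le_nhds (hv.mem_nhds (hv' rfl))] with z hz
  have hmem : ∀ t ∈ Icc (0 : ℝ) (2 - 1), (t + 1, z) ∈ stripRect ∧
      boxGluing.pt i ((boxCycle.exitStrip i).param (t + 1, z)) ∈ U' := by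
    intro t ht
    have := huv (show (t + 1, z) ∈ u ×ˢ v from
      ⟨hu' ⟨by linarith [ht.1], by linarith [ht.2]⟩, hz⟩)
    exact ⟨this.1, this.2.2⟩
  refine ⟨2 - 1, by norm_num, fun t => boxGluing.pt i ((boxCycle.exitStrip i).param (t + 1, z)),
    ?_, ?_, ?_, ?_, ?_⟩
  · intro t ht
    refine boxGluing.hasMFDerivWithinAt_pt_comp
      ((boxCycle.exitStrip i).side_subset_dom ((boxCycle.exitStrip i).param_mem _ (hmem t ht).1))
      (HasDerivAt.hasDerivWithinAt ?_)
    exact ((boxCycle.exitStrip i).hasDerivAt_param _ (hmem t ht).1).comp_add_const t 1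
  · have h4 : (boxCycle.exitStrip i).param (0 + 1, z) =
        exitSection (cycleExponent i) (cycleForward i) z := by
      rw [zero_add]; exact boxExit_param_section hk _ z
    exact congrArg (boxGluing.pt i) h4
  · have h4 : (boxCycle.entryStrip (i + 1)).param (2 - 1 + 1, z) = entrySection
        (cycleExponent (i + 1)) (cycleForward (i + 1)) (twist (cycleForward (i + 1)) z) := by
      rw [sub_add_cancel]; exact boxEntry_param_section hk' _ z
    refine (pt_exit_eq_pt_entry i (hmem (2 - 1) (by norm_num)).1).trans ?_
    exact congrArg (boxGluing.pt (i + 1)) h4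
  · intro t ht
    exact hA _ (hmem t ⟨ht.1.le, ht.2.le⟩).1 ⟨by linarith [ht.1], by linarith [ht.2]⟩
  · intro t ht
    exact hUU' (hmem t ht).2

theorem pt_injOn (i : Fin 4) : InjOn (boxGluing.pt i) (boxGluing.dom i) := fun p hp q hq h => by
  rw [← boxGluing.chart_pt hp, ← boxGluing.chart_pt hq, h]

theorem Strip.param_injOn {U : Set (ℝ × ℝ)} {F : ℝ × ℝ → ℝ × ℝ} {o : Bool} (S : Strip U F o) :
    InjOn S.param stripRect := fun p hp q hq h => by
  rw [← S.coord_param p hp, ← S.coord_param q hq, h]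

theorem mem_stripRect_of_abs_lt {τ c : ℝ} (hτ : τ ∈ Ioo (0 : ℝ) 3) (hc : |c| < 1 / 8) :
    (τ, c) ∈ stripRect := by
  have := abs_lt.1 hc
  exact ⟨hτ, by linarith, this.2⟩

theorem exitSection_eq_param (i : Fin 4) (z : ℝ) :
    exitSection (cycleExponent i) (cycleForward i) z = (boxCycle.exitStrip i).param (1, z) :=
  (boxExit_param_section (one_le_cycleExponent i) _ z).symm

theorem entrySection_eq_param (i : Fin 4) {w : ℝ} (hw : w ∈ twistRange (cycleForward i)) :
    entrySection (cycleExponent i) (cycleForward i) w =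
      (boxCycle.entryStrip i).param (2, untwist (cycleForward i) w) := by
  have := boxEntry_param_section (one_le_cycleExponent i) (cycleForward i)
    (untwist (cycleForward i) w)
  rw [twist_untwist _ hw] at this
  exact this.symm

theorem entry_mem_stripRect (i : Fin 4) {w : ℝ} (hw : w ∈ twistRange (cycleForward i)) :
    ((2 : ℝ), untwist (cycleForward i) w) ∈ stripRect :=
  ⟨by norm_num, untwist_mem hw⟩

theorem exit_param_mem_dom (i : Fin 4) {r : ℝ × ℝ} (hr : r ∈ stripRect) :
    (boxCycle.exitStrip i).param r ∈ boxGluing.dom i :=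
  (boxCycle.exitStrip i).side_subset_dom ((boxCycle.exitStrip i).param_mem r hr)

theorem entry_param_mem_dom (i : Fin 4) {r : ℝ × ℝ} (hr : r ∈ stripRect) :
    (boxCycle.entryStrip i).param r ∈ boxGluing.dom i :=
  (boxCycle.entryStrip i).side_subset_dom ((boxCycle.entryStrip i).param_mem r hr)

theorem injOn_surfaceExit (i : Fin 4) : InjOn (surfaceExit i) (Ico 0 (1 / 8)) := by
  intro z hz w hw h
  have hz' : ((1 : ℝ), z) ∈ stripRect :=
    mem_stripRect_of_abs_lt (by norm_num) (by rw [abs_of_nonneg hz.1]; exact hz.2)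
  have hw' : ((1 : ℝ), w) ∈ stripRect :=
    mem_stripRect_of_abs_lt (by norm_num) (by rw [abs_of_nonneg hw.1]; exact hw.2)
  rw [surfaceExit, surfaceExit, exitSection_eq_param, exitSection_eq_param] at h
  have h1 := pt_injOn i (exit_param_mem_dom i hz') (exit_param_mem_dom i hw') h
  exact congrArg Prod.snd ((boxCycle.exitStrip i).param_injOn hz' hw' h1)

theorem exists_Ioo_subset_twistRange (b : Bool) : ∃ ε > 0, Ioo (-ε) ε ⊆ twistRange b := by
  obtain ⟨ε, hε, h⟩ := Metric.mem_nhds_iff.1 (twistRange_mem_nhds_zero b)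
  rw [Real.ball_eq_Ioo, zero_sub, zero_add] at h
  exact ⟨ε, hε, h⟩

theorem isTransitMap_connection (i : Fin 4) :
    IsTransitMap boxGluing.vectorField boxPolycycle.carrier (surfaceExit i) (surfaceEntry (i + 1))
      (twist (cycleForward (i + 1))) := by
  obtain ⟨ε, hε, hεr⟩ := exists_Ioo_subset_twistRange (cycleForward (i + 1))
  have hsub : ∀ z ∈ Ico 0 ε, z ∈ twistRange (cycleForward (i + 1)) := fun z hz =>
    hεr ⟨by linarith [hz.1], hz.2⟩
  refine FlowsTo.isTransitMap hε ?_ (flowsTo_connection i ?_) (tendsto_twist _)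
  · intro z hz w hw h
    have hz' := entry_mem_stripRect (i + 1) (hsub z hz)
    have hw' := entry_mem_stripRect (i + 1) (hsub w hw)
    rw [surfaceEntry, surfaceEntry, entrySection_eq_param _ (hsub z hz),
      entrySection_eq_param _ (hsub w hw)] at h
    have h1 := pt_injOn (i + 1) (entry_param_mem_dom _ hz') (entry_param_mem_dom _ hw') h
    have h2 := congrArg Prod.snd ((boxCycle.entryStrip (i + 1)).param_injOn hz' hw' h1)
    rw [← twist_untwist _ (hsub z hz), ← twist_untwist _ (hsub w hw)]
    exact congrArg _ h2
  · rintro r hr hr1 ⟨w, hw, h⟩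
    have hw0 := hsub w ⟨hw.1.le, hw.2⟩
    have hw' := entry_mem_stripRect (i + 1) hw0
    rw [surfaceEntry, entrySection_eq_param _ hw0, pt_exit_eq_pt_entry i hr] at h
    have h1 := pt_injOn (i + 1) (entry_param_mem_dom _ hw') (entry_param_mem_dom _ hr) h
    have h2 := congrArg Prod.fst ((boxCycle.entryStrip (i + 1)).param_injOn hw' hr h1)
    have h3 : (2 : ℝ) = r.1 := h2
    linarith [hr1.2]

theorem exitSection_not_mem_cornerRegion (k : ℕ) (b : Bool) (z : ℝ) :
    exitSection k b z ∉ cornerRegion k := by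
  cases b
  · exact fun h => lt_irrefl _ (show Real.exp 6 < Real.exp 6 from h.2.2.2)
  · exact fun h => lt_irrefl _ (show centerX k 3 < centerX k 3 from h.2.1)

theorem corner_not_mem_exit (i : Fin 4) : ∀ p ∈ cornerRegion (cycleExponent i),
    p ∈ boxGluing.dom i → boxGluing.pt i p ∉ surfaceExit i '' Ioo 0 (1 / 8) := by
  rintro p hp hpd ⟨z, hz, h⟩
  have hz' : ((1 : ℝ), z) ∈ stripRect :=
    mem_stripRect_of_abs_lt (by norm_num) (by rw [abs_of_pos hz.1]; exact hz.2)
  have hd := exit_param_mem_dom i hz'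
  rw [← exitSection_eq_param] at hd
  have h1 := pt_injOn i hd hpd h
  rw [← h1] at hp
  exact exitSection_not_mem_cornerRegion _ _ _ hp

theorem isTransitMap_corner (i : Fin 4) :
    IsTransitMap boxGluing.vectorField boxPolycycle.carrier (surfaceEntry i) (surfaceExit i)
      (cornerMap (cycleExponent i) (cycleForward i)) :=
  FlowsTo.isTransitMap (by norm_num) (injOn_surfaceExit i)
    (flowsTo_corner i (corner_not_mem_exit i)) (tendsto_cornerMap (one_le_cycleExponent i) _)

/-! ### The first return map -/

/-- The section on which the return map is defined. -/
def returnSection : Set boxGluing.Space := surfaceExit 3 '' Ioo 0 (1 / 8)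

/-- The section lies in the flow box common to the boxes `3` and `0`. It is therefore missed by the
boxes `1` and `2`, which are opposite to these. -/
theorem mem_returnSection {x : boxGluing.Space} (hx : x ∈ returnSection) :
    ∃ c, ((1 : ℝ), c) ∈ stripRect ∧ x = boxGluing.pt 3 ((boxCycle.exitStrip 3).param (1, c)) ∧
      x = boxGluing.pt 0 ((boxCycle.entryStrip 0).param (1, c)) := by
  obtain ⟨z, hz, rfl⟩ := hx
  have hz' : ((1 : ℝ), z) ∈ stripRect :=
    mem_stripRect_of_abs_lt (by norm_num) (by rw [abs_of_pos hz.1]; exact hz.2)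
  refine ⟨z, hz', ?_, ?_⟩
  · rw [surfaceExit, exitSection_eq_param]
  · rw [surfaceExit, exitSection_eq_param]
    exact pt_exit_eq_pt_entry 3 hz'

theorem pt_one_not_mem {p : ℝ × ℝ} (hp : p ∈ boxGluing.dom 1) :
    boxGluing.pt 1 p ∉ returnSection := by
  intro h
  obtain ⟨c, hc, h1, -⟩ := mem_returnSection h
  have h2 : p ∈ boxCycle.overlap 1 (1 + 2) :=
    ((boxGluing.pt_eq_pt_iff hp (exit_param_mem_dom 3 hc)).1 h1).1
  rw [StripCycle.overlap_opposite] at h2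
  exact h2.elim

theorem pt_two_not_mem {p : ℝ × ℝ} (hp : p ∈ boxGluing.dom 2) :
    boxGluing.pt 2 p ∉ returnSection := by
  intro h
  obtain ⟨c, hc, -, h1⟩ := mem_returnSection h
  have h2 : p ∈ boxCycle.overlap 2 (2 + 2) :=
    ((boxGluing.pt_eq_pt_iff hp (entry_param_mem_dom 0 hc)).1 h1).1
  rw [StripCycle.overlap_opposite] at h2
  exact h2.elim

theorem eventually_mem_stripRect {τ : ℝ} (hτ : τ ∈ Ioo (0 : ℝ) 3) :
    ∀ᶠ z in 𝓝[>] (0 : ℝ), (τ, z) ∈ stripRect := by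
  filter_upwards [Ioo_mem_nhdsGT (show (0 : ℝ) < 1 / 8 by norm_num)] with z hz
  exact mem_stripRect_of_abs_lt hτ (by rw [abs_of_pos hz.1]; exact hz.2)

theorem eventually_mem_twistRange (b : Bool) : ∀ᶠ z in 𝓝[>] (0 : ℝ), z ∈ twistRange b :=
  nhdsWithin_le_nhds (twistRange_mem_nhds_zero b)

/-- The first return map of the example. -/
noncomputable def returnMap : ℝ → ℝ :=
  cornerMap 1 false ∘ gluingMap ∘ cornerMap 1 true ∘ cornerMap 2 false ∘ gluingMap ∘
    cornerMap 2 true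

/-- The pieces are the connections `c` and the corners `k`; the facts `e` and `x` say that entry and
exit points are off the return section. The pieces in the boxes `1` and `2` avoid the section
altogether. On the connection that starts at it `τ > 1`, in the corner of box `0` the height is
below `e^6` while it is `e^7` on the section, and the last corner ends at its first hit. -/
theorem isTransitMap_returnMap :
    IsTransitMap boxGluing.vectorField boxPolycycle.carrier (surfaceExit 3) (surfaceExit 3)
      returnMap := by
  have tc := fun i => tendsto_cornerMap (one_le_cycleExponent i) (cycleForward i)
  have tt := fun i => tendsto_twist (cycleForward i)
  have c3 : FlowsTo boxGluing.vectorField boxPolycycle.carrier returnSection (surfaceExit 3)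
      (surfaceEntry 0) (twist (cycleForward 0)) := by
    refine flowsTo_connection 3 fun r hr hr1 h => ?_
    obtain ⟨c, hc, h1, -⟩ := mem_returnSection h
    have h2 := pt_injOn 3 (exit_param_mem_dom 3 hr) (exit_param_mem_dom 3 hc) h1
    have h3 : r.1 = 1 := congrArg Prod.fst ((boxCycle.exitStrip 3).param_injOn hr hc h2)
    linarith [hr1.1]
  have e0 : ∀ᶠ z in 𝓝[>] 0, surfaceEntry 0 z ∉ returnSection := by
    filter_upwards [eventually_mem_twistRange (cycleForward 0)] with z hz h
    obtain ⟨c, hc, -, h1⟩ := mem_returnSection h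
    rw [surfaceEntry, entrySection_eq_param 0 hz] at h1
    have hz' := entry_mem_stripRect 0 hz
    have h2 := pt_injOn 0 (entry_param_mem_dom 0 hz') (entry_param_mem_dom 0 hc) h1
    have h3 : (2 : ℝ) = 1 := congrArg Prod.fst ((boxCycle.entryStrip 0).param_injOn hz' hc h2)
    norm_num at h3
  have k0 : FlowsTo boxGluing.vectorField boxPolycycle.carrier returnSection (surfaceEntry 0)
      (surfaceExit 0) (cornerMap (cycleExponent 0) (cycleForward 0)) := by
    refine flowsTo_corner 0 fun p hp hpd h => ?_
    obtain ⟨c, hc, -, h1⟩ := mem_returnSection h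
    have h2 := pt_injOn 0 hpd (entry_param_mem_dom 0 hc) h1
    have h3 : p.2 = Real.exp (stripTime true (13 / 2) 1) := congrArg Prod.snd h2
    have h4 : p.2 < Real.exp 6 := hp.2.2.2
    rw [h3, Real.exp_lt_exp] at h4
    norm_num [stripTime, timeSign] at h4
  have x0 : ∀ᶠ z in 𝓝[>] 0, surfaceExit 0 z ∉ returnSection := by
    filter_upwards [eventually_mem_stripRect (τ := 1) (by norm_num)] with z hz
    rw [surfaceExit, exitSection_eq_param, pt_exit_eq_pt_entry 0 hz]
    exact pt_one_not_mem (entry_param_mem_dom 1 hz)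
  have c0 : FlowsTo boxGluing.vectorField boxPolycycle.carrier returnSection (surfaceExit 0)
      (surfaceEntry 1) (twist (cycleForward 1)) := by
    refine flowsTo_connection 0 fun r hr hr1 => ?_
    rw [pt_exit_eq_pt_entry 0 hr]
    exact pt_one_not_mem (entry_param_mem_dom 1 hr)
  have e1 : ∀ᶠ z in 𝓝[>] 0, surfaceEntry 1 z ∉ returnSection := by
    filter_upwards [eventually_mem_twistRange (cycleForward 1)] with z hz
    rw [surfaceEntry, entrySection_eq_param 1 hz]
    exact pt_one_not_mem (entry_param_mem_dom 1 (entry_mem_stripRect 1 hz))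
  have k1 : FlowsTo boxGluing.vectorField boxPolycycle.carrier returnSection (surfaceEntry 1)
      (surfaceExit 1) (cornerMap (cycleExponent 1) (cycleForward 1)) :=
    flowsTo_corner 1 fun p _ hpd => pt_one_not_mem hpd
  have x1 : ∀ᶠ z in 𝓝[>] 0, surfaceExit 1 z ∉ returnSection := by
    filter_upwards [eventually_mem_stripRect (τ := 1) (by norm_num)] with z hz
    rw [surfaceExit, exitSection_eq_param]
    exact pt_one_not_mem (exit_param_mem_dom 1 hz)
  have c1 : FlowsTo boxGluing.vectorField boxPolycycle.carrier returnSection (surfaceExit 1)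
      (surfaceEntry 2) (twist (cycleForward 2)) :=
    flowsTo_connection 1 fun r hr _ => pt_one_not_mem (exit_param_mem_dom 1 hr)
  have e2 : ∀ᶠ z in 𝓝[>] 0, surfaceEntry 2 z ∉ returnSection := by
    filter_upwards [eventually_mem_twistRange (cycleForward 2)] with z hz
    rw [surfaceEntry, entrySection_eq_param 2 hz]
    exact pt_two_not_mem (entry_param_mem_dom 2 (entry_mem_stripRect 2 hz))
  have k2 : FlowsTo boxGluing.vectorField boxPolycycle.carrier returnSection (surfaceEntry 2)
      (surfaceExit 2) (cornerMap (cycleExponent 2) (cycleForward 2)) :=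
    flowsTo_corner 2 fun p _ hpd => pt_two_not_mem hpd
  have x2 : ∀ᶠ z in 𝓝[>] 0, surfaceExit 2 z ∉ returnSection := by
    filter_upwards [eventually_mem_stripRect (τ := 1) (by norm_num)] with z hz
    rw [surfaceExit, exitSection_eq_param]
    exact pt_two_not_mem (exit_param_mem_dom 2 hz)
  have c2 : FlowsTo boxGluing.vectorField boxPolycycle.carrier returnSection (surfaceExit 2)
      (surfaceEntry 3) (twist (cycleForward 3)) :=
    flowsTo_connection 2 fun r hr _ => pt_two_not_mem (exit_param_mem_dom 2 hr)
  have e3 : ∀ᶠ z in 𝓝[>] 0, surfaceEntry 3 z ∉ returnSection := by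
    filter_upwards [eventually_mem_twistRange (cycleForward 3)] with z hz
    have hz' := entry_mem_stripRect 3 hz
    have h1 := pt_exit_eq_pt_entry 2 hz'
    rw [surfaceEntry, entrySection_eq_param 3 hz]
    exact h1 ▸ pt_two_not_mem (exit_param_mem_dom 2 hz')
  have k3 : FlowsTo boxGluing.vectorField boxPolycycle.carrier returnSection (surfaceEntry 3)
      (surfaceExit 3) (cornerMap (cycleExponent 3) (cycleForward 3)) :=
    flowsTo_corner 3 (corner_not_mem_exit 3)
  have f1 := c3.comp k0 (tt 0) e0
  have t1 := (tc 0).comp (tt 0)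
  have f2 := f1.comp c0 t1 x0
  have t2 := (tt 1).comp t1
  have f3 := f2.comp k1 t2 e1
  have t3 := (tc 1).comp t2
  have f4 := f3.comp c1 t3 x1
  have t4 := (tt 2).comp t3
  have f5 := f4.comp k2 t4 e2
  have t5 := (tc 2).comp t4
  have f6 := f5.comp c2 t5 x2
  have t6 := (tt 3).comp t5
  have f7 := f6.comp k3 t6 e3
  have t7 := (tc 3).comp t6
  exact FlowsTo.isTransitMap (by norm_num) (injOn_surfaceExit 3) f7 t7

theorem invRoot_one (B : ℝ) : invRoot 1 B = B⁻¹ := by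
  simp [invRoot, Real.rpow_neg_one]

/-- In the chart `z = e^(-ζ)` the map `e^(-1/z^k)`, followed by `f` and by the inverse corner map
with the same `k`, becomes `m_k⁻¹ ∘ A (f^log) ∘ m_k`. The pair with `k = 2` gives `conjugatedMap`
and the pair with `k = 1` gives `innerMap`. -/
theorem logChart_returnMap : logChart returnMap =ᶠ[atTop] logReturnMap := by
  filter_upwards [eventually_ge_atTop 0] with ζ hζ
  have h1 : cornerMap 2 true (Real.exp (-ζ)) = Real.exp (-Real.exp (2 * ζ)) := by
    simp only [cornerMap, if_true, ← Real.exp_nat_mul, ← Real.exp_neg]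
    congr 3
    push_cast
    ring
  have h2 : 0 < logChart gluingMap (Real.exp (2 * ζ)) := by
    have h3 : 1 ≤ Real.exp (2 * ζ) := Real.one_le_exp (by linarith)
    have h4 : Real.exp (-Real.exp (2 * ζ)) ≤ 1 / 2 := by
      rw [Real.exp_neg, one_div]
      have := Real.add_one_le_exp (Real.exp (2 * ζ))
      exact inv_anti₀ (by norm_num) (by linarith)
    have h5 := Real.exp_pos (-Real.exp (2 * ζ))
    have h6 : Real.log (gluingMap (Real.exp (-Real.exp (2 * ζ)))) < 0 :=
      Real.log_neg (by unfold gluingMap; positivity) (by unfold gluingMap; nlinarith)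
    unfold logChart
    linarith
  have h3 : cornerMap 2 false (gluingMap (Real.exp (-Real.exp (2 * ζ)))) =
      Real.exp (-conjugatedMap ζ) := by
    change invRoot 2 (logChart gluingMap (Real.exp (2 * ζ))) = _
    rw [invRoot, Real.rpow_def_of_pos h2]
    congr 1
    simp only [conjugatedMap, innerMap, conjExp, mulMap, Function.comp_apply]
    push_cast
    ring
  have h4 : cornerMap 1 true (Real.exp (-conjugatedMap ζ)) =
      Real.exp (-Real.exp (conjugatedMap ζ)) := by
    simp only [cornerMap, if_true, pow_one, ← Real.exp_neg, neg_neg]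
  have h5 : cornerMap 1 false (gluingMap (Real.exp (-Real.exp (conjugatedMap ζ)))) =
      (logChart gluingMap (Real.exp (conjugatedMap ζ)))⁻¹ := invRoot_one _
  have h6 : returnMap (Real.exp (-ζ)) = (logChart gluingMap (Real.exp (conjugatedMap ζ)))⁻¹ := by
    simp only [returnMap, Function.comp_apply, h1, h3, h4, h5]
  change -Real.log (returnMap (Real.exp (-ζ))) = _
  rw [h6, Real.log_inv, neg_neg]
  rfl

theorem IsTransitMap.congr {M : Type*} [TopologicalSpace M] [ChartedSpace (ℝ × ℝ) M]
    {V : (x : M) → TangentSpace 𝓘(ℝ, ℝ × ℝ) x} {S : Set M} {σ τ : ℝ → M} {T T' : ℝ → ℝ}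
    (h : IsTransitMap V S σ τ T) (hT : T =ᶠ[𝓝[>] 0] T') : IsTransitMap V S σ τ T' := by
  obtain ⟨ε, hε, hinj, h⟩ := h
  refine ⟨ε, hε, hinj, fun U hU => ?_⟩
  filter_upwards [h U hU, hT] with z hz hz'
  rwa [← hz']

theorem exists_polycycle :
    ∃ (M : Type) (_ : TopologicalSpace M) (_ : T2Space M) (_ : SecondCountableTopology M)
        (_ : ChartedSpace (ℝ × ℝ) M) (_ : IsManifold 𝓘(ℝ, ℝ × ℝ) ω M)
        (V : (x : M) → TangentSpace 𝓘(ℝ, ℝ × ℝ) x) (P : SimpleAlternantPolycycle V 4)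
        (entry exit : Fin 4 → ℝ → M) (Δ : ℝ → ℝ),
      IsAnalyticField V ∧
      (∀ i, IsSection V (P.chart i) (P.connection i) (exit i)) ∧
      (∀ i, IsSection V (P.chart (i + 1)) (P.connection i) (entry (i + 1))) ∧
      IsTransitMap V P.carrier (exit 3) (entry 0) (fun z => z) ∧
      IsTransitMap V P.carrier (entry 0) (exit 0) (fun z => Real.exp (-(1 / z ^ 2))) ∧
      IsTransitMap V P.carrier (exit 0) (entry 1) gluingMap ∧
      IsTransitMap V P.carrier (entry 1) (exit 1) (fun z => (1 / -Real.log z) ^ (1 / 2 : ℝ)) ∧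
      IsTransitMap V P.carrier (exit 1) (entry 2) (fun z => z) ∧
      IsTransitMap V P.carrier (entry 2) (exit 2) (fun z => Real.exp (-(1 / z))) ∧
      IsTransitMap V P.carrier (exit 2) (entry 3) gluingMap ∧
      IsTransitMap V P.carrier (entry 3) (exit 3) (fun z => 1 / -Real.log z) ∧
      IsTransitMap V P.carrier (exit 3) (exit 3) Δ ∧
      logChart Δ =ᶠ[atTop] logReturnMap := by
  refine ⟨boxGluing.Space, inferInstance, inferInstance, boxGluing.secondCountableTopology,
    inferInstance, inferInstance, boxGluing.vectorField, boxPolycycle, surfaceEntry, surfaceExit,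
    returnMap, boxGluing.isAnalyticField_vectorField, isSection_surfaceExit,
    isSection_surfaceEntry, isTransitMap_connection 3, ?_, isTransitMap_connection 0, ?_,
    isTransitMap_connection 1, ?_, isTransitMap_connection 2, ?_, isTransitMap_returnMap,
    logChart_returnMap⟩
  · refine (isTransitMap_corner 0).congr (Eventually.of_forall fun z => ?_)
    change Real.exp (-(z ^ 2)⁻¹) = Real.exp (-(1 / z ^ 2))
    rw [one_div]
  · refine (isTransitMap_corner 1).congr ?_
    filter_upwards [Ioo_mem_nhdsGT one_pos] with z hz
    have h := Real.log_neg hz.1 hz.2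
    change (-Real.log z) ^ (-(1 / ((2 : ℕ) : ℝ))) = _
    rw [Real.rpow_neg (by linarith), one_div (-Real.log z), Real.inv_rpow (by linarith)]
    norm_num
  · refine (isTransitMap_corner 2).congr (Eventually.of_forall fun z => ?_)
    change Real.exp (-(z ^ 1)⁻¹) = Real.exp (-(1 / z))
    rw [one_div, pow_one]
  · refine (isTransitMap_corner 3).congr (Eventually.of_forall fun z => ?_)
    change invRoot 1 (-Real.log z) = 1 / -Real.log z
    rw [invRoot_one, one_div]

/-! ### The domains `ln (ℂ_b⁺)` -/

theorem mem_lnHalfPlane_iff {b : ℝ} (hb : 0 < b) {ζ : ℂ} :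
    ζ ∈ lnHalfPlane b ↔ b ≤ (Complex.exp ζ).re ∧ |ζ.im| < Real.pi / 2 := by
  constructor
  · rintro ⟨w, hw, rfl⟩
    have hw : b ≤ w.re := hw
    have h0 : w ≠ 0 := by
      rintro rfl
      simp at hw
      linarith
    refine ⟨by rwa [Complex.exp_log h0], ?_⟩
    rw [Complex.log_im, Complex.abs_arg_lt_pi_div_two_iff]
    exact Or.inl (hb.trans_le hw)
  · rintro ⟨h1, h2⟩
    have := Real.pi_pos
    refine ⟨Complex.exp ζ, h1, Complex.log_exp ?_ ?_⟩ <;> linarith [(abs_lt.1 h2).1, (abs_lt.1 h2).2]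

theorem lnHalfPlane_anti {b b' : ℝ} (h : b ≤ b') : lnHalfPlane b' ⊆ lnHalfPlane b :=
  image_mono fun _ hw => le_trans h hw

theorem log_le_re_of_mem_lnHalfPlane {b : ℝ} (hb : 0 < b) {ζ : ℂ} (hζ : ζ ∈ lnHalfPlane b) :
    Real.log b ≤ ζ.re := by
  have h := ((mem_lnHalfPlane_iff hb).1 hζ).1
  have h2 : b ≤ Real.exp ζ.re := by
    rw [← Complex.norm_exp]
    exact h.trans (Complex.re_le_norm _)
  exact (Real.log_le_iff_le_exp hb).2 h2

theorem ofReal_mem_lnHalfPlane {b x : ℝ} (hb : 0 < b) (hx : Real.log b ≤ x) :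
    (x : ℂ) ∈ lnHalfPlane b := by
  rw [mem_lnHalfPlane_iff hb]
  constructor
  · rw [← Complex.ofReal_exp, Complex.ofReal_re]
    exact (Real.log_le_iff_le_exp hb).1 hx
  · simp [Real.pi_pos]

theorem eventually_ofReal_mem_lnHalfPlane {b : ℝ} (hb : 0 < b) :
    ∀ᶠ x : ℝ in atTop, (x : ℂ) ∈ lnHalfPlane b :=
  (eventually_ge_atTop _).mono fun _ hx => ofReal_mem_lnHalfPlane hb hx

/-- The interior of `lnHalfPlane b`. -/
def lnOpen (b : ℝ) : Set ℂ := {ζ | b < (Complex.exp ζ).re ∧ |ζ.im| < Real.pi / 2}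

theorem isOpen_lnOpen (b : ℝ) : IsOpen (lnOpen b) := by
  have h1 : Continuous fun ζ : ℂ => (Complex.exp ζ).re :=
    Complex.continuous_re.comp Complex.continuous_exp
  have h2 : Continuous fun ζ : ℂ => |ζ.im| := Complex.continuous_im.abs
  exact (isOpen_lt continuous_const h1).inter (isOpen_lt h2 continuous_const)

theorem lnOpen_subset {b : ℝ} (hb : 0 < b) : lnOpen b ⊆ lnHalfPlane b := fun _ hζ =>
  (mem_lnHalfPlane_iff hb).2 ⟨hζ.1.le, hζ.2⟩

theorem lnHalfPlane_subset_lnOpen {b b' : ℝ} (hb : 0 < b) (h : b < b') :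
    lnHalfPlane b' ⊆ lnOpen b := fun _ hζ =>
  have h' := (mem_lnHalfPlane_iff (hb.trans h)).1 hζ
  ⟨h.trans_le h'.1, h'.2⟩

theorem isPreconnected_lnOpen {b : ℝ} (hb : 0 < b) : IsPreconnected (lnOpen b) := by
  have h : lnOpen b = Complex.log '' {w | b < w.re} := by
    ext ζ
    constructor
    · intro hζ
      have h2 := abs_lt.1 hζ.2
      have := Real.pi_pos
      refine ⟨Complex.exp ζ, hζ.1, Complex.log_exp ?_ ?_⟩ <;> linarith [h2.1, h2.2]
    · rintro ⟨w, hw, rfl⟩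
      have hw : b < w.re := hw
      have h0 : w ≠ 0 := by
        rintro rfl
        simp at hw
        linarith
      refine ⟨by rwa [Complex.exp_log h0], ?_⟩
      rw [Complex.log_im, Complex.abs_arg_lt_pi_div_two_iff]
      exact Or.inl (hb.trans hw)
  rw [h]
  refine (convex_halfSpace_re_gt b).isPreconnected.image _ fun w hw => ?_
  exact (continuousAt_clog (Or.inl (hb.trans hw))).continuousWithinAt

theorem eqOn_nhds_of_eqOn_lnHalfPlane {f g : ℂ → ℂ} {b b' : ℝ} (hb : 0 < b) (h : b < b')
    (hfg : EqOn f g (lnHalfPlane b)) {ζ : ℂ} (hζ : ζ ∈ lnHalfPlane b') : f =ᶠ[𝓝 ζ] g :=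
  ((hfg.mono (lnOpen_subset hb)).eventuallyEq_of_mem
    ((isOpen_lnOpen b).mem_nhds (lnHalfPlane_subset_lnOpen hb h hζ)))

/-! ### Germs of analytic functions on the domains `ln (ℂ_b⁺)` -/

/-- `k` is analytic on `ln (ℂ_b⁺)` for some `b`. -/
def EventuallyAnalytic (k : ℂ → ℂ) : Prop := ∃ b > 0, AnalyticOnNhd ℂ k (lnHalfPlane b)

namespace EventuallyAnalytic

theorem congr {f g : ℂ → ℂ} (hf : EventuallyAnalytic f) {b : ℝ} (hb : 0 < b)
    (h : EqOn g f (lnHalfPlane b)) : EventuallyAnalytic g := by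
  obtain ⟨b₁, hb₁, hf⟩ := hf
  refine ⟨max b₁ (b + 1), by positivity, fun ζ hζ => ?_⟩
  have h1 : ζ ∈ lnHalfPlane (b + 1) := lnHalfPlane_anti (le_max_right _ _) hζ
  exact (hf ζ (lnHalfPlane_anti (le_max_left _ _) hζ)).congr
    (eqOn_nhds_of_eqOn_lnHalfPlane hb (lt_add_one b) h.symm h1)

theorem const (c : ℂ) : EventuallyAnalytic fun _ => c := ⟨1, one_pos, fun _ _ => analyticAt_const⟩

theorem add {f g : ℂ → ℂ} (hf : EventuallyAnalytic f) (hg : EventuallyAnalytic g) :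
    EventuallyAnalytic fun ζ => f ζ + g ζ := by
  obtain ⟨b₁, hb₁, hf⟩ := hf
  obtain ⟨b₂, hb₂, hg⟩ := hg
  exact ⟨max b₁ b₂, by positivity, fun ζ hζ =>
    (hf ζ (lnHalfPlane_anti (le_max_left _ _) hζ)).add
      (hg ζ (lnHalfPlane_anti (le_max_right _ _) hζ))⟩

theorem mul {f g : ℂ → ℂ} (hf : EventuallyAnalytic f) (hg : EventuallyAnalytic g) :
    EventuallyAnalytic fun ζ => f ζ * g ζ := by
  obtain ⟨b₁, hb₁, hf⟩ := hf
  obtain ⟨b₂, hb₂, hg⟩ := hg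
  exact ⟨max b₁ b₂, by positivity, fun ζ hζ =>
    (hf ζ (lnHalfPlane_anti (le_max_left _ _) hζ)).mul
      (hg ζ (lnHalfPlane_anti (le_max_right _ _) hζ))⟩

theorem sub {f g : ℂ → ℂ} (hf : EventuallyAnalytic f) (hg : EventuallyAnalytic g) :
    EventuallyAnalytic fun ζ => f ζ - g ζ := by
  simpa [sub_eq_add_neg] using hf.add ((const (-1)).mul hg)

theorem sum {ι : Type*} (s : Finset ι) {f : ι → ℂ → ℂ} (hf : ∀ i, EventuallyAnalytic (f i)) :
    EventuallyAnalytic fun ζ => ∑ i ∈ s, f i ζ := by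
  classical
  induction s using Finset.induction_on with
  | empty => simpa using const 0
  | insert i s hi ih =>
    simp only [Finset.sum_insert hi]
    exact (hf i).add ih

theorem deriv {f : ℂ → ℂ} (hf : EventuallyAnalytic f) : EventuallyAnalytic (deriv f) := by
  obtain ⟨b, hb, hf⟩ := hf
  exact ⟨b, hb, fun ζ hζ => (hf ζ hζ).deriv⟩

theorem of_halfPlane {f : ℂ → ℂ} {a : ℝ} (hf : AnalyticOnNhd ℂ f (halfPlane a)) :
    EventuallyAnalytic f :=
  ⟨Real.exp a, Real.exp_pos a, fun ζ hζ => hf ζ (by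
    have := log_le_re_of_mem_lnHalfPlane (Real.exp_pos a) hζ
    rwa [Real.log_exp] at this)⟩

/-- Since `|Im ζ| < π/2` and `α < 1`, the argument of `e^(αζ)` stays away from `±π/2`. Its real part
is at least `e^(α Re ζ) cos (απ/2)`, which exceeds `a` far out in the domain. -/
theorem comp_exp_mul {ψ : ℂ → ℂ} {a : ℝ} (hψ : AnalyticOnNhd ℂ ψ (halfPlane a)) {α : ℝ}
    (hα : 0 < α) (hα' : α < 1) : EventuallyAnalytic fun ζ => ψ (Complex.exp (α * ζ)) := by
  have hcos : 0 < Real.cos (α * (Real.pi / 2)) := by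
    apply Real.cos_pos_of_mem_Ioo
    constructor <;> nlinarith [Real.pi_pos]
  have hlim : Tendsto (fun x : ℝ => Real.exp (α * x) * Real.cos (α * (Real.pi / 2))) atTop atTop :=
    (Real.tendsto_exp_atTop.comp (tendsto_id.const_mul_atTop hα)).atTop_mul_const hcos
  obtain ⟨x₀, hx₀⟩ := (hlim.eventually_ge_atTop a).exists_forall_of_atTop
  refine ⟨Real.exp x₀, Real.exp_pos _, fun ζ hζ => ?_⟩
  have hre := log_le_re_of_mem_lnHalfPlane (Real.exp_pos _) hζ
  rw [Real.log_exp] at hre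
  have him := ((mem_lnHalfPlane_iff (Real.exp_pos _)).1 hζ).2
  have hmem : Complex.exp (α * ζ) ∈ halfPlane a := by
    change a ≤ (Complex.exp (α * ζ)).re
    rw [Complex.exp_re, Complex.re_ofReal_mul, Complex.im_ofReal_mul]
    refine (hx₀ _ hre).trans (mul_le_mul_of_nonneg_left ?_ (Real.exp_pos _).le)
    rw [← Real.cos_abs (α * ζ.im), abs_mul, abs_of_pos hα]
    apply Real.cos_le_cos_of_nonneg_of_le_pi (by positivity)
    · nlinarith [Real.pi_pos]
    · exact mul_le_mul_of_nonneg_left him.le hα.le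
  exact (hψ _ hmem).comp_of_eq (analyticAt_const.mul analyticAt_id).cexp rfl

end EventuallyAnalytic

theorem K10.eventuallyAnalytic {k : ℂ → ℂ} (hk : k ∈ K10) : EventuallyAnalytic k := by
  obtain ⟨n, l, φ, h, b, hb, hk⟩ := hk
  refine EventuallyAnalytic.congr (EventuallyAnalytic.sum Finset.univ (fun i => ?_)) hb hk
  obtain ⟨-, a, -, hφ, -⟩ := h i
  exact EventuallyAnalytic.of_halfPlane (a := a) fun ζ hζ =>
    (analyticAt_const.mul analyticAt_id).cexp.mul (hφ ζ hζ)

theorem K1.eventuallyAnalytic {Z : Set ℂ} {p : ℕ} {k : ℂ → ℂ} (hk : k ∈ K1 Z p) :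
    EventuallyAnalytic k := by
  cases p with
  | zero => exact K10.eventuallyAnalytic hk
  | succ p =>
    obtain ⟨φ, hφ, n, ψ, α, h, b, hb, hk⟩ := hk
    refine EventuallyAnalytic.congr ((K10.eventuallyAnalytic hφ).add
      (EventuallyAnalytic.sum Finset.univ fun i => ?_)) hb hk
    obtain ⟨⟨⟨a, ha⟩, -⟩, h1, h2⟩ := h i
    exact EventuallyAnalytic.comp_exp_mul ha h1 h2

theorem K10.congr {k k' : ℂ → ℂ} (hk : k ∈ K10) {b : ℝ} (hb : 0 < b)
    (h : EqOn k' k (lnHalfPlane b)) : k' ∈ K10 := by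
  obtain ⟨n, l, φ, h', b', hb', hk⟩ := hk
  refine ⟨n, l, φ, h', max b b', by positivity, fun ζ hζ => ?_⟩
  rw [h (lnHalfPlane_anti (le_max_left _ _) hζ), hk ζ (lnHalfPlane_anti (le_max_right _ _) hζ)]

theorem K1.congr {Z : Set ℂ} {p : ℕ} {k k' : ℂ → ℂ} (hk : k ∈ K1 Z p) {b : ℝ} (hb : 0 < b)
    (h : EqOn k' k (lnHalfPlane b)) : k' ∈ K1 Z p := by
  cases p with
  | zero => exact K10.congr hk hb h
  | succ p =>
    obtain ⟨φ, hφ, n, ψ, α, h', b', hb', hk⟩ := hk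
    refine ⟨φ, hφ, n, ψ, α, h', max b b', by positivity, fun ζ hζ => ?_⟩
    rw [h (lnHalfPlane_anti (le_max_left _ _) hζ), hk ζ (lnHalfPlane_anti (le_max_right _ _) hζ)]

theorem zero_mem_K10 : (fun _ => 0) ∈ K10 :=
  ⟨0, Fin.elim0, Fin.elim0, fun i => i.elim0, 1, one_pos, by simp⟩

theorem zero_mem_K1 (Z : Set ℂ) (p : ℕ) : (fun _ => 0) ∈ K1 Z p := by
  cases p with
  | zero => exact zero_mem_K10
  | succ p => exact ⟨_, zero_mem_K10, 0, Fin.elim0, Fin.elim0, fun i => i.elim0, 1, one_pos, by simp⟩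

/-! ### The divide and differentiate step -/

theorem hasDerivAt_quotient_mul_exp {k₁ k₂ e₁ e₂ : ℂ → ℂ} {ζ : ℂ} (hk₁ : AnalyticAt ℂ k₁ ζ)
    (hk₂ : AnalyticAt ℂ k₂ ζ) (he₁ : AnalyticAt ℂ e₁ ζ) (he₂ : AnalyticAt ℂ e₂ ζ)
    (h : k₁ ζ ≠ 0) :
    HasDerivAt (fun w => k₂ w / k₁ w * Complex.exp (e₂ w - e₁ w))
      ((deriv k₂ ζ * k₁ ζ - deriv k₁ ζ * k₂ ζ + k₂ ζ * k₁ ζ * (deriv e₂ ζ - deriv e₁ ζ)) /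
        k₁ ζ ^ 2 * Complex.exp (e₂ ζ - e₁ ζ)) ζ := by
  have h1 := hk₁.differentiableAt.hasDerivAt
  have h2 := hk₂.differentiableAt.hasDerivAt
  have h3 := he₁.differentiableAt.hasDerivAt
  have h4 := he₂.differentiableAt.hasDerivAt
  convert! (h2.div h1 h).mul (h4.sub h3).cexp using 1
  simp only [Pi.sub_apply, Pi.div_apply]
  field_simp

/-- The quotient rule determines `k` wherever `k₁ ≠ 0`. All functions are analytic on a connected
domain, so the identity theorem extends the equality across the zeros of `k₁`. -/
theorem divideDifferentiate_iff {Z : Set ℂ} {p : ℕ} {k₁ k₂ e₁ e₂ : ℂ → ℂ} {ν₁ ν₂ : ℝ}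
    (hk₁ : k₁ ∈ K1 Z p) (hk₂ : k₂ ∈ K1 Z p) (he₁ : IsExponent e₁ ν₁) (he₂ : IsExponent e₂ ν₂) :
    DivideDifferentiate Z p k₁ e₁ k₂ e₂ ↔
      (fun ζ => deriv k₂ ζ * k₁ ζ - deriv k₁ ζ * k₂ ζ +
        k₂ ζ * k₁ ζ * (deriv e₂ ζ - deriv e₁ ζ)) ∈ K1 Z p := by
  have ak₁ := K1.eventuallyAnalytic hk₁
  have ak₂ := K1.eventuallyAnalytic hk₂
  obtain ⟨a₁, ha₁, -⟩ := he₁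
  obtain ⟨a₂, ha₂, -⟩ := he₂
  have ae₁ := EventuallyAnalytic.of_halfPlane ha₁
  have ae₂ := EventuallyAnalytic.of_halfPlane ha₂
  set W : ℂ → ℂ := fun ζ => deriv k₂ ζ * k₁ ζ - deriv k₁ ζ * k₂ ζ +
        k₂ ζ * k₁ ζ * (deriv e₂ ζ - deriv e₁ ζ) with hW
  have aW : EventuallyAnalytic W := by
    exact ((ak₂.deriv.mul ak₁).sub (ak₁.deriv.mul ak₂)).add
      ((ak₂.mul ak₁).mul (ae₂.deriv.sub ae₁.deriv))
  obtain ⟨b₁, hb₁, bk₁⟩ := ak₁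
  obtain ⟨b₂, hb₂, bk₂⟩ := ak₂
  obtain ⟨b₃, hb₃, be₁⟩ := ae₁
  obtain ⟨b₄, hb₄, be₂⟩ := ae₂
  have key : ∀ b, b₁ ≤ b → b₂ ≤ b → b₃ ≤ b → b₄ ≤ b → ∀ ζ ∈ lnHalfPlane b, k₁ ζ ≠ 0 →
      HasDerivAt (fun w => k₂ w / k₁ w * Complex.exp (e₂ w - e₁ w))
        (W ζ / k₁ ζ ^ 2 * Complex.exp (e₂ ζ - e₁ ζ)) ζ := fun b h1 h2 h3 h4 ζ hζ h =>
    hasDerivAt_quotient_mul_exp (bk₁ ζ (lnHalfPlane_anti h1 hζ)) (bk₂ ζ (lnHalfPlane_anti h2 hζ))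
      (be₁ ζ (lnHalfPlane_anti h3 hζ)) (be₂ ζ (lnHalfPlane_anti h4 hζ)) h
  constructor
  · rintro ⟨k, hk, b, hb, h⟩
    obtain ⟨b₅, hb₅, bk⟩ := K1.eventuallyAnalytic hk
    obtain ⟨b₆, hb₆, bW⟩ := aW
    obtain ⟨B, hB⟩ := Finite.bddAbove_range ![b₁, b₂, b₃, b₄, b₅, b₆, b]
    have hle : ∀ i, ![b₁, b₂, b₃, b₄, b₅, b₆, b] i ≤ B := fun i => hB (mem_range_self i)
    have l1 : b₁ ≤ B := hle 0
    have l2 : b₂ ≤ B := hle 1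
    have l3 : b₃ ≤ B := hle 2
    have l4 : b₄ ≤ B := hle 3
    have l5 : b₅ ≤ B := hle 4
    have l6 : b₆ ≤ B := hle 5
    have l7 : b ≤ B := hle 6
    have hBp : 0 < B := hb.trans_le l7
    have hprod : ∀ ζ ∈ lnHalfPlane B, k₁ ζ ≠ 0 → W ζ = k ζ := by
      intro ζ hζ h0
      have h1 := (key B l1 l2 l3 l4 ζ hζ h0).unique (h ζ (lnHalfPlane_anti l7 hζ) h0)
      have h2 := mul_right_cancel₀ (Complex.exp_ne_zero _) h1
      exact (div_left_inj' (pow_ne_zero 2 h0)).1 h2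
    have hsub : lnOpen B ⊆ lnHalfPlane B := lnOpen_subset hBp
    have an1 : AnalyticOnNhd ℂ k₁ (lnOpen B) := fun ζ hζ => bk₁ ζ (lnHalfPlane_anti l1 (hsub hζ))
    -- If `k₁` vanishes identically, the condition on `k` is void, but then the combination is `0`
    -- and belongs to the class anyway.
    by_cases h0 : EqOn k₁ 0 (lnOpen B)
    · refine K1.congr (zero_mem_K1 Z p) (b := B + 1) (by linarith) fun ζ hζ => ?_
      have hζ' := lnHalfPlane_subset_lnOpen hBp (lt_add_one B) hζ
      have hz : k₁ =ᶠ[𝓝 ζ] fun _ => 0 := h0.eventuallyEq_of_mem ((isOpen_lnOpen B).mem_nhds hζ')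
      have hd : deriv k₁ ζ = 0 := by rw [hz.deriv_eq]; simp
      simp only [hW, hd, h0 hζ', Pi.zero_apply]
      ring
    · refine K1.congr hk (b := B + 1) (by linarith) fun ζ hζ => ?_
      have hζ' := lnHalfPlane_subset_lnOpen hBp (lt_add_one B) hζ
      simp only [EqOn, not_forall] at h0
      obtain ⟨z₀, hz₀, hne⟩ := h0
      have hev : W =ᶠ[𝓝 z₀] k := by
        have hc : ∀ᶠ z in 𝓝 z₀, k₁ z ≠ 0 :=
          (an1 z₀ hz₀).continuousAt.eventually_ne hne
        filter_upwards [hc, (isOpen_lnOpen B).mem_nhds hz₀] with z h1 h2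
        exact hprod z (hsub h2) h1
      exact (AnalyticOnNhd.eqOn_of_preconnected_of_eventuallyEq
        (fun z hz => bW z (lnHalfPlane_anti l6 (hsub hz)))
        (fun z hz => bk z (lnHalfPlane_anti l5 (hsub hz)))
        (isPreconnected_lnOpen hBp) hz₀ hev) hζ'
  · intro h
    refine ⟨W, h, b₁ + b₂ + b₃ + b₄, by positivity, fun ζ hζ h0 => ?_⟩
    exact key _ (by linarith) (by linarith) (by linarith) (by linarith) ζ hζ h0

theorem divideDifferentiate_self_iff {Z : Set ℂ} {p : ℕ} {k₁ k₂ e : ℂ → ℂ} {ν : ℝ}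
    (hk₁ : k₁ ∈ K1 Z p) (hk₂ : k₂ ∈ K1 Z p) (he : IsExponent e ν) :
    DivideDifferentiate Z p k₁ e k₂ e ↔
      (fun ζ => deriv k₂ ζ * k₁ ζ - deriv k₁ ζ * k₂ ζ) ∈ K1 Z p := by
  have h := divideDifferentiate_iff hk₁ hk₂ he he
  simpa using h

/-! ### Functions with expansions in powers of `e^(-s)` and `s⁻¹` -/

/-- The value of a polynomial in `s⁻¹` and `e^(-s)`. -/
noncomputable def expEval (s : ℂ) : Polynomial (Polynomial ℝ) →+* ℂ :=
  Polynomial.eval₂RingHom (Polynomial.aeval s⁻¹ : Polynomial ℝ →ₐ[ℝ] ℂ).toRingHom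
    (Complex.exp (-s))

theorem expEval_C (s : ℂ) (Q : Polynomial ℝ) :
    expEval s (Polynomial.C Q) = Polynomial.aeval s⁻¹ Q := by
  simp [expEval]

theorem expEval_X (s : ℂ) : expEval s Polynomial.X = Complex.exp (-s) := by
  simp [expEval]

theorem expEval_bounded (P : Polynomial (Polynomial ℝ)) :
    ∃ C, ∀ s : ℂ, 1 ≤ s.re → ‖expEval s P‖ ≤ C := by
  have hmul : ∀ f g : ℂ → ℂ, (∃ C, ∀ s : ℂ, 1 ≤ s.re → ‖f s‖ ≤ C) →
      (∃ C, ∀ s : ℂ, 1 ≤ s.re → ‖g s‖ ≤ C) → ∃ C, ∀ s : ℂ, 1 ≤ s.re → ‖f s * g s‖ ≤ C := by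
    rintro f g ⟨C, hC⟩ ⟨D, hD⟩
    refine ⟨C * D, fun s hs => ?_⟩
    rw [norm_mul]
    exact mul_le_mul (hC s hs) (hD s hs) (norm_nonneg _) ((norm_nonneg _).trans (hC s hs))
  have hadd : ∀ f g : ℂ → ℂ, (∃ C, ∀ s : ℂ, 1 ≤ s.re → ‖f s‖ ≤ C) →
      (∃ C, ∀ s : ℂ, 1 ≤ s.re → ‖g s‖ ≤ C) → ∃ C, ∀ s : ℂ, 1 ≤ s.re → ‖f s + g s‖ ≤ C := by
    rintro f g ⟨C, hC⟩ ⟨D, hD⟩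
    exact ⟨C + D, fun s hs => (norm_add_le _ _).trans (add_le_add (hC s hs) (hD s hs))⟩
  have hX : ∃ C, ∀ s : ℂ, 1 ≤ s.re → ‖Complex.exp (-s)‖ ≤ C := by
    refine ⟨1, fun s hs => ?_⟩
    rw [Complex.norm_exp, Complex.neg_re, Real.exp_le_one_iff]
    linarith
  have hinv : ∃ C, ∀ s : ℂ, 1 ≤ s.re → ‖s⁻¹‖ ≤ C := by
    refine ⟨1, fun s hs => ?_⟩
    rw [norm_inv]
    exact inv_le_one_of_one_le₀ (hs.trans (Complex.re_le_norm s))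
  have hC : ∀ Q : Polynomial ℝ,
      ∃ C, ∀ s : ℂ, 1 ≤ s.re → ‖Polynomial.aeval s⁻¹ Q‖ ≤ C := by
    intro Q
    induction Q using Polynomial.induction_on with
    | C r => exact ⟨|r|, fun s _ => by simp⟩
    | add p q hp hq => simpa using hadd _ _ hp hq
    | monomial n r h =>
      have := hmul _ _ h hinv
      simpa [pow_succ, mul_assoc] using this
  induction P using Polynomial.induction_on with
  | C Q => simpa only [expEval_C] using hC Q
  | add p q hp hq => simpa using hadd _ _ hp hq
  | monomial n r h =>
    have := hmul _ _ h hX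
    simpa only [pow_succ, ← mul_assoc, map_mul, expEval_X] using this

theorem expEval_bound (P : Polynomial (Polynomial ℝ)) {M : ℕ} (h : ∀ m < M, P.coeff m = 0) :
    ∃ C, ∀ s : ℂ, 1 ≤ s.re → ‖expEval s P‖ ≤ C * Real.exp (-M * s.re) := by
  obtain ⟨Q, rfl⟩ := Polynomial.X_pow_dvd_iff.2 h
  obtain ⟨C, hC⟩ := expEval_bounded Q
  refine ⟨C, fun s hs => ?_⟩
  rw [map_mul, map_pow, expEval_X, norm_mul, norm_pow, Complex.norm_exp, ← Real.exp_nat_mul,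
    mul_comm]
  refine mul_le_mul (hC s hs) (le_of_eq ?_) (Real.exp_pos _).le ((norm_nonneg _).trans (hC s hs))
  rw [Complex.neg_re]
  ring_nf

/-- `h` is analytic on a right half plane, with the asymptotic expansion
`∑ F_m(s⁻¹) e^(-m s)` there. -/
def HasExp (h : ℂ → ℂ) (F : PowerSeries (Polynomial ℝ)) : Prop :=
  ∃ a ≥ (1 : ℝ), AnalyticOnNhd ℂ h (halfPlane a) ∧ ∀ M : ℕ, ∃ C : ℝ, ∀ s ∈ halfPlane a,
    ‖h s - expEval s (F.trunc M)‖ ≤ C * Real.exp (-M * s.re)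

theorem halfPlane_anti {a a' : ℝ} (h : a ≤ a') : halfPlane a' ⊆ halfPlane a :=
  fun _ hs => le_trans h hs

/-- Terms of degree at least `M` are absorbed in the error, so an expansion can be verified with any
polynomial that is correct below `M`. -/
theorem norm_sub_le_of_agree {h : ℂ → ℂ} {a : ℝ} (ha : 1 ≤ a) {P Q : Polynomial (Polynomial ℝ)}
    {M : ℕ} (hPQ : ∀ m < M, P.coeff m = Q.coeff m)
    (hP : ∃ C : ℝ, ∀ s ∈ halfPlane a, ‖h s - expEval s P‖ ≤ C * Real.exp (-M * s.re)) :
    ∃ C : ℝ, ∀ s ∈ halfPlane a, ‖h s - expEval s Q‖ ≤ C * Real.exp (-M * s.re) := by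
  obtain ⟨C, hC⟩ := hP
  obtain ⟨D, hD⟩ := expEval_bound (P - Q) (M := M) fun m hm => by simp [hPQ m hm]
  refine ⟨C + D, fun s hs => ?_⟩
  have h1 := hD s (ha.trans hs)
  calc ‖h s - expEval s Q‖ = ‖(h s - expEval s P) + expEval s (P - Q)‖ := by
        rw [map_sub]; ring_nf
    _ ≤ _ := by
        rw [add_mul]
        exact (norm_add_le _ _).trans (add_le_add (hC s hs) h1)

namespace HasExp

theorem of_approx {h : ℂ → ℂ} {F : PowerSeries (Polynomial ℝ)} {a : ℝ} (ha : 1 ≤ a)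
    (han : AnalyticOnNhd ℂ h (halfPlane a))
    (H : ∀ M : ℕ, ∃ P : Polynomial (Polynomial ℝ), (∀ m < M, P.coeff m = F.coeff m) ∧
      ∃ C : ℝ, ∀ s ∈ halfPlane a, ‖h s - expEval s P‖ ≤ C * Real.exp (-M * s.re)) :
    HasExp h F := by
  refine ⟨a, ha, han, fun M => ?_⟩
  obtain ⟨P, hP, hC⟩ := H M
  exact norm_sub_le_of_agree ha (fun m hm => by rw [hP m hm, PowerSeries.coeff_trunc, if_pos hm]) hC

theorem exists_halfPlane {h : ℂ → ℂ} {F : PowerSeries (Polynomial ℝ)} (H : HasExp h F) :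
    ∃ a ≥ (1 : ℝ), AnalyticOnNhd ℂ h (halfPlane a) ∧ ∀ a' ≥ a, ∀ M : ℕ,
      ∃ C : ℝ, ∀ s ∈ halfPlane a',
        ‖h s - expEval s (F.trunc M)‖ ≤ C * Real.exp (-M * s.re) := by
  obtain ⟨a, ha, han, H⟩ := H
  refine ⟨a, ha, han, fun a' h' M => ?_⟩
  obtain ⟨C, hC⟩ := H M
  exact ⟨C, fun s hs => hC s (halfPlane_anti h' hs)⟩

theorem add {h₁ h₂ : ℂ → ℂ} {F₁ F₂ : PowerSeries (Polynomial ℝ)} (H₁ : HasExp h₁ F₁)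
    (H₂ : HasExp h₂ F₂) : HasExp (fun s => h₁ s + h₂ s) (F₁ + F₂) := by
  obtain ⟨a₁, ha₁, an₁, H₁⟩ := H₁.exists_halfPlane
  obtain ⟨a₂, ha₂, an₂, H₂⟩ := H₂.exists_halfPlane
  refine of_approx (a := max a₁ a₂) (ha₁.trans (le_max_left _ _)) (fun s hs =>
    (an₁ s (halfPlane_anti (le_max_left _ _) hs)).add
      (an₂ s (halfPlane_anti (le_max_right _ _) hs))) fun M =>
    ⟨F₁.trunc M + F₂.trunc M, fun m hm => ?_, ?_⟩
  · simp [PowerSeries.coeff_trunc, hm]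
  · obtain ⟨C, hC⟩ := H₁ _ (le_max_left a₁ a₂) M
    obtain ⟨D, hD⟩ := H₂ _ (le_max_right a₁ a₂) M
    refine ⟨C + D, fun s hs => ?_⟩
    rw [map_add, add_sub_add_comm, add_mul]
    exact (norm_add_le _ _).trans (add_le_add (hC s hs) (hD s hs))

theorem mul {h₁ h₂ : ℂ → ℂ} {F₁ F₂ : PowerSeries (Polynomial ℝ)} (H₁ : HasExp h₁ F₁)
    (H₂ : HasExp h₂ F₂) : HasExp (fun s => h₁ s * h₂ s) (F₁ * F₂) := by
  obtain ⟨a₁, ha₁, an₁, H₁⟩ := H₁.exists_halfPlane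
  obtain ⟨a₂, ha₂, an₂, H₂⟩ := H₂.exists_halfPlane
  have ha : 1 ≤ max a₁ a₂ := ha₁.trans (le_max_left _ _)
  refine of_approx (a := max a₁ a₂) ha (fun s hs =>
    (an₁ s (halfPlane_anti (le_max_left _ _) hs)).mul
      (an₂ s (halfPlane_anti (le_max_right _ _) hs))) fun M =>
    ⟨F₁.trunc M * F₂.trunc M, fun m hm => ?_, ?_⟩
  · rw [PowerSeries.coeff_mul_eq_coeff_trunc_mul_trunc _ _ hm, ← Polynomial.coe_mul,
      Polynomial.coeff_coe]
  · obtain ⟨C, hC⟩ := H₁ _ (le_max_left a₁ a₂) M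
    obtain ⟨D, hD⟩ := H₂ _ (le_max_right a₁ a₂) M
    -- The approximation of order `0` is the boundedness of `h₂`.
    obtain ⟨D₀, hD₀⟩ := H₂ _ (le_max_right a₁ a₂) 0
    obtain ⟨C₁, hC₁⟩ := expEval_bounded (F₁.trunc M)
    refine ⟨C * D₀ + C₁ * D, fun s hs => ?_⟩
    have h0 : ‖h₂ s‖ ≤ D₀ := by simpa using hD₀ s hs
    have h1 := hC₁ s (ha.trans hs)
    have key : h₁ s * h₂ s - expEval s (F₁.trunc M * F₂.trunc M) =
        (h₁ s - expEval s (F₁.trunc M)) * h₂ s +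
          expEval s (F₁.trunc M) * (h₂ s - expEval s (F₂.trunc M)) := by
      rw [map_mul]; ring
    rw [key]
    refine (norm_add_le _ _).trans ?_
    rw [norm_mul, norm_mul]
    have e1 := mul_le_mul (hC s hs) h0 (norm_nonneg _) ((norm_nonneg _).trans (hC s hs))
    have e2 := mul_le_mul h1 (hD s hs) (norm_nonneg _) ((norm_nonneg _).trans h1)
    linarith

theorem coe_polynomial {P : Polynomial (Polynomial ℝ)} {h : ℂ → ℂ}
    (hP : ∀ s, 1 ≤ s.re → h s = expEval s P) (han : AnalyticOnNhd ℂ h (halfPlane 1)) :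
    HasExp h P := by
  refine of_approx le_rfl han fun M => ⟨P, fun m _ => by rw [Polynomial.coeff_coe], 0, ?_⟩
  intro s hs
  rw [hP s hs]
  simp

theorem aeval_inv (Q : Polynomial ℝ) :
    HasExp (fun s => Polynomial.aeval s⁻¹ Q) (PowerSeries.C Q) := by
  have h := coe_polynomial (P := Polynomial.C Q) (h := fun s => Polynomial.aeval s⁻¹ Q)
    (fun s _ => (expEval_C s Q).symm) ?_
  · simpa using h
  · intro s hs
    have h0 : s ≠ 0 := by
      rintro rfl
      have : (1 : ℝ) ≤ 0 := hs
      linarith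
    exact AnalyticAt.aeval_polynomial (analyticAt_id.inv h0) Q

theorem const (r : ℝ) : HasExp (fun _ => (r : ℂ)) (PowerSeries.C (Polynomial.C r)) := by
  simpa using aeval_inv (Polynomial.C r)

theorem inv_id : HasExp (fun s => s⁻¹) (PowerSeries.C Polynomial.X) := by
  simpa using aeval_inv Polynomial.X

theorem exp_neg : HasExp (fun s => Complex.exp (-s)) PowerSeries.X := by
  simpa using coe_polynomial (P := Polynomial.X) (h := fun s => Complex.exp (-s))
    (fun s _ => (expEval_X s).symm) fun s _ => analyticAt_id.neg.cexp

theorem congr {h h' : ℂ → ℂ} {F : PowerSeries (Polynomial ℝ)} (H : HasExp h F)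
    (hh : ∀ s, h' s = h s) : HasExp h' F := by
  rwa [show h' = h from funext hh]

theorem sum {ι : Type*} (t : Finset ι) {h : ι → ℂ → ℂ} {F : ι → PowerSeries (Polynomial ℝ)}
    (H : ∀ i, HasExp (h i) (F i)) : HasExp (fun s => ∑ i ∈ t, h i s) (∑ i ∈ t, F i) := by
  classical
  induction t using Finset.induction_on with
  | empty => simpa using const 0
  | insert i t hi ih =>
    simp only [Finset.sum_insert hi]
    exact (H i).add ih

theorem pow {h : ℂ → ℂ} {F : PowerSeries (Polynomial ℝ)} (H : HasExp h F) (n : ℕ) :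
    HasExp (fun s => h s ^ n) (F ^ n) := by
  induction n with
  | zero => simpa using const 1
  | succ n ih =>
    simp only [pow_succ]
    exact ih.mul H

end HasExp

theorem expEval_trunc (s : ℂ) (F : PowerSeries (Polynomial ℝ)) (M : ℕ) :
    expEval s (F.trunc M) =
      ∑ m ∈ Finset.range M, Polynomial.aeval s⁻¹ (F.coeff m) * Complex.exp (-m * s) := by
  have h : F.trunc M = ∑ m ∈ Finset.range M, Polynomial.monomial m (F.coeff m) := by
    ext1 m
    simp [PowerSeries.coeff_trunc, Polynomial.coeff_monomial]
  rw [h, map_sum]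
  refine Finset.sum_congr rfl fun m _ => ?_
  rw [← Polynomial.C_mul_X_pow_eq_monomial, map_mul, map_pow, expEval_C, expEval_X,
    ← Complex.exp_nat_mul]
  ring_nf

namespace HasExp

theorem approx {h : ℂ → ℂ} {F : PowerSeries (Polynomial ℝ)} (H : HasExp h F) :
    ∃ a ≥ (1 : ℝ), AnalyticOnNhd ℂ h (halfPlane a) ∧ ∀ M : ℕ, ∃ C : ℝ, ∀ s ∈ halfPlane a,
      ‖h s - ∑ m ∈ Finset.range M, Polynomial.aeval s⁻¹ (F.coeff m) * Complex.exp (-m * s)‖ ≤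
        C * Real.exp (-M * s.re) := by
  simpa only [HasExp, expEval_trunc] using H

theorem bounded {h : ℂ → ℂ} {F : PowerSeries (Polynomial ℝ)} (H : HasExp h F) :
    ∃ a ≥ (1 : ℝ), AnalyticOnNhd ℂ h (halfPlane a) ∧ ∃ C, ∀ s ∈ halfPlane a, ‖h s‖ ≤ C := by
  obtain ⟨a, ha, han, H⟩ := H
  obtain ⟨C, hC⟩ := H 0
  exact ⟨a, ha, han, C, fun s hs => by simpa using hC s hs⟩

theorem decay {h : ℂ → ℂ} {F : PowerSeries (Polynomial ℝ)} (H : HasExp h F)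
    (h0 : F.coeff 0 = 0) : ∃ a ≥ (1 : ℝ), AnalyticOnNhd ℂ h (halfPlane a) ∧
      ∃ C, ∀ s ∈ halfPlane a, ‖h s‖ ≤ C * Real.exp (-s.re) := by
  obtain ⟨a, ha, han, H⟩ := H.approx
  obtain ⟨C, hC⟩ := H 1
  exact ⟨a, ha, han, C, fun s hs => by simpa [h0] using hC s hs⟩

/-- In the strip `a' ≤ Re s ≤ a` the factor `e^(-M Re s)` is bounded below, so boundedness suffices
there. This gives estimates of all orders on one prescribed half plane. -/
theorem bound_of_bounded {h : ℂ → ℂ} {F : PowerSeries (Polynomial ℝ)} (H : HasExp h F) {a' : ℝ}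
    (ha' : 1 ≤ a') (hb : ∃ C, ∀ s ∈ halfPlane a', ‖h s‖ ≤ C) (M : ℕ) :
    ∃ C : ℝ, ∀ s ∈ halfPlane a', ‖h s - expEval s (F.trunc M)‖ ≤ C * Real.exp (-M * s.re) := by
  obtain ⟨a, ha, -, H⟩ := H
  obtain ⟨D, hD⟩ := H M
  obtain ⟨C, hC⟩ := hb
  obtain ⟨E, hE⟩ := expEval_bounded (F.trunc M)
  have hC0 : 0 ≤ C := (norm_nonneg _).trans (hC a' (show a' ≤ ((a' : ℝ) : ℂ).re by simp))
  have hE0 : 0 ≤ E := (norm_nonneg _).trans (hE 1 (by simp))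
  refine ⟨|D| + (C + E) * Real.exp (M * a), fun s hs => ?_⟩
  rcases le_total a s.re with hsa | hsa
  · refine (hD s hsa).trans (mul_le_mul_of_nonneg_right ?_ (Real.exp_pos _).le)
    have : 0 ≤ (C + E) * Real.exp (M * a) := by positivity
    linarith [le_abs_self D]
  · have h1 : ‖h s - expEval s (F.trunc M)‖ ≤ C + E :=
      (norm_sub_le _ _).trans (add_le_add (hC s hs) (hE s (ha'.trans hs)))
    have h2 : 1 ≤ Real.exp (M * a) * Real.exp (-M * s.re) := by
      rw [← Real.exp_add, Real.one_le_exp_iff]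
      nlinarith [show (0 : ℝ) ≤ M from Nat.cast_nonneg M]
    have h3 : 0 ≤ |D| * Real.exp (-M * s.re) := by positivity
    rw [add_mul, mul_assoc]
    nlinarith

end HasExp

/-- The expansion of `log (1 + u)`, where `u` has the expansion `U` without constant term. -/
noncomputable def logSeries (U : PowerSeries (Polynomial ℝ)) : PowerSeries (Polynomial ℝ) :=
  PowerSeries.mk fun m => PowerSeries.coeff m (∑ j ∈ Finset.range (m + 1),
    PowerSeries.C (Polynomial.C ((-1) ^ (j + 1) / (j : ℝ))) * U ^ j)

/-- As `U^j` is divisible by the `j`-th power of the variable, the terms with `j > m` do not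
contribute. -/
theorem coeff_logSeries {U : PowerSeries (Polynomial ℝ)} (hU : U.coeff 0 = 0) {m M : ℕ}
    (hm : m < M) : (logSeries U).coeff m = PowerSeries.coeff m (∑ j ∈ Finset.range M,
      PowerSeries.C (Polynomial.C ((-1) ^ (j + 1) / (j : ℝ))) * U ^ j) := by
  rw [logSeries, PowerSeries.coeff_mk, map_sum, map_sum]
  refine Finset.sum_subset (Finset.range_mono hm) fun j _ hj => ?_
  have hj : m < j := by simpa using hj
  have hd : PowerSeries.X ^ j ∣ U ^ j :=
    pow_dvd_pow_of_dvd (PowerSeries.X_dvd_iff.2 (by simpa using hU)) j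
  rw [PowerSeries.coeff_C_mul, PowerSeries.X_pow_dvd_iff.1 hd m hj, mul_zero]

theorem coeff_zero_logSeries (U : PowerSeries (Polynomial ℝ)) : (logSeries U).coeff 0 = 0 := by
  simp [logSeries]

/-- Since `u = O(e^(-Re s))`, the Taylor polynomial of degree `M` approximates the logarithm up to
`O(e^(-(M+1) Re s))`, and it has an expansion as a polynomial in `u`. -/
theorem HasExp.log_one_add {u : ℂ → ℂ} {U : PowerSeries (Polynomial ℝ)} (H : HasExp u U)
    (hU : U.coeff 0 = 0) : HasExp (fun s => Complex.log (1 + u s)) (logSeries U) := by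
  obtain ⟨a, ha, han, C, hC⟩ := H.decay hU
  have hC0 : 0 ≤ C := by
    have := (norm_nonneg _).trans (hC a (show a ≤ ((a : ℝ) : ℂ).re by simp))
    exact nonneg_of_mul_nonneg_left this (Real.exp_pos _)
  have hsmall : ∃ a' ≥ a, ∀ s ∈ halfPlane a', ‖u s‖ ≤ 1 / 2 := by
    have hlim : Tendsto (fun x : ℝ => C * Real.exp (-x)) atTop (𝓝 (C * 0)) :=
      Real.tendsto_exp_neg_atTop_nhds_zero.const_mul C
    rw [mul_zero] at hlim
    obtain ⟨x₀, hx₀⟩ := (hlim.eventually_le_const (by norm_num : (0 : ℝ) < 1 / 2)).exists_forall_of_atTop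
    refine ⟨max a x₀, le_max_left _ _, fun s hs => ?_⟩
    exact (hC s (halfPlane_anti (le_max_left _ _) hs)).trans
      (hx₀ _ ((le_max_right _ _).trans hs))
  obtain ⟨a', haa', hsm⟩ := hsmall
  have hlogT : ∀ M : ℕ, HasExp (fun s => Complex.logTaylor M (u s))
      (∑ j ∈ Finset.range M,
        PowerSeries.C (Polynomial.C ((-1) ^ (j + 1) / (j : ℝ))) * U ^ j) := fun M => by
    refine (HasExp.sum (Finset.range M) fun j =>
      (HasExp.const ((-1) ^ (j + 1) / (j : ℝ))).mul (H.pow j)).congr fun s => ?_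
    rw [Complex.logTaylor]
    refine Finset.sum_congr rfl fun j _ => ?_
    push_cast
    ring
  -- The half plane provided by `hlogT` may depend on `M`. The bound `‖u‖ ≤ 1/2` makes the Taylor
  -- polynomials bounded on the half plane of `a'`, which then serves for all `M`.
  have hpoly : ∀ M : ℕ, ∃ C : ℝ, ∀ s ∈ halfPlane a',
      ‖Complex.logTaylor (M + 1) (u s) - expEval s ((∑ j ∈ Finset.range (M + 1),
        PowerSeries.C (Polynomial.C ((-1) ^ (j + 1) / (j : ℝ))) * U ^ j).trunc M)‖ ≤
          C * Real.exp (-M * s.re) := by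
    intro M
    refine (hlogT (M + 1)).bound_of_bounded (ha.trans haa')
      ⟨∑ j ∈ Finset.range (M + 1), 1, fun s hs => ?_⟩ M
    rw [Complex.logTaylor]
    refine (norm_sum_le _ _).trans (Finset.sum_le_sum fun j _ => ?_)
    rw [norm_div, norm_mul, norm_pow, norm_neg, norm_one, one_pow, one_mul, norm_pow,
      Complex.norm_natCast]
    rcases Nat.eq_zero_or_pos j with rfl | hj
    · simp
    · refine (div_le_self (by positivity) (by exact_mod_cast hj)).trans (pow_le_one₀ (norm_nonneg _) ?_)
      linarith [hsm s hs]
  refine HasExp.of_approx (ha.trans haa') (fun s hs => ?_) fun M =>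
    ⟨(∑ j ∈ Finset.range (M + 1), PowerSeries.C (Polynomial.C ((-1) ^ (j + 1) / (j : ℝ))) *
      U ^ j).trunc M, fun m hm => ?_, ?_⟩
  · have h1 := (han s (halfPlane_anti haa' hs))
    refine (analyticAt_const.add h1).clog ?_
    refine Complex.mem_slitPlane_of_norm_lt_one ?_
    linarith [hsm s hs]
  · rw [PowerSeries.coeff_trunc, if_pos hm, coeff_logSeries hU (hm.trans (Nat.lt_succ_self M))]
  · obtain ⟨D, hD⟩ := hpoly M
    refine ⟨D + 2 * C ^ (M + 1), fun s hs => ?_⟩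
    have h1 := hsm s hs
    have h2 := Complex.norm_log_sub_logTaylor_le M (z := u s) (by linarith)
    have h3 : (1 - ‖u s‖)⁻¹ ≤ 2 := by
      rw [inv_le_comm₀ (by linarith) (by norm_num)]
      linarith
    have h4 : ‖u s‖ ^ (M + 1) ≤ C ^ (M + 1) * Real.exp (-M * s.re) := by
      have h5 := hC s (halfPlane_anti haa' hs)
      have hs0 : 0 ≤ s.re := by linarith [show a' ≤ s.re from hs]
      calc ‖u s‖ ^ (M + 1) ≤ (C * Real.exp (-s.re)) ^ (M + 1) := by gcongr
        _ = C ^ (M + 1) * Real.exp (-(M + 1 : ℕ) * s.re) := by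
          rw [mul_pow, ← Real.exp_nat_mul]
          ring_nf
        _ ≤ _ := by
          gcongr
          linarith
    have h6 : ‖Complex.log (1 + u s) - Complex.logTaylor (M + 1) (u s)‖ ≤
        2 * C ^ (M + 1) * Real.exp (-M * s.re) := by
      have : 0 ≤ (1 - ‖u s‖)⁻¹ := inv_nonneg.2 (by linarith)
      refine h2.trans ((div_le_self (by positivity) (by
        have : (0 : ℝ) ≤ M := Nat.cast_nonneg M
        linarith)).trans ?_)
      calc ‖u s‖ ^ (M + 1) * (1 - ‖u s‖)⁻¹ ≤ (C ^ (M + 1) * Real.exp (-M * s.re)) * 2 := by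
            gcongr
        _ = _ := by ring
    calc _ = ‖(Complex.log (1 + u s) - Complex.logTaylor (M + 1) (u s)) +
          (Complex.logTaylor (M + 1) (u s) - expEval s ((∑ j ∈ Finset.range (M + 1),
        PowerSeries.C (Polynomial.C ((-1) ^ (j + 1) / (j : ℝ))) * U ^ j).trunc M))‖ := by
          congr 1; ring
      _ ≤ _ := (norm_add_le _ _).trans (by
          rw [add_mul]
          linarith [hD s hs])

/-- The expansion of the derivative of a function. -/
noncomputable def derivSeries (F : PowerSeries (Polynomial ℝ)) : PowerSeries (Polynomial ℝ) :=
  PowerSeries.mk fun m => -(Polynomial.C (m : ℝ)) * F.coeff m -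
    Polynomial.X ^ 2 * Polynomial.derivative (F.coeff m)

/-- Termwise, `Q(s⁻¹) e^(-ms)` has the derivative `(-m Q(s⁻¹) - s⁻² Q'(s⁻¹)) e^(-ms)`, so truncation
commutes with differentiation. -/
theorem hasDerivAt_expEval_trunc (F : PowerSeries (Polynomial ℝ)) (M : ℕ) {s : ℂ} (hs : s ≠ 0) :
    HasDerivAt (fun s => expEval s (F.trunc M)) (expEval s ((derivSeries F).trunc M)) s := by
  simp only [expEval_trunc]
  refine HasDerivAt.fun_sum fun m _ => ?_
  have h1 : HasDerivAt (fun s : ℂ => Polynomial.aeval s⁻¹ (F.coeff m))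
      (Polynomial.aeval s⁻¹ (Polynomial.derivative (F.coeff m)) * -(s ^ 2)⁻¹) s :=
    HasDerivAt.comp s (Polynomial.hasDerivAt_aeval _ _) (hasDerivAt_inv hs)
  have h2 : HasDerivAt (fun s : ℂ => Complex.exp (-m * s)) (Complex.exp (-m * s) * (-m * 1)) s :=
    ((hasDerivAt_id s).const_mul _).cexp
  convert! h1.mul h2 using 1
  simp [derivSeries]
  ring

/-- Cauchy's estimate on unit disks turns the bound for the error into one for its derivative. The
half plane shrinks by `1` and the constant grows by `e^M`. -/
theorem HasExp.deriv {h : ℂ → ℂ} {F : PowerSeries (Polynomial ℝ)} (H : HasExp h F) :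
    HasExp (deriv h) (derivSeries F) := by
  obtain ⟨a, ha, han, H⟩ := H
  have hsub : ∀ s ∈ halfPlane (a + 1), Metric.closedBall s 1 ⊆ halfPlane a := by
    intro s hs z hz
    have h1 := Complex.abs_re_le_norm (z - s)
    rw [Complex.sub_re] at h1
    have h2 : ‖z - s‖ ≤ 1 := by simpa [dist_eq_norm] using hz
    have h3 : a + 1 ≤ s.re := hs
    change a ≤ z.re
    linarith [neg_abs_le (z.re - s.re)]
  have hne : ∀ s ∈ halfPlane a, s ≠ 0 := by
    rintro s hs rfl
    have : a ≤ 0 := hs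
    linarith
  refine ⟨a + 1, by linarith, fun s hs => (han s (halfPlane_anti (by linarith) hs)).deriv,
    fun M => ?_⟩
  obtain ⟨C, hC⟩ := H M
  refine ⟨C * Real.exp M, fun s hs => ?_⟩
  have hs' : s ∈ halfPlane a := halfPlane_anti (by linarith) hs
  have hd : ∀ z ∈ halfPlane a, HasDerivAt (fun s => h s - expEval s (F.trunc M))
      (_root_.deriv h z - expEval z ((derivSeries F).trunc M)) z := fun z hz =>
    (han z hz).differentiableAt.hasDerivAt.sub (hasDerivAt_expEval_trunc F M (hne z hz))
  have hC0 : 0 ≤ C := by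
    have := (norm_nonneg _).trans (hC s hs')
    exact nonneg_of_mul_nonneg_left this (Real.exp_pos _)
  rw [← (hd s hs').deriv]
  have := Complex.norm_deriv_le_of_forall_mem_sphere_norm_le one_pos (c := s)
    (f := fun s => h s - expEval s (F.trunc M)) (C := C * Real.exp M * Real.exp (-M * s.re)) ?_ ?_
  · simpa using this
  · refine DifferentiableOn.diffContOnCl fun z hz => ?_
    rw [closure_ball _ one_ne_zero] at hz
    exact (hd z (hsub s hs hz)).differentiableAt.differentiableWithinAt
  · intro z hz
    refine (hC z (hsub s hs (Metric.sphere_subset_closedBall hz))).trans ?_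
    rw [mul_assoc, ← Real.exp_add]
    refine mul_le_mul_of_nonneg_left (Real.exp_le_exp.2 ?_) hC0
    have h1 := Complex.abs_re_le_norm (z - s)
    rw [Complex.sub_re] at h1
    have h2 : ‖z - s‖ = 1 := by simpa [dist_eq_norm] using hz
    have h3 := neg_abs_le (z.re - s.re)
    nlinarith [show (0 : ℝ) ≤ M from Nat.cast_nonneg M]

/-! ### STAR-series in powers of `e^(-X)` -/

theorem mul_exp_isExponent (r : ℝ) : IsExponent (fun ζ => (r : ℂ) * Complex.exp ζ) r := by
  refine ⟨0, fun ζ _ => analyticAt_const.mul analyticAt_id.cexp, fun _ => 0, fun q => q + 1,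
    by norm_num, fun i j h => by simpa using h,
    tendsto_atTop_add_const_right _ _ tendsto_natCast_atTop_atTop, fun N => ⟨0, fun ζ _ => ?_⟩⟩
  simp

theorem monomial_mem_FC0 (r : ℝ) {c : ℝ} (hc : 0 < c) :
    (fun ζ : ℂ => (r : ℂ) * Complex.exp (-(c : ℂ) * ζ)) ∈ FC0 := by
  refine ⟨0, le_rfl, fun ζ _ => analyticAt_const.mul (analyticAt_const.mul analyticAt_id).cexp,
    -- A Dulac series is infinite by definition; the single term is padded with zero coefficients at
    -- the exponents `c + q`.
    fun q => if q = 0 then r else 0, fun q => c + q, by simpa using hc,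
    fun i j h => by simpa using h,
    tendsto_atTop_add_const_left _ _ tendsto_natCast_atTop_atTop, fun N => ⟨|r|, fun ζ _ => ?_⟩⟩
  rcases Nat.eq_zero_or_pos N with rfl | hN
  · simp [Complex.norm_exp]
  · have : ∑ q ∈ Finset.range N, (((if q = 0 then r else 0 : ℝ) : ℝ) : ℂ) *
        Complex.exp (-((c + (q : ℝ) : ℝ) : ℂ) * ζ) = r * Complex.exp (-(c : ℂ) * ζ) := by
      rw [Finset.sum_eq_single_of_mem 0 (Finset.mem_range.2 hN)]
      · simp
      · intro q _ hq
        simp [hq]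
    rw [this, sub_self, norm_zero]
    positivity

theorem aeval_exp_neg_mem_K10 (Q : Polynomial ℝ) :
    (fun ζ => Polynomial.aeval (Complex.exp ζ)⁻¹ Q) ∈ K10 := by
  -- Elements of `FC0` have no constant term, so `e^(-iζ)` is written as `e^ζ · e^(-(i+1)ζ)`, with
  -- `λ = 1`.
  refine ⟨Q.natDegree + 1, fun _ => 1, fun i ζ => (Q.coeff i : ℂ) *
    Complex.exp (-((i + 1 : ℝ) : ℂ) * ζ), fun i => ⟨one_pos, monomial_mem_FC0 _ (by positivity)⟩,
    1, one_pos, fun ζ _ => ?_⟩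
  beta_reduce
  rw [Polynomial.aeval_eq_sum_range, Finset.sum_range]
  refine Finset.sum_congr rfl fun i _ => ?_
  rw [← Complex.exp_neg, ← Complex.exp_nat_mul, Complex.real_smul, mul_left_comm, ← Complex.exp_add]
  congr 2
  push_cast
  ring

theorem eventually_mul_exp_le (C : ℝ) {m l : ℝ} (h : l < m) :
    ∃ b > 0, ∀ x ≥ b, C * Real.exp (-m * x) ≤ Real.exp (-l * x) := by
  have hlim : Tendsto (fun x : ℝ => Real.exp ((m - l) * x)) atTop atTop :=
    Real.tendsto_exp_atTop.comp (tendsto_id.const_mul_atTop (sub_pos.2 h))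
  obtain ⟨x₀, hx₀⟩ := (hlim.eventually_ge_atTop C).exists_forall_of_atTop
  refine ⟨max x₀ 1, by positivity, fun x hx => ?_⟩
  have h1 := hx₀ x ((le_max_left _ _).trans hx)
  calc C * Real.exp (-m * x) ≤ Real.exp ((m - l) * x) * Real.exp (-m * x) := by gcongr
    _ = Real.exp (-l * x) := by
      rw [← Real.exp_add]
      ring_nf

theorem exp_mem_halfPlane {b : ℝ} (hb : 0 < b) {ζ : ℂ} (hζ : ζ ∈ lnHalfPlane b) :
    Complex.exp ζ ∈ halfPlane b ∧ Complex.log (Complex.exp ζ) = ζ := by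
  obtain ⟨h1, h2⟩ := (mem_lnHalfPlane_iff hb).1 hζ
  have h2 := abs_lt.1 h2
  have := Real.pi_pos
  exact ⟨h1, Complex.log_exp (by linarith) (by linarith)⟩

/-- An expansion in powers of `e^(-X)` is a STAR-series with the exponents `-q e^ζ`. The definition
allows no constants in the bounds; they are absorbed by passing to a smaller rate, `1/2` instead of
`1` or `l` instead of `N`. -/
theorem mem_starClass {Z : Set ℂ} {K : Set (ℂ → ℂ)} {ψ : ℂ → ℂ} {κ : ℕ → ℂ → ℂ} {a : ℝ}
    (han : AnalyticOnNhd ℂ ψ (halfPlane a)) (hκ : ∀ q, κ q ∈ K)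
    (hdec : ∃ b C, ∀ X ∈ halfPlane b, ‖ψ X‖ ≤ C * Real.exp (-X.re))
    (happ : ∀ N : ℕ, ∃ b C, ∀ X ∈ halfPlane b,
      ‖ψ X - ∑ q ∈ Finset.range N, κ q (Complex.log X) * Complex.exp (-q * X)‖ ≤
        C * Real.exp (-N * X.re)) : ψ ∈ starClass Z K := by
  refine ⟨⟨a, han⟩, ⟨1 / 2, by norm_num, ?_⟩, κ,
    fun q ζ => ((-(q : ℝ) : ℝ) : ℂ) * Complex.exp ζ, fun q => -(q : ℝ), hκ,
    fun q => mul_exp_isExponent _, fun i j h => by simpa using h,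
    tendsto_neg_atTop_atBot.comp tendsto_natCast_atTop_atTop, fun l _ => ?_⟩
  · obtain ⟨b, C, hC⟩ := hdec
    obtain ⟨b', hb', h⟩ := eventually_mul_exp_le C (show (1 / 2 : ℝ) < 1 by norm_num)
    have hp : 0 < max b b' := hb'.trans_le (le_max_right _ _)
    refine ⟨_, hp, fun ζ hζ => ?_⟩
    have h1 := (exp_mem_halfPlane hp hζ.1).1
    refine (hC _ (halfPlane_anti (le_max_left _ _) h1)).trans ?_
    have := h _ ((le_max_right b b').trans h1)
    rwa [neg_one_mul] at this
  · obtain ⟨N₀, hN₀⟩ := exists_nat_gt l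
    refine ⟨N₀, fun N hN => ?_⟩
    obtain ⟨b, C, hC⟩ := happ N
    obtain ⟨b', hb', h⟩ := eventually_mul_exp_le C (show l < (N : ℝ) from
      hN₀.trans_le (by exact_mod_cast hN))
    have hp : 0 < max b b' := hb'.trans_le (le_max_right _ _)
    refine ⟨_, hp, fun ζ hζ => ?_⟩
    have h1 := exp_mem_halfPlane hp hζ.1
    have h2 := hC _ (halfPlane_anti (le_max_left _ _) h1.1)
    rw [h1.2] at h2
    refine le_trans (le_of_eq ?_) (h2.trans (h _ ((le_max_right b b').trans h1.1)))
    simp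

theorem HasExp.mem_FC1 {h : ℂ → ℂ} {F : PowerSeries (Polynomial ℝ)} (H : HasExp h F)
    (h0 : F.coeff 0 = 0) (Z : Set ℂ) : h ∈ FC1 Z 0 := by
  obtain ⟨a', -, -, hd⟩ := H.decay h0
  obtain ⟨a, ha, han, H⟩ := H.approx
  refine mem_starClass han (fun q => aeval_exp_neg_mem_K10 (F.coeff q)) ⟨a', hd⟩
    fun N => ⟨a, ?_⟩
  obtain ⟨C, hC⟩ := H N
  refine ⟨C, fun X hX => ?_⟩
  have hX0 : X ≠ 0 := by
    rintro rfl
    have : a ≤ 0 := hX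
    linarith
  simp only [Complex.exp_log hX0]
  exact hC X hX

/-! ### The functions of the example -/

/-- `log (1 + e^(-s))`. -/
noncomputable def ell (s : ℂ) : ℂ := Complex.log (1 + Complex.exp (-s))

/-- The functions whose compositions with the square root are the iterated derivatives of
`X ↦ log (1 - ell √X / √X)`. -/
noncomputable def gam : ℕ → ℂ → ℂ
  | 0 => fun s => Complex.log (1 + -(s⁻¹ * ell s))
  | n + 1 => fun s => deriv (gam n) s * (2⁻¹ * s⁻¹)

/-- The expansion of `gam n`. -/
noncomputable def gamSeries : ℕ → PowerSeries (Polynomial ℝ)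
  | 0 => logSeries (PowerSeries.C (Polynomial.C (-1)) *
      (PowerSeries.C Polynomial.X * logSeries PowerSeries.X))
  | n + 1 => derivSeries (gamSeries n) *
      (PowerSeries.C (Polynomial.C 2⁻¹) * PowerSeries.C Polynomial.X)

theorem hasExp_ell : HasExp ell (logSeries PowerSeries.X) :=
  HasExp.exp_neg.log_one_add (by simp)

theorem coeff_zero_gamSeries (n : ℕ) : (gamSeries n).coeff 0 = 0 := by
  induction n with
  | zero => exact coeff_zero_logSeries _
  | succ n ih =>
    rw [gamSeries, ← map_mul, PowerSeries.coeff_mul_C, derivSeries, PowerSeries.coeff_mk, ih]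
    simp

theorem hasExp_gam (n : ℕ) : HasExp (gam n) (gamSeries n) := by
  induction n with
  | zero =>
    refine (((HasExp.const (-1)).mul (HasExp.inv_id.mul hasExp_ell)).log_one_add ?_).congr
      fun s => ?_
    · simpa using coeff_zero_logSeries PowerSeries.X
    · simp [gam]
  | succ n ih =>
    exact (ih.deriv.mul ((HasExp.const 2⁻¹).mul HasExp.inv_id)).congr fun s => by simp [gam]

/-- The principal square root. -/
noncomputable def csqrt (X : ℂ) : ℂ := Complex.exp (((1 / 2 : ℝ) : ℂ) * Complex.log X)

theorem csqrt_sq {X : ℂ} (hX : X ≠ 0) : csqrt X ^ 2 = X := by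
  rw [csqrt, ← Complex.exp_nat_mul]
  conv_rhs => rw [← Complex.exp_log hX]
  congr 1
  push_cast
  ring

/-- With `s = csqrt X` one has `Re X = (Re s)² - (Im s)² ≤ (Re s)²`, and `Re s > 0`. -/
theorem csqrt_mem_halfPlane {a : ℝ} {X : ℂ} (hX : 0 < X.re) (h : a ^ 2 ≤ X.re) :
    csqrt X ∈ halfPlane a := by
  have h0 : X ≠ 0 := by
    rintro rfl
    simp at hX
  have h1 : 0 < (csqrt X).re := by
    rw [csqrt, Complex.exp_re, Complex.im_ofReal_mul, Complex.log_im]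
    refine mul_pos (Real.exp_pos _) (Real.cos_pos_of_mem_Ioo ?_)
    have := abs_lt.1 (Complex.abs_arg_lt_pi_div_two_iff.2 (Or.inl hX))
    have := Real.pi_pos
    constructor <;> linarith
  have h2 : (csqrt X ^ 2).re = X.re := by rw [csqrt_sq h0]
  rw [pow_two, Complex.mul_re] at h2
  change a ≤ (csqrt X).re
  nlinarith [sq_nonneg (csqrt X).im]

theorem hasDerivAt_csqrt {X : ℂ} (hX : 0 < X.re) :
    HasDerivAt csqrt (2⁻¹ * (csqrt X)⁻¹) X := by
  have h0 : X ≠ 0 := by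
    rintro rfl
    simp at hX
  have h1 : HasDerivAt csqrt (csqrt X * (((1 / 2 : ℝ) : ℂ) * X⁻¹)) X :=
    ((Complex.hasDerivAt_log (Or.inl hX)).const_mul _).cexp
  convert! h1 using 1
  have h2 : csqrt X ≠ 0 := Complex.exp_ne_zero _
  have h3 := csqrt_sq h0
  rw [← mul_assoc, mul_comm (csqrt X)]
  nth_rewrite 3 [← h3]
  field_simp
  push_cast
  ring

/-- The iterated derivatives of `X ↦ log (1 - ell √X / √X)`. -/
noncomputable def gamSqrt (n : ℕ) (X : ℂ) : ℂ := gam n (csqrt X)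

theorem gamSqrt_spec (n : ℕ) : ∃ b ≥ (1 : ℝ), ∃ C, ∀ X ∈ halfPlane b,
    HasDerivAt (gamSqrt n) (gamSqrt (n + 1) X) X ∧ ‖gamSqrt n X‖ ≤ C := by
  obtain ⟨a, ha, han, C, hC⟩ := (hasExp_gam n).bounded
  refine ⟨a ^ 2, one_le_pow₀ ha, C, fun X hX => ?_⟩
  have hX : a ^ 2 ≤ X.re := hX
  have hX0 : 0 < X.re := by nlinarith
  have hm := csqrt_mem_halfPlane hX0 hX
  refine ⟨?_, hC _ hm⟩
  exact HasDerivAt.comp X (han _ hm).differentiableAt.hasDerivAt (hasDerivAt_csqrt hX0)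

/-- Induction on `N`: as a function of `h`, the remainder of order `N + 1` for `G n` vanishes at
`0`, and its derivative is the remainder of order `N` for `G (n + 1)`. The mean value inequality on
the disk of radius `‖h‖` supplies the extra factor. -/
theorem taylor_bound {G : ℕ → ℂ → ℂ} (hG : ∀ n, ∃ b ≥ (1 : ℝ), ∃ C, ∀ X ∈ halfPlane b,
    HasDerivAt (G n) (G (n + 1) X) X ∧ ‖G n X‖ ≤ C) (N n : ℕ) :
    ∃ b ≥ (1 : ℝ), ∃ C, ∀ X ∈ halfPlane b, ∀ h : ℂ, ‖h‖ ≤ 1 →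
      ‖G n (X + h) - ∑ j ∈ Finset.range N, G (n + j) X * (h ^ j / j.factorial)‖ ≤
        C * ‖h‖ ^ N := by
  have hball : ∀ b : ℝ, ∀ X ∈ halfPlane (b + 1), ∀ h : ℂ, ‖h‖ ≤ 1 → X + h ∈ halfPlane b := by
    intro b X hX h hh
    have h1 := (abs_le.1 ((Complex.abs_re_le_norm h).trans hh)).1
    have h2 : b + 1 ≤ X.re := hX
    change b ≤ (X + h).re
    rw [Complex.add_re]
    linarith
  induction N generalizing n with
  | zero =>
    obtain ⟨b, hb, C, hC⟩ := hG n
    exact ⟨b + 1, by linarith, C, fun X hX h hh => by simpa using (hC _ (hball b X hX h hh)).2⟩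
  | succ N ih =>
    obtain ⟨b, hb, C, hC⟩ := ih (n + 1)
    obtain ⟨b', hb', C', hC'⟩ := hG n
    refine ⟨max b (b' + 1), hb.trans (le_max_left _ _), C, fun X hX h hh => ?_⟩
    have hXb := halfPlane_anti (le_max_left _ _) hX
    have hXb' := halfPlane_anti (le_max_right _ _) hX
    set D : ℂ → ℂ := fun w =>
      G n (X + w) - ∑ j ∈ Finset.range (N + 1), G (n + j) X * (w ^ j / j.factorial) with hD
    have hC0 : 0 ≤ C * ‖h‖ ^ N := (norm_nonneg _).trans (hC X hXb h hh)
    have hder : ∀ w ∈ Metric.closedBall (0 : ℂ) ‖h‖, HasDerivWithinAt D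
        (G (n + 1) (X + w) -
          ∑ j ∈ Finset.range N, G (n + 1 + j) X * (w ^ j / j.factorial))
        (Metric.closedBall (0 : ℂ) ‖h‖) w := by
      intro w hw
      have hw : ‖w‖ ≤ ‖h‖ := by simpa using hw
      refine HasDerivAt.hasDerivWithinAt ?_
      have h1 : HasDerivAt (fun w => G n (X + w)) (G (n + 1) (X + w)) w :=
        HasDerivAt.comp_const_add _ _ (hC' _ (hball b' X hXb' w (hw.trans hh))).1
      have h2 : HasDerivAt (fun w : ℂ => ∑ j ∈ Finset.range N,
          G (n + (j + 1)) X * (w ^ (j + 1) / ((j + 1).factorial : ℂ)))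
          (∑ j ∈ Finset.range N, G (n + 1 + j) X * (w ^ j / j.factorial)) w := by
        refine HasDerivAt.fun_sum fun j _ => ?_
        rw [show n + 1 + j = n + (j + 1) by ring]
        refine HasDerivAt.const_mul _ ?_
        convert! (hasDerivAt_pow (j + 1) w).div_const ((j + 1).factorial : ℂ) using 1
        rw [Nat.factorial_succ]
        have h3 : (j.factorial : ℂ) ≠ 0 := by exact_mod_cast j.factorial_ne_zero
        have h4 : ((j : ℂ) + 1) ≠ 0 := by exact_mod_cast j.succ_ne_zero
        push_cast
        field_simp
      have h3 := h1.sub (h2.add_const (G n X))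
      refine h3.congr_of_eventuallyEq (Eventually.of_forall fun w => ?_)
      simp only [hD, Finset.sum_range_succ']
      simp
    have hbd : ∀ w ∈ Metric.closedBall (0 : ℂ) ‖h‖, ‖G (n + 1) (X + w) -
          ∑ j ∈ Finset.range N, G (n + 1 + j) X * (w ^ j / j.factorial)‖ ≤ C * ‖h‖ ^ N := by
      intro w hw
      have hw : ‖w‖ ≤ ‖h‖ := by simpa using hw
      -- The sign of `C` is not known beforehand. For `w ≠ 0` the estimate itself forces `C ≥ 0`;
      -- the point `w = 0` is treated separately.
      rcases eq_or_ne w 0 with rfl | hw0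
      · rcases le_or_gt 0 C with hCp | hCn
        · exact (hC X hXb 0 (by simp)).trans (by gcongr)
        · have := (norm_nonneg _).trans (hC X hXb 0 (by simp))
          exact (hC X hXb 0 (by simp)).trans (by
            rcases Nat.eq_zero_or_pos N with rfl | hN
            · simp
            · rw [norm_zero, zero_pow hN.ne', mul_zero]
              exact hC0)
      · have hwp : 0 < ‖w‖ ^ N := pow_pos (norm_pos_iff.2 hw0) N
        have h1 := hC X hXb w (hw.trans hh)
        have hCp : 0 ≤ C := nonneg_of_mul_nonneg_left ((norm_nonneg _).trans h1) hwp
        exact h1.trans (by gcongr)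
    have := (convex_closedBall (0 : ℂ) ‖h‖).norm_image_sub_le_of_norm_hasDerivWithin_le
      hder hbd (Metric.mem_closedBall_self (norm_nonneg h)) (by simp : h ∈ Metric.closedBall 0 ‖h‖)
    have hD0 : D 0 = 0 := by
      simp only [hD, Finset.sum_range_succ']
      simp
    rw [hD0, sub_zero, sub_zero] at this
    rw [pow_succ, ← mul_assoc]
    exact this

/-! ### The expansion of the shifted term -/

/-- The function whose composition with `exp ∘ m₂` is the term `g ∘ B - g` of the expansion. -/
noncomputable def shiftTerm (X : ℂ) : ℂ := gamSqrt 0 (X + -ell X) - gamSqrt 0 X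

theorem ell_bound : ∃ a ≥ (1 : ℝ), AnalyticOnNhd ℂ ell (halfPlane a) ∧ ∃ C ≥ 0,
    ∀ X ∈ halfPlane a, ‖ell X‖ ≤ 1 ∧ ‖ell X‖ ≤ C * Real.exp (-X.re) := by
  obtain ⟨a, ha, han, C, hC⟩ := hasExp_ell.decay (coeff_zero_logSeries _)
  obtain ⟨b, hb, h⟩ := eventually_mul_exp_le C (show (0 : ℝ) < 1 from one_pos)
  refine ⟨max a b, ha.trans (le_max_left _ _), fun X hX =>
    han X (halfPlane_anti (le_max_left _ _) hX), C, ?_, fun X hX => ?_⟩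
  · have := (norm_nonneg _).trans (hC a (show a ≤ ((a : ℝ) : ℂ).re by simp))
    exact nonneg_of_mul_nonneg_left this (Real.exp_pos _)
  · have h1 := hC X (halfPlane_anti (le_max_left _ _) hX)
    have h2 := h _ ((le_max_right a b).trans hX)
    rw [neg_zero, zero_mul, Real.exp_zero, neg_one_mul] at h2
    exact ⟨h1.trans h2, h1⟩

theorem analyticOnNhd_gamSqrt (n : ℕ) :
    ∃ b ≥ (1 : ℝ), AnalyticOnNhd ℂ (gamSqrt n) (halfPlane b) := by
  obtain ⟨a, ha, han, -⟩ := (hasExp_gam n).bounded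
  refine ⟨a ^ 2, one_le_pow₀ ha, fun X hX => ?_⟩
  have hX : a ^ 2 ≤ X.re := hX
  have hX0 : 0 < X.re := by nlinarith
  exact (han _ (csqrt_mem_halfPlane hX0 hX)).comp_of_eq
    ((analyticAt_const.mul (analyticAt_id.clog (Or.inl hX0))).cexp) rfl

theorem analyticOnNhd_shiftTerm : ∃ a, AnalyticOnNhd ℂ shiftTerm (halfPlane a) := by
  obtain ⟨b, hb, hg⟩ := analyticOnNhd_gamSqrt 0
  obtain ⟨a, ha, hl, C, -, hC⟩ := ell_bound
  refine ⟨max a (b + 1), fun X hX => ?_⟩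
  have h1 := halfPlane_anti (le_max_left _ _) hX
  have h2 : b + 1 ≤ X.re := (le_max_right a _).trans hX
  have h3 : X + -ell X ∈ halfPlane b := by
    have h4 := Complex.abs_re_le_norm (ell X)
    have h5 := (abs_le.1 (h4.trans (hC X h1).1)).2
    change b ≤ (X + -ell X).re
    rw [Complex.add_re, Complex.neg_re]
    linarith
  exact ((hg _ h3).comp_of_eq (analyticAt_id.add (hl X h1).neg) rfl).sub
    (hg X (by change b ≤ X.re; linarith))

/-- The coefficients of the powers of `-ell`. -/
noncomputable def shiftCoeff (n j : ℕ) : Polynomial ℝ :=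
  PowerSeries.coeff j ((PowerSeries.C (Polynomial.C (-1)) * logSeries PowerSeries.X) ^ n)

theorem hasExp_neg_ell : HasExp (fun s => -ell s)
    (PowerSeries.C (Polynomial.C (-1)) * logSeries PowerSeries.X) :=
  ((HasExp.const (-1)).mul hasExp_ell).congr fun s => by simp

theorem shiftCoeff_eq_zero {n j : ℕ} (h : j < n) : shiftCoeff n j = 0 := by
  refine PowerSeries.X_pow_dvd_iff.1 (pow_dvd_pow_of_dvd (PowerSeries.X_dvd_iff.2 ?_) n) j h
  have := coeff_zero_logSeries PowerSeries.X
  rw [map_mul]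
  simp only [PowerSeries.coeff_zero_eq_constantCoeff] at this
  rw [this, mul_zero]

/-- The coefficient of `e^(-j X)` in the expansion of `shiftTerm`, as a function of `√X`. -/
noncomputable def shiftKappa (j : ℕ) (s : ℂ) : ℂ :=
  ∑ n ∈ Finset.range j, Polynomial.aeval s⁻¹ (Polynomial.expand ℝ 2 (shiftCoeff (n + 1) j)) *
    ((((n + 1).factorial : ℝ)⁻¹ : ℝ) * gam (n + 1) s)

/-- Each summand contains a factor `gam (n + 1)`, whose expansion has no constant term; this gives
the exponential decrease. -/
theorem shiftKappa_mem (Z : Set ℂ) (j : ℕ) : shiftKappa j ∈ FC1 Z 0 := by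
  refine (HasExp.sum (Finset.range j) fun n => (HasExp.aeval_inv _).mul
    ((HasExp.const _).mul (hasExp_gam (n + 1)))).mem_FC1 ?_ Z
  rw [map_sum]
  refine Finset.sum_eq_zero fun n _ => ?_
  rw [PowerSeries.coeff_C_mul, PowerSeries.coeff_C_mul, coeff_zero_gamSeries, mul_zero, mul_zero]

/-- The expansion of `(-ell)^(n+1)` starts at `e^(-(n+1)X)`, so the terms with `n ≥ j` vanish and
the range of summation can be made independent of `j`. The substitution `expand ℝ 2` accounts for
`X⁻¹ = s⁻²`. -/
theorem shiftKappa_csqrt {X : ℂ} (hX : X ≠ 0) {j N : ℕ} (hj : j < N) :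
    shiftKappa j (csqrt X) = ∑ n ∈ Finset.range N,
      Polynomial.aeval X⁻¹ (shiftCoeff (n + 1) j) *
        (((n + 1).factorial : ℂ)⁻¹ * gamSqrt (n + 1) X) := by
  rw [shiftKappa, ← Finset.sum_subset (Finset.range_mono hj.le)]
  · refine Finset.sum_congr rfl fun n _ => ?_
    rw [Polynomial.expand_aeval, inv_pow, csqrt_sq hX, gamSqrt]
    push_cast
    rfl
  · intro n _ hn
    rw [shiftCoeff_eq_zero (by simp at hn; omega)]
    simp

theorem gamSqrt_bounds (N : ℕ) : ∃ b ≥ (1 : ℝ), ∃ C ≥ 0, ∀ n < N, ∀ X ∈ halfPlane b,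
    ‖gamSqrt (n + 1) X‖ ≤ C := by
  induction N with
  | zero => exact ⟨1, le_rfl, 0, le_rfl, fun n hn => absurd hn (Nat.not_lt_zero n)⟩
  | succ N ih =>
    obtain ⟨b, hb, C, hC, h⟩ := ih
    obtain ⟨b', hb', C', h'⟩ := gamSqrt_spec (N + 1)
    refine ⟨max b b', hb.trans (le_max_left _ _), max C C', hC.trans (le_max_left _ _),
      fun n hn X hX => ?_⟩
    rcases Nat.lt_succ_iff_lt_or_eq.1 hn with hn | rfl
    · exact (h n hn X (halfPlane_anti (le_max_left _ _) hX)).trans (le_max_left _ _)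
    · exact (h' X (halfPlane_anti (le_max_right _ _) hX)).2.trans (le_max_right _ _)

theorem neg_ell_pow_bounds (N : ℕ) : ∀ K : ℕ, ∃ b ≥ (1 : ℝ), ∃ C ≥ 0, ∀ n < K,
    ∀ X ∈ halfPlane b, ‖(-ell X) ^ (n + 1) - ∑ j ∈ Finset.range N,
      Polynomial.aeval X⁻¹ (shiftCoeff (n + 1) j) * Complex.exp (-j * X)‖ ≤
        C * Real.exp (-N * X.re) := by
  intro K
  induction K with
  | zero => exact ⟨1, le_rfl, 0, le_rfl, fun n hn => absurd hn (Nat.not_lt_zero n)⟩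
  | succ K ih =>
    obtain ⟨b, hb, C, hC, h⟩ := ih
    obtain ⟨b', hb', -, h'⟩ := (hasExp_neg_ell.pow (K + 1)).approx
    obtain ⟨C', h'⟩ := h' N
    refine ⟨max b b', hb.trans (le_max_left _ _), max C C', hC.trans (le_max_left _ _),
      fun n hn X hX => ?_⟩
    rcases Nat.lt_succ_iff_lt_or_eq.1 hn with hn | rfl
    · refine (h n hn X (halfPlane_anti (le_max_left _ _) hX)).trans ?_
      gcongr
      exact le_max_left _ _
    · refine (h' X (halfPlane_anti (le_max_right _ _) hX)).trans ?_
      gcongr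
      exact le_max_right _ _

/-- Taylor's formula at `X` with the increment `-ell X = O(e^(-Re X))`; the subtraction in
`shiftTerm` removes the term of order `0`. -/
theorem shiftTerm_taylor (N : ℕ) : ∃ b ≥ (1 : ℝ), ∃ C, ∀ X ∈ halfPlane b,
    ‖shiftTerm X - ∑ n ∈ Finset.range N,
      gamSqrt (n + 1) X * ((-ell X) ^ (n + 1) / (n + 1).factorial)‖ ≤
        C * Real.exp (-(N + 1 : ℕ) * X.re) := by
  obtain ⟨b, hb, C, hC⟩ := taylor_bound gamSqrt_spec (N + 1) 0
  obtain ⟨a, ha, -, D, hD0, hD⟩ := ell_bound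
  refine ⟨max a b, ha.trans (le_max_left _ _), |C| * D ^ (N + 1), fun X hX => ?_⟩
  have h1 := hD X (halfPlane_anti (le_max_left _ _) hX)
  have h2 := hC X (halfPlane_anti (le_max_right _ _) hX) (-ell X) (by rw [norm_neg]; exact h1.1)
  simp only [Finset.sum_range_succ' _ N, zero_add, norm_neg] at h2
  have h3 : ‖shiftTerm X - ∑ n ∈ Finset.range N,
      gamSqrt (n + 1) X * ((-ell X) ^ (n + 1) / (n + 1).factorial)‖ ≤ C * ‖ell X‖ ^ (N + 1) := by
    refine le_trans (le_of_eq ?_) h2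
    congr 1
    simp only [shiftTerm, pow_zero, Nat.factorial_zero, Nat.cast_one, div_one, mul_one]
    ring
  refine h3.trans ?_
  calc C * ‖ell X‖ ^ (N + 1) ≤ |C| * (D * Real.exp (-X.re)) ^ (N + 1) := by
        gcongr
        · exact le_abs_self C
        · exact h1.2
    _ = _ := by
      rw [mul_pow, ← Real.exp_nat_mul, mul_assoc]
      ring_nf

/-- The powers of `-ell` in the Taylor sum are expanded up to `e^(-NX)` and the double sum is
rearranged by powers of `e^(-X)`. The bounded factors `gamSqrt (n + 1)` are left unexpanded. -/
theorem shiftTerm_approx (N : ℕ) : ∃ b ≥ (1 : ℝ), ∃ C, ∀ X ∈ halfPlane b,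
    ‖shiftTerm X - ∑ q ∈ Finset.range N, shiftKappa q (csqrt X) * Complex.exp (-q * X)‖ ≤
      C * Real.exp (-N * X.re) := by
  obtain ⟨b₁, hb₁, C₁, h₁⟩ := shiftTerm_taylor N
  obtain ⟨b₂, hb₂, C₂, hC₂, h₂⟩ := gamSqrt_bounds N
  obtain ⟨b₃, hb₃, C₃, hC₃, h₃⟩ := neg_ell_pow_bounds N N
  refine ⟨max b₁ (max b₂ b₃), hb₁.trans (le_max_left _ _), |C₁| + N * (C₂ * C₃), fun X hX => ?_⟩
  have hX1 := halfPlane_anti (le_max_left _ _) hX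
  have hX2 := halfPlane_anti ((le_max_left _ _).trans (le_max_right b₁ _)) hX
  have hX3 := halfPlane_anti ((le_max_right _ _).trans (le_max_right b₁ _)) hX
  have hX0 : 0 < X.re := by linarith [show b₁ ≤ X.re from hX1]
  have hne : X ≠ 0 := by
    rintro rfl
    simp at hX0
  have hsum : ∑ q ∈ Finset.range N, shiftKappa q (csqrt X) * Complex.exp (-q * X) =
      ∑ n ∈ Finset.range N, gamSqrt (n + 1) X * (((n + 1).factorial : ℂ)⁻¹ *
        ∑ j ∈ Finset.range N,
          Polynomial.aeval X⁻¹ (shiftCoeff (n + 1) j) * Complex.exp (-j * X)) := by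
    simp only [Finset.mul_sum]
    rw [Finset.sum_comm]
    refine Finset.sum_congr rfl fun j hj => ?_
    rw [shiftKappa_csqrt hne (Finset.mem_range.1 hj), Finset.sum_mul]
    refine Finset.sum_congr rfl fun n _ => ?_
    ring
  have hA := h₁ X hX1
  have hB : ‖∑ n ∈ Finset.range N,
      gamSqrt (n + 1) X * ((-ell X) ^ (n + 1) / (n + 1).factorial) -
      ∑ q ∈ Finset.range N, shiftKappa q (csqrt X) * Complex.exp (-q * X)‖ ≤
      N * (C₂ * C₃) * Real.exp (-N * X.re) := by
    rw [hsum, ← Finset.sum_sub_distrib]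
    refine ((norm_sum_le _ _).trans (Finset.sum_le_sum
      (g := fun _ => C₂ * (C₃ * Real.exp (-N * X.re))) fun n hn => ?_)).trans (le_of_eq ?_)
    · have hn := Finset.mem_range.1 hn
      rw [div_eq_inv_mul, ← mul_sub, ← mul_sub, norm_mul, norm_mul]
      have h4 : ‖((n + 1).factorial : ℂ)⁻¹‖ ≤ 1 := by
        rw [norm_inv, Complex.norm_natCast]
        exact inv_le_one_of_one_le₀ (by exact_mod_cast (n + 1).factorial_pos)
      refine mul_le_mul (h₂ n hn X hX2) ?_ (by positivity) hC₂
      refine (mul_le_of_le_one_left (norm_nonneg _) h4).trans (h₃ n hn X hX3)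
    · rw [Finset.sum_const, Finset.card_range, nsmul_eq_mul]
      ring
  have hA' : ‖shiftTerm X - ∑ n ∈ Finset.range N,
      gamSqrt (n + 1) X * ((-ell X) ^ (n + 1) / (n + 1).factorial)‖ ≤
      |C₁| * Real.exp (-N * X.re) := by
    refine hA.trans ?_
    calc C₁ * Real.exp (-(N + 1 : ℕ) * X.re) ≤ |C₁| * Real.exp (-(N + 1 : ℕ) * X.re) := by
          gcongr
          exact le_abs_self _
      _ ≤ _ := by
        gcongr
        linarith
  rw [add_mul]
  refine le_trans ?_ (add_le_add hA' hB)
  refine le_trans (le_of_eq ?_) (norm_add_le _ _)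
  congr 1
  ring

theorem shiftTerm_mem_FC1 (Z : Set ℂ) : shiftTerm ∈ FC1 Z 1 := by
  obtain ⟨a, ha⟩ := analyticOnNhd_shiftTerm
  refine mem_starClass (κ := fun q ζ => shiftKappa q (Complex.exp (((1 / 2 : ℝ) : ℂ) * ζ))) ha
    (fun q => ?_) ?_ fun N => ?_
  -- In the variable `ζ = log X` the root `√X` is `exp (ζ/2)`, so the coefficient has the form `ψ ∘
  -- exp ∘ m_{1/2}` with `ψ` in `FC^{1,0}`.
  · exact ⟨_, zero_mem_K10, 1, fun _ => shiftKappa q, fun _ => 1 / 2,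
      fun _ => ⟨shiftKappa_mem Z q, by norm_num, by norm_num⟩, 1, one_pos, fun ζ _ => by simp⟩
  · obtain ⟨b, -, C, hC⟩ := shiftTerm_taylor 0
    exact ⟨b, C, fun X hX => by simpa using hC X hX⟩
  · obtain ⟨b, -, C, hC⟩ := shiftTerm_approx N
    exact ⟨b, C, hC⟩

/-! ### The real functions of the example -/

theorem logChart_gluingMap (ζ : ℝ) :
    logChart gluingMap ζ = ζ - Real.log (1 + Real.exp (-ζ)) := by
  have h := Real.exp_pos (-ζ)
  rw [logChart, gluingMap, show Real.exp (-ζ) + Real.exp (-ζ) ^ 2 =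
    Real.exp (-ζ) * (1 + Real.exp (-ζ)) by ring, Real.log_mul h.ne' (by positivity), Real.log_exp]
  ring

theorem log_one_add_exp_neg_bounds {y : ℝ} (hy : 1 ≤ y) :
    0 < Real.log (1 + Real.exp (-y)) ∧ Real.log (1 + Real.exp (-y)) < 1 := by
  have h := Real.exp_pos (-y)
  refine ⟨Real.log_pos (by linarith), ?_⟩
  have h1 := Real.log_le_sub_one_of_pos (by positivity : 0 < 1 + Real.exp (-y))
  have h2 : Real.exp (-y) < 1 := by
    rw [Real.exp_lt_one_iff]
    linarith
  linarith

theorem exp_innerMap {ζ : ℝ} (hζ : 0 ≤ ζ) :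
    Real.exp (innerMap ζ) = Real.exp ζ - Real.log (1 + Real.exp (-Real.exp ζ)) := by
  have h1 : 1 ≤ Real.exp ζ := Real.one_le_exp hζ
  have h2 := log_one_add_exp_neg_bounds h1
  rw [innerMap, conjExp, logChart_gluingMap, Real.exp_log]
  linarith

theorem innerMap_lt {ζ : ℝ} (hζ : 0 ≤ ζ) : innerMap ζ < ζ := by
  have h := exp_innerMap hζ
  have h2 := log_one_add_exp_neg_bounds (Real.one_le_exp hζ)
  rw [← Real.exp_lt_exp]
  linarith

theorem conjugatedMap_nonneg : ∀ᶠ ζ in atTop, 0 ≤ conjugatedMap ζ := by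
  filter_upwards [eventually_ge_atTop 1] with ζ hζ
  have h := exp_innerMap (show 0 ≤ 2 * ζ by linarith)
  have h1 : 1 ≤ Real.exp (2 * ζ) := Real.one_le_exp (by linarith)
  have h2 := log_one_add_exp_neg_bounds h1
  have h3 : 2 ≤ Real.exp (2 * ζ) := by
    have := Real.add_one_le_exp (2 * ζ)
    linarith
  have h4 : 0 ≤ innerMap (2 * ζ) := by
    rw [← Real.one_le_exp_iff]
    linarith
  change 0 ≤ 2⁻¹ * innerMap (2 * ζ)
  positivity

theorem conjugatedMap_lt {ζ : ℝ} (hζ : 0 ≤ ζ) : conjugatedMap ζ < ζ := by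
  have h := innerMap_lt (show 0 ≤ 2 * ζ by linarith)
  change 2⁻¹ * innerMap (2 * ζ) < ζ
  linarith

theorem logReturnMap_not_eventuallyEq_id : ¬ (logReturnMap =ᶠ[atTop] id) := by
  intro h
  obtain ⟨ζ, h1, h2, h3⟩ := (h.and (conjugatedMap_nonneg.and (eventually_ge_atTop 0))).exists
  have h4 : innerMap (conjugatedMap ζ) = ζ := h1
  linarith [innerMap_lt h2, conjugatedMap_lt h3]

theorem ofReal_ell (y : ℝ) : ell y = (Real.log (1 + Real.exp (-y)) : ℝ) := by
  rw [ell, Complex.ofReal_log (by positivity)]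
  push_cast
  rfl

theorem csqrt_exp (ζ : ℝ) : csqrt (Real.exp (2 * ζ) : ℝ) = (Real.exp ζ : ℝ) := by
  rw [csqrt, ← Complex.ofReal_log (Real.exp_pos _).le, Real.log_exp, Complex.ofReal_exp]
  congr 1
  push_cast
  ring

theorem ofReal_innerMap_sub {ζ : ℝ} (hζ : 0 ≤ ζ) :
    ((innerMap ζ - ζ : ℝ) : ℂ) = gamSqrt 0 (Real.exp (2 * ζ) : ℝ) := by
  have h1 : 1 ≤ Real.exp ζ := Real.one_le_exp hζ
  have h2 := log_one_add_exp_neg_bounds h1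
  have h0 := Real.exp_pos ζ
  set L := Real.log (1 + Real.exp (-Real.exp ζ)) with hL
  have h3 : 0 < 1 + -((Real.exp ζ)⁻¹ * L) := by
    have : (Real.exp ζ)⁻¹ * L < 1 := by
      rw [inv_mul_lt_one₀ h0]
      linarith
    linarith
  rw [gamSqrt, csqrt_exp, gam]
  beta_reduce
  rw [ofReal_ell, ← hL, ← Complex.ofReal_inv, ← Complex.ofReal_mul,
    ← Complex.ofReal_neg, ← Complex.ofReal_one, ← Complex.ofReal_add, ← Complex.ofReal_log h3.le]
  congr 1
  rw [sub_eq_iff_eq_add, ← Real.exp_injective.eq_iff, exp_innerMap hζ, Real.exp_add,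
    Real.exp_log h3, ← hL]
  field_simp
  ring

/-- For `X = e^(2ζ)`, `conjugatedMap` becomes `X ↦ X - ell X`, while `innerMap - id` is `gamSqrt 0`
at `X`. -/
theorem ofReal_expansionTerm :
    ∀ᶠ ζ : ℝ in atTop, (expansionTerm ζ : ℂ) = shiftTerm (Real.exp (2 * ζ) : ℝ) := by
  filter_upwards [eventually_ge_atTop 0, conjugatedMap_nonneg] with ζ h0 h1
  have h2 : Real.exp (2 * conjugatedMap ζ) =
      Real.exp (2 * ζ) + -Real.log (1 + Real.exp (-Real.exp (2 * ζ))) := by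
    rw [← sub_eq_add_neg, ← exp_innerMap (by linarith)]
    congr 1
    change 2 * (2⁻¹ * innerMap (2 * ζ)) = _
    ring
  rw [shiftTerm, ofReal_ell, ← Complex.ofReal_neg, ← Complex.ofReal_add, ← h2,
    ← ofReal_innerMap_sub h0, ← ofReal_innerMap_sub h1, ← Complex.ofReal_sub]
  rfl

/-! ### Functions with asymptotic expansions in real exponentials -/

/-- The real exponential polynomials. -/
noncomputable def expPoly : Submodule ℝ (ℂ → ℂ) :=
  Submodule.span ℝ (range fun (μ : ℝ) (ζ : ℂ) => Complex.exp (μ * ζ))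

theorem exp_mem_expPoly (μ : ℝ) : (fun ζ : ℂ => Complex.exp (μ * ζ)) ∈ expPoly :=
  Submodule.subset_span (mem_range_self μ)

theorem const_mem_expPoly (r : ℝ) : (fun _ : ℂ => (r : ℂ)) ∈ expPoly := by
  convert! expPoly.smul_mem r (exp_mem_expPoly 0) using 1
  ext ζ
  simp

theorem mul_mem_expPoly {P Q : ℂ → ℂ} (hP : P ∈ expPoly) (hQ : Q ∈ expPoly) :
    (fun ζ => P ζ * Q ζ) ∈ expPoly := by
  have h : P * Q ∈ expPoly := by
    have := Submodule.mul_mem_mul hP hQ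
    rw [expPoly, Submodule.span_mul_span] at this
    refine Submodule.span_mono ?_ this
    rintro _ ⟨_, ⟨μ, rfl⟩, _, ⟨ν, rfl⟩, rfl⟩
    refine ⟨μ + ν, ?_⟩
    ext ζ
    simp only [Pi.mul_apply]
    rw [← Complex.exp_add]
    push_cast
    ring_nf
  exact h

theorem exists_expPoly_eq {P : ℂ → ℂ} (hP : P ∈ expPoly) :
    ∃ (s : Finset ℝ) (p : ℝ → ℝ), (∀ μ ∈ s, p μ ≠ 0) ∧
      ∀ ζ, P ζ = ∑ μ ∈ s, (p μ : ℂ) * Complex.exp (μ * ζ) := by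
  obtain ⟨c, rfl⟩ := Finsupp.mem_span_range_iff_exists_finsupp.1 hP
  refine ⟨c.support, c, fun μ hμ => by simpa using hμ, fun ζ => ?_⟩
  simp [Finsupp.sum, Finset.sum_apply]

theorem norm_exp_real_mul (μ : ℝ) (ζ : ℂ) : ‖Complex.exp (μ * ζ)‖ = Real.exp (μ * ζ.re) := by
  rw [Complex.norm_exp, Complex.re_ofReal_mul]

theorem norm_sum_exp_le (s : Finset ℝ) (p : ℝ → ℝ) {m : ℝ} (hm : ∀ μ ∈ s, μ ≤ m) {ζ : ℂ}
    (hζ : 0 ≤ ζ.re) : ‖∑ μ ∈ s, (p μ : ℂ) * Complex.exp (μ * ζ)‖ ≤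
      (∑ μ ∈ s, |p μ|) * Real.exp (m * ζ.re) := by
  rw [Finset.sum_mul]
  refine (norm_sum_le _ _).trans (Finset.sum_le_sum fun μ hμ => ?_)
  rw [norm_mul, norm_exp_real_mul, Complex.norm_real, Real.norm_eq_abs]
  have := hm μ hμ
  gcongr

/-- `h` is analytic on a right half plane, where it has an asymptotic expansion in real
exponentials. -/
def TameOn (a : ℝ) (h : ℂ → ℂ) : Prop :=
  AnalyticOnNhd ℂ h (halfPlane a) ∧ ∀ N : ℕ, ∃ P ∈ expPoly, ∃ C : ℝ, ∀ ζ ∈ halfPlane a,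
    ‖h ζ - P ζ‖ ≤ C * Real.exp (-N * ζ.re)

theorem analytic_of_mem_expPoly {P : ℂ → ℂ} (hP : P ∈ expPoly) (s : Set ℂ) :
    AnalyticOnNhd ℂ P s := by
  obtain ⟨t, p, -, h⟩ := exists_expPoly_eq hP
  rw [show P = _ from funext h]
  intro ζ _
  exact Finset.analyticAt_fun_sum _ fun μ _ =>
    analyticAt_const.mul (analyticAt_const.mul analyticAt_id).cexp

theorem tameOn_of_mem_expPoly {P : ℂ → ℂ} (hP : P ∈ expPoly) (a : ℝ) : TameOn a P :=
  ⟨analytic_of_mem_expPoly hP _, fun _ => ⟨P, hP, 0, fun ζ _ => by simp⟩⟩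

namespace TameOn

theorem mono {a a' : ℝ} {h : ℂ → ℂ} (H : TameOn a h) (haa' : a ≤ a') : TameOn a' h :=
  ⟨fun ζ hζ => H.1 ζ (halfPlane_anti haa' hζ), fun N => by
    obtain ⟨P, hP, C, hC⟩ := H.2 N
    exact ⟨P, hP, C, fun ζ hζ => hC ζ (halfPlane_anti haa' hζ)⟩⟩

theorem of_approx {a : ℝ} {h : ℂ → ℂ} (han : AnalyticOnNhd ℂ h (halfPlane a))
    (H : ∀ N : ℕ, ∃ g, TameOn a g ∧ ∃ C : ℝ, ∀ ζ ∈ halfPlane a,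
      ‖h ζ - g ζ‖ ≤ C * Real.exp (-N * ζ.re)) : TameOn a h := by
  refine ⟨han, fun N => ?_⟩
  obtain ⟨g, hg, C, hC⟩ := H N
  obtain ⟨P, hP, D, hD⟩ := hg.2 N
  refine ⟨P, hP, C + D, fun ζ hζ => ?_⟩
  rw [add_mul]
  refine le_trans (le_of_eq ?_) ((norm_add_le _ _).trans (add_le_add (hC ζ hζ) (hD ζ hζ)))
  congr 1
  ring

theorem add {a : ℝ} {f g : ℂ → ℂ} (hf : TameOn a f) (hg : TameOn a g) :
    TameOn a fun ζ => f ζ + g ζ := by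
  refine ⟨fun ζ hζ => (hf.1 ζ hζ).add (hg.1 ζ hζ), fun N => ?_⟩
  obtain ⟨P, hP, C, hC⟩ := hf.2 N
  obtain ⟨Q, hQ, D, hD⟩ := hg.2 N
  refine ⟨P + Q, expPoly.add_mem hP hQ, C + D, fun ζ hζ => ?_⟩
  rw [Pi.add_apply, add_sub_add_comm, add_mul]
  exact (norm_add_le _ _).trans (add_le_add (hC ζ hζ) (hD ζ hζ))

theorem const (a r : ℝ) : TameOn a fun _ => (r : ℂ) :=
  tameOn_of_mem_expPoly (const_mem_expPoly r) a

theorem growth {a : ℝ} (ha : 0 ≤ a) {h : ℂ → ℂ} (H : TameOn a h) :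
    ∃ (A : ℕ) (C : ℝ), 0 ≤ C ∧ ∀ ζ ∈ halfPlane a, ‖h ζ‖ ≤ C * Real.exp (A * ζ.re) := by
  obtain ⟨P, hP, C, hC⟩ := H.2 0
  obtain ⟨s, p, -, hp⟩ := exists_expPoly_eq hP
  obtain ⟨m, hm⟩ := s.finite_toSet.bddAbove
  obtain ⟨A, hA⟩ := exists_nat_ge m
  refine ⟨A, |C| + ∑ μ ∈ s, |p μ|, by positivity, fun ζ hζ => ?_⟩
  have h0 : 0 ≤ ζ.re := ha.trans hζ
  have h1 := norm_sum_exp_le s p (m := A) (fun μ hμ => (hm hμ).trans hA) h0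
  rw [← hp] at h1
  have h2 : ‖h ζ - P ζ‖ ≤ |C| * Real.exp (A * ζ.re) := by
    refine (hC ζ hζ).trans ?_
    gcongr
    · exact le_abs_self C
    · push_cast
      have : (0 : ℝ) ≤ A * ζ.re := by positivity
      linarith
  rw [add_mul]
  refine le_trans (le_of_eq ?_) ((norm_add_le _ _).trans (add_le_add h2 h1))
  congr 1
  ring

/-- Each factor is approximated with a surplus of precision that compensates the growth of the
other. `P` is chosen before `Q`, since the precision of `Q` depends on the growth of `P`. -/
theorem mul {a : ℝ} (ha : 0 ≤ a) {f g : ℂ → ℂ} (hf : TameOn a f) (hg : TameOn a g) :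
    TameOn a fun ζ => f ζ * g ζ := by
  refine ⟨fun ζ hζ => (hf.1 ζ hζ).mul (hg.1 ζ hζ), fun N => ?_⟩
  obtain ⟨A, K, hK, hA⟩ := hg.growth ha
  obtain ⟨P, hP, C, hC⟩ := hf.2 (N + A)
  obtain ⟨B, L, hL, hB⟩ := (tameOn_of_mem_expPoly hP a).growth ha
  obtain ⟨Q, hQ, D, hD⟩ := hg.2 (N + B)
  refine ⟨_, mul_mem_expPoly hP hQ, C * K + L * D, fun ζ hζ => ?_⟩
  have key : f ζ * g ζ - P ζ * Q ζ = (f ζ - P ζ) * g ζ + P ζ * (g ζ - Q ζ) := by ring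
  have e1 := mul_le_mul (hC ζ hζ) (hA ζ hζ) (norm_nonneg _) ((norm_nonneg _).trans (hC ζ hζ))
  have e2 := mul_le_mul (hB ζ hζ) (hD ζ hζ) (norm_nonneg _) ((norm_nonneg _).trans (hB ζ hζ))
  rw [key]
  refine (norm_add_le _ _).trans ?_
  rw [norm_mul, norm_mul, add_mul]
  refine add_le_add (e1.trans (le_of_eq ?_)) (e2.trans (le_of_eq ?_))
  · rw [mul_mul_mul_comm, ← Real.exp_add]
    push_cast
    ring_nf
  · rw [mul_mul_mul_comm, ← Real.exp_add]
    push_cast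
    ring_nf

theorem sub {a : ℝ} (ha : 0 ≤ a) {f g : ℂ → ℂ} (hf : TameOn a f) (hg : TameOn a g) :
    TameOn a fun ζ => f ζ - g ζ := by
  simpa [sub_eq_add_neg] using hf.add ((const a (-1)).mul ha hg)

theorem pow {a : ℝ} (ha : 0 ≤ a) {f : ℂ → ℂ} (hf : TameOn a f) (n : ℕ) :
    TameOn a fun ζ => f ζ ^ n := by
  induction n with
  | zero => simpa using const a 1
  | succ n ih =>
    simp only [pow_succ]
    exact ih.mul ha hf

theorem sum {a : ℝ} {ι : Type*} (s : Finset ι) {f : ι → ℂ → ℂ} (hf : ∀ i ∈ s, TameOn a (f i)) :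
    TameOn a fun ζ => ∑ i ∈ s, f i ζ := by
  classical
  induction s using Finset.induction_on with
  | empty => simpa using const a 0
  | insert i s hi ih =>
    simp only [Finset.sum_insert hi]
    exact (hf i (Finset.mem_insert_self _ _)).add
      (ih fun j hj => hf j (Finset.mem_insert_of_mem hj))

end TameOn

theorem tendsto_exp_mul_of_neg {c : ℝ} (hc : c < 0) :
    Tendsto (fun x : ℝ => Real.exp (c * x)) atTop (𝓝 0) :=
  Real.tendsto_exp_atBot.comp (tendsto_id.const_mul_atTop_of_neg hc)

/-- The leading term of an expansion. -/
theorem tendsto_leading {a : ℝ} {h : ℂ → ℂ} {s : Finset ℝ} {p : ℝ → ℝ} {N : ℕ} {C : ℝ}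
    (hC : ∀ ζ ∈ halfPlane a,
      ‖h ζ - ∑ μ ∈ s, (p μ : ℂ) * Complex.exp (μ * ζ)‖ ≤ C * Real.exp (-N * ζ.re))
    {m : ℝ} (hm : m ∈ s) (hmax : ∀ μ ∈ s, μ ≤ m) (hmN : -(N : ℝ) < m) :
    Tendsto (fun x : ℝ => h x * Complex.exp (-(m : ℂ) * x)) atTop (𝓝 (p m)) := by
  have h1 : Tendsto (fun x : ℝ => (h x - ∑ μ ∈ s, (p μ : ℂ) * Complex.exp (μ * x)) *
      Complex.exp (-(m : ℂ) * x)) atTop (𝓝 0) := by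
    refine squeeze_zero_norm' (a := fun x => C * Real.exp ((-N - m) * x)) ?_ ?_
    · filter_upwards [eventually_ge_atTop a] with x hx
      have := hC x (by simpa [halfPlane] using hx)
      rw [Complex.ofReal_re] at this
      rw [norm_mul, ← Complex.ofReal_neg, norm_exp_real_mul, Complex.ofReal_re,
        show (-(N : ℝ) - m) * x = -N * x + -m * x by ring, Real.exp_add, ← mul_assoc]
      gcongr
    · simpa using (tendsto_exp_mul_of_neg (by linarith : -(N : ℝ) - m < 0)).const_mul C
  have h2 : Tendsto (fun x : ℝ => ∑ μ ∈ s, (p μ : ℂ) * Complex.exp (((μ - m : ℝ) : ℂ) * x)) atTop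
      (𝓝 (∑ μ ∈ s, if μ = m then (p μ : ℂ) else 0)) := by
    refine tendsto_finsetSum _ fun μ hμ => ?_
    split_ifs with hμm
    · subst hμm
      simp
    · rw [tendsto_zero_iff_norm_tendsto_zero]
      have := (tendsto_exp_mul_of_neg (sub_neg.2 (lt_of_le_of_ne (hmax μ hμ) hμm))).const_mul |p μ|
      rw [mul_zero] at this
      refine this.congr fun x => ?_
      rw [norm_mul, norm_exp_real_mul, Complex.norm_real, Real.norm_eq_abs, Complex.ofReal_re]
  rw [Finset.sum_ite_eq_of_mem' s m _ hm] at h2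
  have h3 := h1.add h2
  rw [zero_add] at h3
  refine h3.congr fun x => ?_
  rw [sub_mul, Finset.sum_mul]
  have : ∀ μ ∈ s, (p μ : ℂ) * Complex.exp (((μ - m : ℝ) : ℂ) * x) =
      (p μ : ℂ) * Complex.exp (μ * x) * Complex.exp (-(m : ℂ) * x) := fun μ _ => by
    rw [mul_assoc, ← Complex.exp_add]
    push_cast
    ring_nf
  rw [Finset.sum_congr rfl this]
  ring

/-- Phragmén–Lindelöf: a bounded analytic function on the right half plane that decays along the
positive axis faster than every exponential vanishes. -/
theorem eq_zero_of_fast_decay {a : ℝ} {h : ℂ → ℂ} (han : AnalyticOnNhd ℂ h (halfPlane a))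
    (H : ∀ N : ℕ, ∃ C : ℝ, ∀ ζ ∈ halfPlane a, ‖h ζ‖ ≤ C * Real.exp (-N * ζ.re)) :
    ∀ ζ ∈ halfPlane a, h ζ = 0 := by
  have hmem : ∀ z : ℂ, 0 ≤ z.re → z + a ∈ halfPlane a := fun z hz => by
    change a ≤ (z + a).re
    simpa using hz
  obtain ⟨C, hC⟩ := H 0
  have hb : ∀ z : ℂ, 0 ≤ z.re → ‖h (z + a)‖ ≤ C := fun z hz => by simpa using hC _ (hmem z hz)
  have key := PhragmenLindelof.eq_zero_on_right_half_plane_of_superexponential_decay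
    (f := fun z => h (z + a)) ?_ ⟨0, by norm_num, 0, ?_⟩ ?_ ⟨C, fun x => hb _ (by simp)⟩
  · intro ζ hζ
    have := key (show 0 ≤ (ζ - a).re by
      have : a ≤ ζ.re := hζ
      simpa using this)
    simpa using this
  · refine DifferentiableOn.diffContOnCl fun z hz => ?_
    rw [Complex.closure_setOfPred_lt_re] at hz
    exact (((han _ (hmem z hz)).differentiableAt).comp z
      (differentiableAt_id.add_const _)).differentiableWithinAt
  · refine Asymptotics.IsBigO.of_bound C ?_
    filter_upwards [mem_inf_of_right (mem_principal_self _)] with z hz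
    have hz : 0 < z.re := hz
    simpa using hb z hz.le
  · intro n
    obtain ⟨D, hD⟩ := H (n + 1)
    refine squeeze_zero_norm' (a := fun x => |D| * Real.exp (-(n + 1) * a) * Real.exp (-1 * x)) ?_ ?_
    · filter_upwards [eventually_ge_atTop 0] with x hx
      have := hD _ (hmem x (by simpa using hx))
      rw [Complex.add_re, Complex.ofReal_re, Complex.ofReal_re] at this
      rw [norm_mul, norm_pow, Real.norm_eq_abs, Real.abs_exp, norm_norm, ← Real.exp_nat_mul]
      calc Real.exp (n * x) * ‖h (x + a)‖ ≤
            Real.exp (n * x) * (|D| * Real.exp (-(n + 1 : ℕ) * (x + a))) := by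
            gcongr
            refine this.trans ?_
            gcongr
            exact le_abs_self D
        _ = |D| * (Real.exp (n * x) * Real.exp (-(n + 1 : ℕ) * (x + a))) := by ring
        _ = _ := by
          rw [mul_assoc, ← Real.exp_add, ← Real.exp_add]
          push_cast
          ring_nf
    · simpa using (tendsto_exp_mul_of_neg (by norm_num : (-1 : ℝ) < 0)).const_mul
        (|D| * Real.exp (-(n + 1) * a))

/-- If some approximation of precision `N` contains an exponent above `-N`, its largest exponent is
a leading term. Otherwise all approximations are as small as their errors, and the function decays
too fast not to be zero. -/
theorem TameOn.dichotomy {a : ℝ} (ha : 0 ≤ a) {h : ℂ → ℂ} (H : TameOn a h) :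
    (∀ ζ ∈ halfPlane a, h ζ = 0) ∨ ∃ m c : ℝ, c ≠ 0 ∧
      Tendsto (fun x : ℝ => h x * Complex.exp (-(m : ℂ) * x)) atTop (𝓝 c) := by
  by_cases hc : ∃ m c : ℝ, c ≠ 0 ∧
      Tendsto (fun x : ℝ => h x * Complex.exp (-(m : ℂ) * x)) atTop (𝓝 c)
  · exact Or.inr hc
  refine Or.inl (eq_zero_of_fast_decay H.1 fun N => ?_)
  obtain ⟨P, hP, C, hC⟩ := H.2 N
  obtain ⟨s, p, hp, hPs⟩ := exists_expPoly_eq hP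
  simp only [hPs] at hC
  have hle : ∀ μ ∈ s, μ ≤ -N := by
    intro μ hμ
    by_contra! hlt
    have hne : s.Nonempty := ⟨μ, hμ⟩
    refine hc ⟨s.max' hne, p (s.max' hne), hp _ (s.max'_mem hne), tendsto_leading hC
      (s.max'_mem hne) (fun ν hν => s.le_max' ν hν) (hlt.trans_le (s.le_max' μ hμ))⟩
  refine ⟨C + ∑ μ ∈ s, |p μ|, fun ζ hζ => ?_⟩
  rw [add_mul]
  refine le_trans (le_of_eq ?_) ((norm_add_le _ _).trans
    (add_le_add (hC ζ hζ) (norm_sum_exp_le s p hle (ha.trans hζ))))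
  congr 1
  ring

/-- Boundedness on the real axis near `+∞`. -/
def RealBounded (h : ℂ → ℂ) : Prop := ∃ C : ℝ, ∀ᶠ x : ℝ in atTop, ‖h x‖ ≤ C

theorem not_realBounded_of_tendsto {h : ℂ → ℂ} {m c : ℝ} (hm : 0 < m) (hc : c ≠ 0)
    (H : Tendsto (fun x : ℝ => h x * Complex.exp (-(m : ℂ) * x)) atTop (𝓝 c)) :
    ¬ RealBounded h := by
  rintro ⟨C, hC⟩
  have h0 : Tendsto (fun x : ℝ => h x * Complex.exp (-(m : ℂ) * x)) atTop (𝓝 0) := by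
    refine squeeze_zero_norm' (a := fun x => C * Real.exp (-m * x)) ?_ ?_
    · filter_upwards [hC] with x hx
      rw [norm_mul, ← Complex.ofReal_neg, norm_exp_real_mul, Complex.ofReal_re]
      gcongr
    · simpa using (tendsto_exp_mul_of_neg (neg_neg_of_pos hm)).const_mul C
  exact hc (by exact_mod_cast tendsto_nhds_unique H h0)

theorem exists_gap (s : Finset ℝ) : ∃ δ > 0, δ ≤ 1 ∧ ∀ μ ∈ s, μ < 0 → μ ≤ -δ := by
  classical
  induction s using Finset.induction_on with
  | empty => exact ⟨1, one_pos, le_rfl, by simp⟩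
  | insert ν s hν ih =>
    obtain ⟨δ, h0, h1, h⟩ := ih
    rcases lt_or_ge ν 0 with hneg | hpos
    · refine ⟨min δ (-ν), lt_min h0 (by linarith), (min_le_left _ _).trans h1, fun μ hμ hμ0 => ?_⟩
      rcases Finset.mem_insert.1 hμ with rfl | hμ
      · linarith [min_le_right δ (-μ)]
      · linarith [min_le_left δ (-ν), h μ hμ hμ0]
    · refine ⟨δ, h0, h1, fun μ hμ hμ0 => ?_⟩
      rcases Finset.mem_insert.1 hμ with rfl | hμ
      · linarith
      · exact h μ hμ hμ0

/-- Boundedness on the real axis excludes positive exponents, so on the whole half plane `h` is a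
constant plus `w = O(e^(-δ Re ζ))`. The exponential series in `w` then gives the expansion. -/
theorem TameOn.exp_of_realBounded {a : ℝ} (ha : 0 ≤ a) {h : ℂ → ℂ} (H : TameOn a h)
    (hb : RealBounded h) : TameOn a fun ζ => Complex.exp (h ζ) := by
  obtain ⟨P, hP, C, hC⟩ := H.2 1
  obtain ⟨s, p, hp, hPs⟩ := exists_expPoly_eq hP
  simp only [hPs] at hC
  have hle : ∀ μ ∈ s, μ ≤ 0 := by
    intro μ hμ
    by_contra! hlt
    have hne : s.Nonempty := ⟨μ, hμ⟩
    have h1 := hlt.trans_le (s.le_max' μ hμ)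
    exact not_realBounded_of_tendsto h1 (hp _ (s.max'_mem hne)) (tendsto_leading hC
      (s.max'_mem hne) (fun ν hν => s.le_max' ν hν) (by push_cast; linarith)) hb
  obtain ⟨δ, hδ, hδ1, hgap⟩ := exists_gap s
  obtain ⟨p₀, hp₀⟩ : ∃ p₀ : ℝ, ∀ ζ : ℂ, ∑ μ ∈ s, (p μ : ℂ) * Complex.exp (μ * ζ) =
      p₀ + ∑ μ ∈ s.erase 0, (p μ : ℂ) * Complex.exp (μ * ζ) := by
    by_cases h0 : (0 : ℝ) ∈ s
    · refine ⟨p 0, fun ζ => ?_⟩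
      rw [← Finset.add_sum_erase s _ h0]
      simp
    · exact ⟨0, fun ζ => by rw [Finset.erase_eq_of_notMem h0]; simp⟩
  set w : ℂ → ℂ := fun ζ => h ζ - (p₀ : ℂ) with hw
  have hwT : TameOn a w := H.sub ha (TameOn.const a p₀)
  set D := |C| + ∑ μ ∈ s.erase 0, |p μ| with hD
  have hD0 : 0 ≤ D := by positivity
  have hwb : ∀ ζ ∈ halfPlane a, ‖w ζ‖ ≤ D * Real.exp (-δ * ζ.re) := by
    intro ζ hζ
    have h0 : 0 ≤ ζ.re := ha.trans hζ
    have h1 := norm_sum_exp_le (s.erase 0) p (m := -δ) (fun μ hμ => by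
      obtain ⟨hμ0, hμs⟩ := Finset.mem_erase.1 hμ
      exact hgap μ hμs (lt_of_le_of_ne (hle μ hμs) hμ0)) h0
    have h2 : ‖h ζ - ∑ μ ∈ s, (p μ : ℂ) * Complex.exp (μ * ζ)‖ ≤ |C| * Real.exp (-δ * ζ.re) := by
      refine (hC ζ hζ).trans ?_
      gcongr
      · exact le_abs_self C
      · push_cast
        linarith
    rw [hD, add_mul]
    refine le_trans (le_of_eq ?_) ((norm_add_le _ _).trans (add_le_add h2 h1))
    rw [hp₀, hw]
    congr 1
    ring
  have hwb1 : ∀ ζ ∈ halfPlane a, ‖w ζ‖ ≤ D := fun ζ hζ => (hwb ζ hζ).trans (by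
    have h0 : 0 ≤ ζ.re := ha.trans hζ
    exact mul_le_of_le_one_right hD0 (Real.exp_le_one_iff.2 (by nlinarith)))
  have hexp : ∀ ζ, Complex.exp (h ζ) = ((Real.exp p₀ : ℝ) : ℂ) * Complex.exp (w ζ) := by
    intro ζ
    rw [Complex.ofReal_exp, ← Complex.exp_add, hw]
    congr 1
    ring
  have hwexp : TameOn a fun ζ => Complex.exp (w ζ) := by
    refine TameOn.of_approx (fun ζ hζ => (hwT.1 ζ hζ).cexp) fun N => ?_
    -- With `K ≥ N/δ` terms the remainder `O(w^K)` has the required order `e^(-N Re ζ)`.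
    obtain ⟨K, hK⟩ := exists_nat_ge (N / δ)
    refine ⟨fun ζ => ∑ k ∈ Finset.range K, (((k.factorial : ℝ)⁻¹ : ℝ) : ℂ) * w ζ ^ k,
      TameOn.sum _ fun k _ => (TameOn.const a _).mul ha (hwT.pow ha k),
      D ^ K * Real.exp D, fun ζ hζ => ?_⟩
    have h0 : 0 ≤ ζ.re := ha.trans hζ
    have h1 := Complex.norm_exp_sub_sum_le_norm_mul_exp (w ζ) K
    have h2 : ∑ k ∈ Finset.range K, (((k.factorial : ℝ)⁻¹ : ℝ) : ℂ) * w ζ ^ k =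
        ∑ k ∈ Finset.range K, w ζ ^ k / k.factorial := by
      refine Finset.sum_congr rfl fun k _ => ?_
      push_cast
      ring
    beta_reduce
    rw [h2]
    refine h1.trans ?_
    calc ‖w ζ‖ ^ K * Real.exp ‖w ζ‖ ≤ (D * Real.exp (-δ * ζ.re)) ^ K * Real.exp D := by
          gcongr
          · exact hwb ζ hζ
          · exact hwb1 ζ hζ
      _ = D ^ K * Real.exp D * Real.exp (K * (-δ * ζ.re)) := by
        rw [mul_pow, ← Real.exp_nat_mul]
        ring
      _ ≤ _ := by
        rw [div_le_iff₀ hδ] at hK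
        refine mul_le_mul_of_nonneg_left (Real.exp_le_exp.2 ?_) (by positivity)
        nlinarith
  have := (TameOn.const a (Real.exp p₀)).mul ha hwexp
  exact (funext hexp : (fun ζ => Complex.exp (h ζ)) = _) ▸ this

/-! ### Comparison of exponents and isolated terms -/

theorem eventually_mul_le_exp (K : ℝ) {c m : ℝ} (hc : 0 < c) (hm : 0 < m) :
    ∀ᶠ x : ℝ in atTop, K * x ≤ c * Real.exp (m * x) := by
  have h := (tendsto_exp_mul_div_rpow_atTop 1 m hm).eventually_ge_atTop (K / c)
  filter_upwards [h, eventually_gt_atTop 0] with x hx h0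
  rw [Real.rpow_one, div_le_div_iff₀ hc h0] at hx
  linarith

/-- `f` exceeds `g` by more than any linear function. -/
def Dominates (f g : ℂ → ℂ) : Prop := ∀ K : ℝ, ∀ᶠ x : ℝ in atTop, K * x ≤ (f x - g x).re

theorem Dominates.trans {f g h : ℂ → ℂ} (h₁ : Dominates f g) (h₂ : Dominates g h) :
    Dominates f h := by
  intro K
  filter_upwards [h₁ K, h₂ 0] with x hx hx'
  rw [Complex.sub_re] at *
  linarith

theorem dominates_of_tendsto {f g : ℂ → ℂ} {m c : ℝ} (hm : 0 < m) (hc : 0 < c)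
    (H : Tendsto (fun x : ℝ => (f x - g x) * Complex.exp (-(m : ℂ) * x)) atTop (𝓝 c)) :
    Dominates f g := by
  intro K
  have h1 : Tendsto (fun x : ℝ => ((f x - g x) * Complex.exp (-(m : ℂ) * x)).re) atTop (𝓝 c) :=
    (Complex.continuous_re.tendsto _).comp H
  filter_upwards [h1.eventually_const_le (show c / 2 < c by linarith),
    eventually_mul_le_exp K (half_pos hc) hm] with x hx hx'
  have h2 : Complex.exp (-(m : ℂ) * x) = ((Real.exp (-m * x) : ℝ) : ℂ) := by
    push_cast
    rfl
  rw [h2, Complex.re_mul_ofReal] at hx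
  have h3 : Real.exp (-m * x) * Real.exp (m * x) = 1 := by
    rw [← Real.exp_add]
    simp
  have h4 := mul_le_mul_of_nonneg_right hx (Real.exp_pos (m * x)).le
  rw [mul_assoc, h3, mul_one] at h4
  exact hx'.trans h4

/-- An unbounded difference has a leading term `c e^(mx)` with `m > 0`, and the sign of the real
number `c` decides which function dominates. -/
theorem dominates_or_of_not_realBounded {a : ℝ} (ha : 0 ≤ a) {f g : ℂ → ℂ} (hf : TameOn a f)
    (hg : TameOn a g) (hb : ¬ RealBounded fun ζ => f ζ - g ζ) :
    Dominates f g ∨ Dominates g f := by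
  rcases (hf.sub ha hg).dichotomy ha with h0 | ⟨m, c, hc, H⟩
  · refine absurd ⟨0, ?_⟩ hb
    filter_upwards [eventually_ge_atTop a] with x hx
    rw [h0 x (show a ≤ ((x : ℝ) : ℂ).re by simpa using hx), norm_zero]
  · have hm : 0 < m := by
      by_contra! hm
      refine hb ⟨‖(c : ℂ)‖ + 1, ?_⟩
      filter_upwards [(H.norm.eventually_le_const (lt_add_one _)), eventually_ge_atTop 0]
        with x hx h0
      refine le_trans ?_ hx
      rw [norm_mul, ← Complex.ofReal_neg, norm_exp_real_mul, Complex.ofReal_re]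
      refine le_mul_of_one_le_right (norm_nonneg _) (Real.one_le_exp ?_)
      nlinarith
    rcases hc.lt_or_gt with hc | hc
    · right
      refine dominates_of_tendsto hm (neg_pos.2 hc) ?_
      convert! H.neg using 2
      · ring
      · push_cast
        rfl
    · exact Or.inl (dominates_of_tendsto hm hc H)

theorem exists_dominant {ι : Type*} {E : ι → ℂ → ℂ} (s : Finset ι) (hs : s.Nonempty)
    (H : ∀ i ∈ s, ∀ j ∈ s, i ≠ j → Dominates (E i) (E j) ∨ Dominates (E j) (E i)) :
    ∃ j ∈ s, ∀ i ∈ s, i ≠ j → Dominates (E j) (E i) := by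
  classical
  induction hs using Finset.Nonempty.cons_induction with
  | singleton i =>
    refine ⟨i, Finset.mem_singleton_self i, fun j hj hne => absurd (Finset.mem_singleton.1 hj) hne⟩
  | cons i s hi hs ih =>
    obtain ⟨j, hj, hmax⟩ := ih fun k hk l hl =>
      H k (Finset.mem_cons_of_mem hk) l (Finset.mem_cons_of_mem hl)
    have hij : i ≠ j := fun h => hi (h ▸ hj)
    rcases H i (Finset.mem_cons_self i s) j (Finset.mem_cons_of_mem hj) hij with h | h
    · refine ⟨i, Finset.mem_cons_self i s, fun k hk hki => ?_⟩
      rcases Finset.mem_cons.1 hk with rfl | hk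
      · exact absurd rfl hki
      · rcases eq_or_ne k j with rfl | hkj
        · exact h
        · exact h.trans (hmax k hk hkj)
    · refine ⟨j, Finset.mem_cons_of_mem hj, fun k hk hkj => ?_⟩
      rcases Finset.mem_cons.1 hk with rfl | hk
      · exact h
      · exact hmax k hk hkj

/-- A sum of tame functions times exponentials of tame functions with pairwise inequivalent
exponents is not smaller than any of its non-trivial terms. -/
theorem false_of_dominant {ι : Type*} {a : ℝ} (ha : 0 ≤ a) {E h : ι → ℂ → ℂ} {s : Finset ι}
    (hh : ∀ i ∈ s, TameOn a (h i)) {i₀ j : ι} (hi₀ : i₀ ∈ s) (hj : j ∈ s)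
    (hne : ¬ ∀ ζ ∈ halfPlane a, h j ζ = 0)
    (hmax : ∀ i ∈ s, i ≠ j → Dominates (E j) (E i))
    (hsmall : ∀ K : ℝ, ∀ᶠ x : ℝ in atTop,
      ‖∑ i ∈ s, h i x * Complex.exp (E i x)‖ ≤ Real.exp ((E i₀ x).re - K * x)) : False := by
  classical
  obtain ⟨m, c, hc, hlim⟩ := ((hh j hj).dichotomy ha).resolve_left hne
  have hexp : Tendsto (fun x : ℝ => Real.exp (-1 * x)) atTop (𝓝 0) :=
    tendsto_exp_mul_of_neg (by norm_num)
  have h1 : Tendsto (fun x : ℝ => ∑ i ∈ s, h i x * Complex.exp (E i x - E j x) *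
      Complex.exp (-(m : ℂ) * x)) atTop (𝓝 (∑ i ∈ s, if i = j then (c : ℂ) else 0)) := by
    refine tendsto_finsetSum _ fun i hi => ?_
    split_ifs with hij
    · subst hij
      simpa using hlim
    · obtain ⟨A, C, hC, hA⟩ := (hh i hi).growth ha
      refine squeeze_zero_norm' (a := fun x => C * Real.exp (-1 * x)) ?_
        (by simpa using hexp.const_mul C)
      -- The slope compensates the growth `e^(Ax)` of the coefficient and the factor `e^(-mx)`,
      -- leaving `e^(-x)`.
      filter_upwards [hmax i hi hij (A - m + 1), eventually_ge_atTop a] with x hx hxa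
      have h2 := hA x (show a ≤ ((x : ℝ) : ℂ).re by simpa using hxa)
      rw [Complex.ofReal_re] at h2
      rw [norm_mul, norm_mul, ← Complex.ofReal_neg, norm_exp_real_mul, Complex.norm_exp,
        Complex.ofReal_re, mul_assoc, ← Real.exp_add]
      calc ‖h i x‖ * Real.exp ((E i x - E j x).re + -m * x) ≤
            (C * Real.exp (A * x)) * Real.exp (-((A - m + 1) * x) + -m * x) := by
            gcongr
            rw [Complex.sub_re] at hx ⊢
            linarith
        _ = _ := by
          rw [mul_assoc, ← Real.exp_add]
          ring_nf
  rw [Finset.sum_ite_eq_of_mem' s j _ hj] at h1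
  have h0 : Tendsto (fun x : ℝ => ∑ i ∈ s, h i x * Complex.exp (E i x - E j x) *
      Complex.exp (-(m : ℂ) * x)) atTop (𝓝 0) := by
    refine squeeze_zero_norm' (a := fun x => Real.exp (-1 * x)) ?_ hexp
    have hle : ∀ᶠ x : ℝ in atTop, (E i₀ x - E j x).re ≤ 0 := by
      rcases eq_or_ne i₀ j with rfl | hij
      · simp
      · filter_upwards [hmax i₀ hi₀ hij 0] with x hx
        rw [Complex.sub_re] at hx ⊢
        linarith
    -- The value `K = 1 - m` is chosen so that, after multiplication by `e^(-E_j - mx)`, at most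
    -- `e^(-x)` is left.
    filter_upwards [hsmall (1 - m), hle] with x hx hx'
    have h2 : ∑ i ∈ s, h i x * Complex.exp (E i x - E j x) * Complex.exp (-(m : ℂ) * x) =
        (∑ i ∈ s, h i x * Complex.exp (E i x)) * (Complex.exp (-E j x) *
          Complex.exp (((-m : ℝ) : ℂ) * x)) := by
      rw [Finset.sum_mul]
      refine Finset.sum_congr rfl fun i _ => ?_
      rw [sub_eq_add_neg, Complex.exp_add]
      push_cast
      ring
    rw [h2, norm_mul, norm_mul, norm_exp_real_mul, Complex.norm_exp, Complex.ofReal_re,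
      ← Real.exp_add]
    calc _ ≤ Real.exp ((E i₀ x).re - (1 - m) * x) * Real.exp ((-E j x).re + -m * x) := by gcongr
      _ ≤ _ := by
        rw [← Real.exp_add, Real.exp_le_exp]
        rw [Complex.sub_re] at hx'
        rw [Complex.neg_re]
        linarith
  exact hc (by exact_mod_cast tendsto_nhds_unique h1 h0)

/-- Induction on the number of terms. Cancellation is possible only among exponents at bounded
distance, and such terms can be merged with a tame coefficient. The term `i₀` is never affected and
survives to the end, where one exponent dominates all others. -/
theorem false_of_isolated {ι : Type*} {a : ℝ} (ha : 0 ≤ a) {E : ι → ℂ → ℂ} {i₀ : ι} :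
    ∀ (s : Finset ι) (h : ι → ℂ → ℂ), (∀ i ∈ s, TameOn a (E i)) → (∀ i ∈ s, TameOn a (h i)) →
      i₀ ∈ s → (¬ ∀ ζ ∈ halfPlane a, h i₀ ζ = 0) →
      (∀ i ∈ s, i ≠ i₀ → ¬ RealBounded fun ζ => E i ζ - E i₀ ζ) →
      (∀ K : ℝ, ∀ᶠ x : ℝ in atTop,
        ‖∑ i ∈ s, h i x * Complex.exp (E i x)‖ ≤ Real.exp ((E i₀ x).re - K * x)) → False := by
  classical
  intro s
  induction s using Finset.strongInduction with
  | H s ih =>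
  intro h hE hh hi₀ hne hiso hsmall
  by_cases hA : ∃ i ∈ s, i ≠ i₀ ∧ ∀ ζ ∈ halfPlane a, h i ζ = 0
  · obtain ⟨i, hi, hii₀, h0⟩ := hA
    refine ih (s.erase i) (Finset.erase_ssubset hi) h
      (fun k hk => hE k (Finset.mem_of_mem_erase hk))
      (fun k hk => hh k (Finset.mem_of_mem_erase hk)) (Finset.mem_erase.2 ⟨hii₀.symm, hi₀⟩) hne
      (fun k hk => hiso k (Finset.mem_of_mem_erase hk)) fun K => ?_
    filter_upwards [hsmall K, eventually_ge_atTop a] with x hx hxa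
    rw [← Finset.add_sum_erase s _ hi,
      h0 x (show a ≤ ((x : ℝ) : ℂ).re by simpa using hxa), zero_mul, zero_add] at hx
    exact hx
  -- The term `j` is absorbed in the term `i`: its coefficient is multiplied by `exp (E j - E i)`,
  -- which is tame. Neither index is `i₀`, because the exponent of `i₀` is isolated.
  by_cases hB : ∃ i ∈ s, ∃ j ∈ s, i ≠ j ∧ RealBounded fun ζ => E j ζ - E i ζ
  · obtain ⟨i, hi, j, hj, hij, hb⟩ := hB
    have hji₀ : j ≠ i₀ := by
      rintro rfl
      refine hiso i hi hij ?_
      obtain ⟨C, hC⟩ := hb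
      exact ⟨C, hC.mono fun x hx => by rwa [norm_sub_rev]⟩
    have hii₀ : i ≠ i₀ := by
      rintro rfl
      exact hiso j hj hij.symm hb
    have hexp := ((hE j hj).sub ha (hE i hi)).exp_of_realBounded ha hb
    set h' : ι → ℂ → ℂ := Function.update h i
      fun ζ => h i ζ + h j ζ * Complex.exp (E j ζ - E i ζ) with hh'
    refine ih (s.erase j) (Finset.erase_ssubset hj) h'
      (fun k hk => hE k (Finset.mem_of_mem_erase hk)) (fun k hk => ?_)
      (Finset.mem_erase.2 ⟨hji₀.symm, hi₀⟩) ?_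
      (fun k hk => hiso k (Finset.mem_of_mem_erase hk)) fun K => ?_
    · rcases eq_or_ne k i with rfl | hki
      · rw [hh', Function.update_self]
        exact (hh k hi).add ((hh j hj).mul ha hexp)
      · rw [hh', Function.update_of_ne hki]
        exact hh k (Finset.mem_of_mem_erase hk)
    · rwa [hh', Function.update_of_ne hii₀.symm]
    · filter_upwards [hsmall K] with x hx
      have hie : i ∈ s.erase j := Finset.mem_erase.2 ⟨hij, hi⟩
      have key : ∑ k ∈ s.erase j, h' k x * Complex.exp (E k x) =
          ∑ k ∈ s, h k x * Complex.exp (E k x) := by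
        rw [← Finset.add_sum_erase s _ hj, ← Finset.add_sum_erase _ _ hie,
          ← Finset.add_sum_erase _ (fun k => h k x * Complex.exp (E k x)) hie]
        have h1 : ∑ k ∈ (s.erase j).erase i, h' k x * Complex.exp (E k x) =
            ∑ k ∈ (s.erase j).erase i, h k x * Complex.exp (E k x) := by
          refine Finset.sum_congr rfl fun k hk => ?_
          rw [hh', Function.update_of_ne (Finset.ne_of_mem_erase hk)]
        rw [h1, hh', Function.update_self, add_mul, mul_assoc, ← Complex.exp_add,
          sub_add_cancel]
        ring
      rwa [key]
  -- Now no coefficient vanishes identically and distinct exponents have unbounded difference, so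
  -- domination is total on `s`.
  · push Not at hA hB
    have htot : ∀ i ∈ s, ∀ j ∈ s, i ≠ j → Dominates (E i) (E j) ∨ Dominates (E j) (E i) :=
      fun i hi j hj hij =>
        dominates_or_of_not_realBounded ha (hE i hi) (hE j hj) (hB j hj i hi hij.symm)
    obtain ⟨j, hj, hmax⟩ := exists_dominant s ⟨i₀, hi₀⟩ htot
    refine false_of_dominant ha hh hi₀ hj ?_ hmax hsmall
    rcases eq_or_ne j i₀ with rfl | hji₀
    · exact hne
    · obtain ⟨ζ, hζ, h0⟩ := hA j hj hji₀
      exact fun h => h0 (h ζ hζ)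

theorem tameOn_of_dulac {f : ℂ → ℂ} {a : ℝ} (ha : 0 ≤ a) (han : AnalyticOnNhd ℂ f (halfPlane a))
    {P : ℕ → ℂ → ℂ} (hP : ∀ n, P n ∈ expPoly) {d : ℕ → ℝ} (hd : Tendsto d atTop atTop)
    (H : ∀ n, ∃ C : ℝ, ∀ ζ ∈ halfPlane a, ‖f ζ - P n ζ‖ ≤ C * Real.exp (-d n * ζ.re)) :
    TameOn a f := by
  refine ⟨han, fun N => ?_⟩
  obtain ⟨n, hn⟩ := (hd.eventually_ge_atTop (N : ℝ)).exists
  obtain ⟨C, hC⟩ := H n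
  refine ⟨P n, hP n, |C|, fun ζ hζ => (hC ζ hζ).trans ?_⟩
  have h0 : 0 ≤ ζ.re := ha.trans hζ
  calc C * Real.exp (-d n * ζ.re) ≤ |C| * Real.exp (-d n * ζ.re) := by
        gcongr
        exact le_abs_self C
    _ ≤ _ := by
      refine mul_le_mul_of_nonneg_left (Real.exp_le_exp.2 ?_) (abs_nonneg C)
      nlinarith

theorem sum_mem_expPoly (t : Finset ℕ) (b c : ℕ → ℝ) :
    (fun ζ : ℂ => ∑ q ∈ t, (b q : ℂ) * Complex.exp (c q * ζ)) ∈ expPoly := by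
  have h := expPoly.sum_mem (t := t) (f := fun q => b q • fun ζ : ℂ => Complex.exp (c q * ζ))
    fun q _ => expPoly.smul_mem _ (exp_mem_expPoly (c q))
  convert! h using 1
  ext ζ
  simp [Finset.sum_apply]

theorem FC0.tameOn {φ : ℂ → ℂ} (hφ : φ ∈ FC0) : ∃ a ≥ 0, TameOn a φ := by
  obtain ⟨a, ha, han, b, c, -, -, hc, H⟩ := hφ
  refine ⟨a, ha, tameOn_of_dulac ha han (fun n => sum_mem_expPoly (Finset.range n) b fun q => -c q)
    hc fun n => ?_⟩
  obtain ⟨C, hC⟩ := H n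
  exact ⟨C, fun ζ hζ => by simpa using hC ζ hζ⟩

theorem IsExponent.tameOn {e : ℂ → ℂ} {ν : ℝ} (he : IsExponent e ν) : ∃ a ≥ 0, TameOn a e := by
  obtain ⟨a, han, b, c, -, -, hc, H⟩ := he
  refine ⟨max a 0, le_max_right _ _, tameOn_of_dulac (le_max_right _ _)
    (fun ζ hζ => han ζ (halfPlane_anti (le_max_left _ _) hζ))
    (P := fun n => (ν • fun ζ : ℂ => Complex.exp ((1 : ℝ) * ζ)) +
      fun ζ : ℂ => ∑ q ∈ Finset.range n, (b q : ℂ) * Complex.exp (((1 - c q : ℝ) : ℂ) * ζ))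
    (fun n => expPoly.add_mem (expPoly.smul_mem _ (exp_mem_expPoly 1))
      (sum_mem_expPoly (Finset.range n) b fun q => 1 - c q))
    (d := fun n => c n - 1) (tendsto_atTop_add_const_right _ _ hc) fun n => ?_⟩
  obtain ⟨C, hC⟩ := H n
  refine ⟨C, fun ζ hζ => ?_⟩
  have := hC ζ (halfPlane_anti (le_max_left _ _) hζ)
  rw [sub_sub] at this
  simpa using this

/-- A coefficient is prescribed only near infinity in a domain `ln (ℂ_b⁺)`. Its defining sum is
analytic on a half plane, as Phragmén–Lindelöf requires, and agrees with it on the real axis. -/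
theorem K10.tameOn {k : ℂ → ℂ} (hk : k ∈ K10) :
    ∃ a ≥ 0, ∃ h, TameOn a h ∧ ∀ᶠ x : ℝ in atTop, k x = h x := by
  obtain ⟨n, l, φ, H, b, hb, hk⟩ := hk
  choose a ha hφ using fun i => FC0.tameOn (H i).2
  have ha' : 0 ≤ ∑ i, a i := Finset.sum_nonneg fun i _ => ha i
  refine ⟨∑ i, a i, ha', fun ζ => ∑ i, Complex.exp ((l i : ℂ) * ζ) * φ i ζ,
    TameOn.sum _ fun i _ => (tameOn_of_mem_expPoly (exp_mem_expPoly (l i)) _).mul ha'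
      ((hφ i).mono (Finset.single_le_sum (fun j _ => ha j) (Finset.mem_univ i))), ?_⟩
  filter_upwards [eventually_ofReal_mem_lnHalfPlane hb] with x hx
  exact hk x hx

/-! ### The coefficients of the expansion of `gam 1` -/

theorem coeff_logSeries_X (m : ℕ) :
    (logSeries PowerSeries.X).coeff m = Polynomial.C ((-1) ^ (m + 1) / (m : ℝ)) := by
  rw [logSeries, PowerSeries.coeff_mk, map_sum, Finset.sum_eq_single_of_mem m (by simp)]
  · simp [PowerSeries.coeff_C_mul, PowerSeries.coeff_X_pow]
  · intro j _ hj
    simp [PowerSeries.coeff_C_mul, PowerSeries.coeff_X_pow, hj.symm]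

/-- With `u = -s⁻¹ ell s`, the power `u^j` is divisible by `s^(-j)`. To first order in `s⁻¹` the
logarithm `log (1 + u)` is `u`, and the expansion of `ell` can be read off. -/
theorem coeff_one_coeff_gamSeries_zero {m : ℕ} (hm : 1 ≤ m) :
    ((gamSeries 0).coeff m).coeff 1 = (-1) ^ m / (m : ℝ) := by
  have hU : PowerSeries.C (Polynomial.C (-1)) *
      (PowerSeries.C Polynomial.X * logSeries PowerSeries.X) =
      PowerSeries.C (Polynomial.C (-1) * Polynomial.X : Polynomial ℝ) *
        logSeries PowerSeries.X := by
    rw [map_mul, mul_assoc]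
  rw [gamSeries, logSeries, PowerSeries.coeff_mk, map_sum, Polynomial.finsetSum_coeff,
    Finset.sum_eq_single_of_mem 1 (by simp; omega)]
  · rw [hU, pow_one, PowerSeries.coeff_C_mul, PowerSeries.coeff_C_mul, coeff_logSeries_X,
      Polynomial.coeff_C_mul, mul_assoc, Polynomial.coeff_C_mul, Polynomial.coeff_X_mul,
      Polynomial.coeff_C_zero]
    push_cast
    ring
  · intro j _ hj
    rw [hU, mul_pow, ← map_pow, PowerSeries.coeff_C_mul, PowerSeries.coeff_C_mul, mul_pow,
      ← map_pow, Polynomial.coeff_C_mul, mul_assoc, Polynomial.coeff_C_mul]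
    rcases Nat.eq_zero_or_pos j with rfl | hj0
    · simp
    · rw [Polynomial.coeff_X_pow_mul', if_neg (by omega)]
      simp

/-- Differentiation of `e^(-ms)` contributes the factor `-m`, while differentiation of the
coefficients starts at `s⁻²`. The coefficient of `s⁻¹` in the derivative is therefore `-m · (-1)^m /
m`, and multiplication by `1/(2s)` cannot annihilate it. -/
theorem coeff_gamSeries_one_ne_zero {m : ℕ} (hm : 1 ≤ m) : (gamSeries 1).coeff m ≠ 0 := by
  intro h
  have hm0 : (m : ℝ) ≠ 0 := by positivity
  rw [gamSeries, ← map_mul, PowerSeries.coeff_mul_C, derivSeries, PowerSeries.coeff_mk] at h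
  have h1 := (mul_eq_zero.1 h).resolve_right (mul_ne_zero (by simp) Polynomial.X_ne_zero)
  have h2 := congrArg (fun P => Polynomial.coeff P 1) h1
  simp only [Polynomial.coeff_sub, Polynomial.coeff_zero] at h2
  rw [neg_mul, Polynomial.coeff_neg, Polynomial.coeff_C_mul, Polynomial.coeff_X_pow_mul',
    if_neg (by norm_num), coeff_one_coeff_gamSeries_zero hm] at h2
  field_simp at h2
  simp at h2

/-! ### Coefficients outside `K_{1,0}` -/

/-- The exponents of the expansion of the leading part of `shiftTerm ∘ exp`. -/
noncomputable def leadExponent (m : ℕ) (ζ : ℂ) : ℂ :=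
  -Complex.exp ζ - m * Complex.exp (((1 / 2 : ℝ) : ℂ) * ζ)

/-- The coefficients of the expansion of the leading part of `shiftTerm ∘ exp`. -/
noncomputable def leadCoeff (m : ℕ) (ζ : ℂ) : ℂ :=
  Polynomial.aeval (Complex.exp (((1 / 2 : ℝ) : ℂ) * ζ))⁻¹ ((gamSeries 1).coeff m)

theorem leadExponent_mem (m : ℕ) : leadExponent m ∈ expPoly := by
  have h := expPoly.sub_mem (expPoly.smul_mem (-1 : ℝ) (exp_mem_expPoly 1))
    (expPoly.smul_mem (m : ℝ) (exp_mem_expPoly (1 / 2)))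
  convert! h using 1
  ext ζ
  simp [leadExponent]

theorem leadCoeff_mem (m : ℕ) : leadCoeff m ∈ expPoly := by
  convert! sum_mem_expPoly (Finset.range (((gamSeries 1).coeff m).natDegree + 1))
    (fun i => ((gamSeries 1).coeff m).coeff i) (fun i => -(i / 2)) using 1
  ext ζ
  rw [leadCoeff, Polynomial.aeval_eq_sum_range]
  refine Finset.sum_congr rfl fun i _ => ?_
  rw [← Complex.exp_neg, ← Complex.exp_nat_mul, Complex.real_smul]
  congr 2
  push_cast
  ring

theorem leadCoeff_not_zero {m : ℕ} (hm : 1 ≤ m) (a : ℝ) :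
    ¬ ∀ ζ ∈ halfPlane a, leadCoeff m ζ = 0 := by
  intro h
  refine coeff_gamSeries_one_ne_zero hm (Polynomial.eq_zero_of_infinite_isRoot _ ?_)
  have hinj : Function.Injective fun x : ℝ => (Real.exp (1 / 2 * x))⁻¹ := fun x y hxy => by
    have := Real.exp_injective (inv_injective hxy)
    linarith
  refine ((Ici_infinite a).image hinj.injOn).mono ?_
  rintro _ ⟨x, hx, rfl⟩
  have h1 := h x (show a ≤ ((x : ℝ) : ℂ).re by simpa using hx)
  rw [leadCoeff, ← Complex.ofReal_mul, ← Complex.ofReal_exp, ← Complex.ofReal_inv] at h1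
  have h2 : Polynomial.aeval (algebraMap ℝ ℂ (Real.exp (1 / 2 * x))⁻¹) ((gamSeries 1).coeff m) = 0 := h1
  rw [Polynomial.aeval_algebraMap_apply] at h2
  have h3 : ((Polynomial.aeval (Real.exp (1 / 2 * x))⁻¹ ((gamSeries 1).coeff m) : ℝ) : ℂ) = 0 := h2
  change Polynomial.eval _ _ = 0
  have h4 := Complex.ofReal_eq_zero.1 h3
  rwa [Polynomial.coe_aeval_eq_eval] at h4

theorem leadExponent_not_realBounded {m m' : ℕ} (h : m ≠ m') :
    ¬ RealBounded fun ζ => leadExponent m ζ - leadExponent m' ζ := by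
  refine not_realBounded_of_tendsto (m := 1 / 2) (c := (m' : ℝ) - m) (by norm_num)
    (sub_ne_zero.2 (by exact_mod_cast h.symm)) ?_
  refine tendsto_const_nhds.congr fun x => ?_
  have h1 : Complex.exp (((1 / 2 : ℝ) : ℂ) * x) * Complex.exp (-((1 / 2 : ℝ) : ℂ) * x) = 1 := by
    rw [← Complex.exp_add]
    simp
  simp only [leadExponent]
  push_cast at h1 ⊢
  linear_combination -((m' : ℂ) - m) * h1

/-- Pigeonhole: otherwise one `e q` is at bounded distance from two different `leadExponent m`,
whose mutual distance is unbounded. -/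
theorem exists_inequivalent {N : ℕ} (e : ℕ → ℂ → ℂ) : ∃ m : ℕ, 1 ≤ m ∧ ∀ q < N,
    ¬ RealBounded fun ζ => e q ζ - leadExponent m ζ := by
  by_contra! h
  choose! f hf hb using h
  obtain ⟨m, m', hne, heq⟩ := Finite.exists_ne_map_eq_of_infinite
    (fun m : ℕ => (⟨f (m + 1), hf (m + 1) (by omega)⟩ : Fin N))
  have heq : f (m + 1) = f (m' + 1) := by simpa using heq
  obtain ⟨C, hC⟩ := hb (m + 1) (by omega)
  obtain ⟨D, hD⟩ := hb (m' + 1) (by omega)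
  refine leadExponent_not_realBounded (show m + 1 ≠ m' + 1 by omega) ⟨C + D, ?_⟩
  filter_upwards [hC, hD] with x hx hx'
  rw [← heq] at hx'
  have key : leadExponent (m + 1) x - leadExponent (m' + 1) x =
      (e (f (m + 1)) x - leadExponent (m' + 1) x) - (e (f (m + 1)) x - leadExponent (m + 1) x) := by
    ring
  rw [key]
  exact (norm_sub_le _ _).trans ((add_le_add hx' hx).trans (add_comm D C).le)

theorem ell_sub_exp_bound : ∃ C ≥ 0, ∀ᶠ X : ℝ in atTop,
    ‖ell X - Complex.exp (-X)‖ ≤ C * Real.exp (-2 * X) := by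
  obtain ⟨a, -, -, H⟩ := hasExp_ell.approx
  obtain ⟨C, hC⟩ := H 2
  refine ⟨|C|, abs_nonneg C, ?_⟩
  filter_upwards [eventually_ge_atTop a] with X hX
  have := hC X (show a ≤ ((X : ℝ) : ℂ).re by simpa using hX)
  simp only [Finset.sum_range_succ, Finset.sum_range_zero, coeff_logSeries_X] at this
  simp at this
  refine this.trans ?_
  rw [neg_mul]
  gcongr
  exact le_abs_self C

theorem gamSqrt_one_approx (M : ℕ) : ∃ C ≥ 0, ∀ᶠ x : ℝ in atTop,
    ‖gamSqrt 1 (Real.exp x : ℝ)‖ ≤ C ∧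
    ‖gamSqrt 1 (Real.exp x : ℝ) - ∑ m ∈ Finset.range M, leadCoeff m x *
      Complex.exp (-m * Complex.exp (((1 / 2 : ℝ) : ℂ) * x))‖ ≤
        C * Real.exp (-M * Real.exp (1 / 2 * x)) := by
  obtain ⟨a, -, -, H⟩ := (hasExp_gam 1).approx
  obtain ⟨C, hC⟩ := H M
  obtain ⟨D, hD⟩ := H 0
  refine ⟨max |C| |D|, (abs_nonneg C).trans (le_max_left _ _), ?_⟩
  have hlim : Tendsto (fun x : ℝ => Real.exp (1 / 2 * x)) atTop atTop :=
    Real.tendsto_exp_atTop.comp (tendsto_id.const_mul_atTop (by norm_num))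
  filter_upwards [hlim.eventually_ge_atTop a] with x hx
  have hs : csqrt (Real.exp x : ℝ) = Complex.exp (((1 / 2 : ℝ) : ℂ) * x) := by
    have := csqrt_exp (1 / 2 * x)
    rw [show 2 * (1 / 2 * x) = x by ring] at this
    rw [this, Complex.ofReal_exp, Complex.ofReal_mul]
  have hre : (Complex.exp (((1 / 2 : ℝ) : ℂ) * x)).re = Real.exp (1 / 2 * x) := by
    rw [← Complex.ofReal_mul, ← Complex.ofReal_exp, Complex.ofReal_re]
  have hmem : Complex.exp (((1 / 2 : ℝ) : ℂ) * x) ∈ halfPlane a := by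
    change a ≤ _
    rwa [hre]
  have h1 := hC _ hmem
  have h2 := hD _ hmem
  rw [gamSqrt, hs]
  rw [hre] at h1
  refine ⟨?_, h1.trans ?_⟩
  · refine le_trans ?_ ((le_abs_self D).trans (le_max_right _ _))
    simpa using h2
  · gcongr
    exact (le_abs_self C).trans (le_max_left _ _)

theorem shiftTerm_lead_approx : ∃ C ≥ 0, ∀ᶠ X : ℝ in atTop,
    ‖shiftTerm X + gamSqrt 1 X * ell X‖ ≤ C * Real.exp (-2 * X) := by
  obtain ⟨b, -, C, hC⟩ := shiftTerm_taylor 1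
  refine ⟨|C|, abs_nonneg C, ?_⟩
  filter_upwards [eventually_ge_atTop b] with X hX
  have := hC X (show b ≤ ((X : ℝ) : ℂ).re by simpa using hX)
  rw [Complex.ofReal_re, Finset.sum_range_one] at this
  have h1 : shiftTerm X + gamSqrt 1 X * ell X =
      shiftTerm X - gamSqrt (0 + 1) X * ((-ell X) ^ (0 + 1) / ((0 + 1).factorial : ℂ)) := by
    simp
  rw [h1]
  refine this.trans ?_
  have h2 : -((1 + 1 : ℕ) : ℝ) * X = -2 * X := by norm_num
  rw [h2]
  exact mul_le_mul_of_nonneg_right (le_abs_self C) (Real.exp_pos _).le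

theorem ofReal_exp_half (x : ℝ) :
    Complex.exp (((1 / 2 : ℝ) : ℂ) * x) = (Real.exp (1 / 2 * x) : ℝ) := by
  push_cast
  rfl

theorem leadExponent_ofReal (m : ℕ) (x : ℝ) :
    leadExponent m x = ((-Real.exp x - m * Real.exp (1 / 2 * x) : ℝ) : ℂ) := by
  rw [leadExponent, ofReal_exp_half]
  push_cast
  rfl

theorem exp_half_sq (x : ℝ) : Real.exp (1 / 2 * x) ^ 2 = Real.exp x := by
  rw [← Real.exp_nat_mul]
  push_cast
  ring_nf

theorem tendsto_exp_half : Tendsto (fun x : ℝ => Real.exp (1 / 2 * x)) atTop atTop :=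
  Real.tendsto_exp_atTop.comp (tendsto_id.const_mul_atTop (by norm_num))

/-- Up to `O(e^(-2X))` the function is `-gamSqrt 1 X · e^(-X)`, and `gamSqrt 1` is expanded in
powers of `e^(-√X)`. Once `√X ≥ M`, the error `e^(-2X)` is below `e^(-X - M√X)`. -/
theorem shiftTerm_add_lead_bound (M : ℕ) : ∃ D ≥ 0, ∀ᶠ x : ℝ in atTop,
    ‖shiftTerm (Real.exp x : ℝ) +
      ∑ m ∈ Finset.range M, leadCoeff m x * Complex.exp (leadExponent m x)‖ ≤
        D * Real.exp (-Real.exp x - M * Real.exp (1 / 2 * x)) := by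
  obtain ⟨C₁, hC₁, h₁⟩ := shiftTerm_lead_approx
  obtain ⟨C₂, hC₂, h₂⟩ := ell_sub_exp_bound
  obtain ⟨C₃, hC₃, h₃⟩ := gamSqrt_one_approx M
  refine ⟨C₁ + C₃ * C₂ + C₃, by positivity, ?_⟩
  filter_upwards [Real.tendsto_exp_atTop.eventually h₁, Real.tendsto_exp_atTop.eventually h₂, h₃,
    tendsto_exp_half.eventually_ge_atTop (M : ℝ)] with x h₁ h₂ h₃ hM
  have hsq := exp_half_sq x
  set s := Real.exp (1 / 2 * x) with hs
  set X := Real.exp x with hX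
  have hs0 : 0 < s := Real.exp_pos _
  have hle : Real.exp (-2 * X) ≤ Real.exp (-X - M * s) := by
    rw [Real.exp_le_exp]
    nlinarith
  have key : shiftTerm (X : ℝ) +
      ∑ m ∈ Finset.range M, leadCoeff m x * Complex.exp (leadExponent m x) =
      (shiftTerm X + gamSqrt 1 X * ell X) - gamSqrt 1 X * (ell X - Complex.exp (-X)) -
      (gamSqrt 1 X - ∑ m ∈ Finset.range M, leadCoeff m x *
        Complex.exp (-m * Complex.exp (((1 / 2 : ℝ) : ℂ) * x))) * Complex.exp (-X) := by
    have h4 : ∑ m ∈ Finset.range M, leadCoeff m x * Complex.exp (leadExponent m x) =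
        (∑ m ∈ Finset.range M, leadCoeff m x *
          Complex.exp (-m * Complex.exp (((1 / 2 : ℝ) : ℂ) * x))) * Complex.exp (-X) := by
      rw [Finset.sum_mul]
      refine Finset.sum_congr rfl fun m _ => ?_
      rw [mul_assoc, ← Complex.exp_add, leadExponent, hX, Complex.ofReal_exp]
      congr 2
      ring
    rw [h4]
    ring
  rw [key]
  have e1 : ‖shiftTerm X + gamSqrt 1 X * ell X‖ ≤ C₁ * Real.exp (-X - M * s) :=
    h₁.trans (by gcongr)
  have e2 : ‖gamSqrt 1 X * (ell X - Complex.exp (-X))‖ ≤ C₃ * C₂ * Real.exp (-X - M * s) := by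
    rw [norm_mul, mul_assoc]
    exact mul_le_mul h₃.1 (h₂.trans (by gcongr)) (norm_nonneg _) hC₃
  have e3 : ‖(gamSqrt 1 X - ∑ m ∈ Finset.range M, leadCoeff m x *
        Complex.exp (-m * Complex.exp (((1 / 2 : ℝ) : ℂ) * x))) * Complex.exp (-X)‖ ≤
        C₃ * Real.exp (-X - M * s) := by
    rw [norm_mul, ← Complex.ofReal_neg, Complex.norm_exp, Complex.ofReal_re]
    refine (mul_le_mul_of_nonneg_right h₃.2 (Real.exp_pos _).le).trans (le_of_eq ?_)
    rw [mul_assoc, ← Real.exp_add]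
    ring_nf
  refine (norm_sub_le _ _).trans ?_
  rw [add_mul, add_mul]
  exact add_le_add ((norm_sub_le _ _).trans (add_le_add e1 e2)) e3

/-- Every STAR-series of `shiftTerm ∘ exp` has a coefficient outside `K_{1,0}`. -/
theorem exists_coeff_not_mem_K10 {Z : Set ℂ} (hZ : range ((↑) : ℝ → ℂ) ⊆ Z) {ψ : ℂ → ℂ}
    (hψ : ∀ᶠ x : ℝ in atTop, ψ (Complex.exp x) = shiftTerm (Real.exp x : ℝ))
    {k e : ℕ → ℂ → ℂ} {ν : ℕ → ℝ} (H : HasStarSeries Z ψ k e ν) : ∃ q, k q ∉ K10 := by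
  by_contra! hk
  obtain ⟨he, -, -, happ⟩ := H
  -- The rate has to exceed `1`, so that the error of the truncation is below `e^(-X - m√X)` for
  -- every `m`.
  obtain ⟨N, hN⟩ := happ (3 / 2) (by norm_num)
  obtain ⟨b, hb, happ⟩ := hN N le_rfl
  obtain ⟨m₀, hm₀, hiso⟩ := exists_inequivalent (N := N) e
  obtain ⟨D, hD, hlead⟩ := shiftTerm_add_lead_bound (m₀ + 1)
  choose a ha hta using fun q => (he q).tameOn
  choose a' ha' h hth hkh using fun q => K10.tameOn (hk q)
  set A := ∑ q ∈ Finset.range N, (a q + a' q) with hA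
  have hA0 : 0 ≤ A := Finset.sum_nonneg fun q _ => add_nonneg (ha q) (ha' q)
  have hle : ∀ q ∈ Finset.range N, a q + a' q ≤ A := fun q hq =>
    Finset.single_le_sum (f := fun q => a q + a' q) (fun j _ => add_nonneg (ha j) (ha' j)) hq
  -- The truncated STAR-series and the negative of the truncated lead expansion both approximate
  -- `shiftTerm`. Their difference, a sum over the disjoint union, is much smaller than its term
  -- `m₀`.
  set E : ℕ ⊕ ℕ → ℂ → ℂ := Sum.elim e leadExponent with hEdef
  set c : ℕ ⊕ ℕ → ℂ → ℂ := Sum.elim h leadCoeff with hcdef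
  set s : Finset (ℕ ⊕ ℕ) := (Finset.range N).disjSum (Finset.range (m₀ + 1)) with hs
  refine false_of_isolated (E := E) (i₀ := Sum.inr m₀) hA0 s c ?_ ?_ ?_ (leadCoeff_not_zero hm₀ A)
    ?_ fun K => ?_
  · rintro (q | m) hi
    · have hq : q ∈ Finset.range N := Finset.inl_mem_disjSum.1 hi
      exact (hta q).mono (by linarith [hle q hq, ha' q])
    · exact tameOn_of_mem_expPoly (leadExponent_mem m) A
  · rintro (q | m) hi
    · have hq : q ∈ Finset.range N := Finset.inl_mem_disjSum.1 hi
      exact (hth q).mono (by linarith [hle q hq, ha q])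
    · exact tameOn_of_mem_expPoly (leadCoeff_mem m) A
  · exact Finset.inr_mem_disjSum.2 (by simp)
  · rintro (q | m) hi hne
    · exact hiso q (Finset.mem_range.1 (Finset.inl_mem_disjSum.1 hi))
    · exact leadExponent_not_realBounded fun h => hne (by rw [h])
  · have hkh' : ∀ᶠ x : ℝ in atTop, ∀ q ∈ Finset.range N, k q x = h q x :=
      (Finset.range N).eventually_all.2 fun q _ => hkh q
    filter_upwards [hψ, hlead, hkh', eventually_ofReal_mem_lnHalfPlane hb,
      tendsto_exp_half.eventually_ge_atTop (2 * (m₀ + 1 : ℕ) : ℝ),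
      -- The additional factor `e^(-√X)` in the error beats `e^(-(K+1)x)`; one unit of the slope is
      -- spent on absorbing the constant `1 + D` in `e^x`.
      eventually_mul_le_exp (K + 1) one_pos (show (0 : ℝ) < 1 / 2 by norm_num),
      Real.tendsto_exp_atTop.eventually_ge_atTop (1 + D)] with x h1 h2 h3 h4 h5 h6 h7
    have h8 := happ x ⟨h4, hZ (mem_range_self x)⟩
    rw [h1, ← Complex.ofReal_exp, Complex.ofReal_re] at h8
    have hsq := exp_half_sq x
    rw [one_mul] at h6
    have hsum : ∑ i ∈ s, c i x * Complex.exp (E i x) =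
        ∑ q ∈ Finset.range N, k q x * Complex.exp (e q x) +
        ∑ m ∈ Finset.range (m₀ + 1), leadCoeff m x * Complex.exp (leadExponent m x) := by
      rw [hs, Finset.sum_disjSum]
      congr 1
      exact Finset.sum_congr rfl fun q hq => by rw [h3 q hq]; rfl
    have hre : (E (Sum.inr m₀) x).re = -Real.exp x - m₀ * Real.exp (1 / 2 * x) := by
      change (leadExponent m₀ x).re = _
      rw [leadExponent_ofReal, Complex.ofReal_re]
    rw [hsum, hre]
    set t := Real.exp (1 / 2 * x) with ht
    set X := Real.exp x with hX
    have ht0 : 0 < t := Real.exp_pos _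
    have hfirst : Real.exp (-(3 / 2) * X) ≤ Real.exp (-X - (m₀ + 1 : ℕ) * t) := by
      rw [Real.exp_le_exp]
      nlinarith
    have key : ∑ q ∈ Finset.range N, k q x * Complex.exp (e q x) +
        ∑ m ∈ Finset.range (m₀ + 1), leadCoeff m x * Complex.exp (leadExponent m x) =
        (shiftTerm (X : ℝ) + ∑ m ∈ Finset.range (m₀ + 1), leadCoeff m x *
          Complex.exp (leadExponent m x)) -
        (shiftTerm (X : ℝ) - ∑ q ∈ Finset.range N, k q x * Complex.exp (e q x)) := by ring
    rw [key]
    calc _ ≤ D * Real.exp (-X - (m₀ + 1 : ℕ) * t) + Real.exp (-X - (m₀ + 1 : ℕ) * t) :=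
          (norm_sub_le _ _).trans (add_le_add h2 (h8.trans hfirst))
      _ = (1 + D) * Real.exp (-X - (m₀ + 1 : ℕ) * t) := by ring
      _ ≤ Real.exp x * Real.exp (-X - (m₀ + 1 : ℕ) * t) := by gcongr
      _ ≤ _ := by
        rw [← Real.exp_add, Real.exp_le_exp]
        push_cast
        linarith

/-! ### Membership of the term of the expansion -/

/-- Since `ζ = log x / 2` inverts `x = e^(2ζ)` near infinity, the germ `ψ` in `D = ψ ∘ exp ∘ m₂` is
determined by `D`. -/
theorem eventually_exp_two_mul {p : ℝ → Prop} :
    (∀ᶠ ζ : ℝ in atTop, p (Real.exp (2 * ζ))) ↔ ∀ᶠ x in atTop, p x := by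
  constructor
  · intro h
    have hlim : Tendsto (fun x => Real.log x / 2) atTop atTop :=
      Real.tendsto_log_atTop.atTop_div_const two_pos
    filter_upwards [hlim.eventually h, eventually_gt_atTop 0] with x hx h0
    rwa [mul_div_cancel₀ _ two_ne_zero, Real.exp_log h0] at hx
  · intro h
    exact (Real.tendsto_exp_atTop.comp (tendsto_id.const_mul_atTop two_pos)).eventually h

theorem eventually_eq_shiftTerm {ψ : ℂ → ℂ}
    (h : ∀ᶠ ζ : ℝ in atTop, (expansionTerm ζ : ℂ) = ψ (Real.exp (2 * ζ))) :
    ∀ᶠ x : ℝ in atTop, ψ x = shiftTerm x := by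
  rw [← eventually_exp_two_mul (p := fun x => ψ x = shiftTerm x)]
  filter_upwards [h, ofReal_expansionTerm] with ζ h1 h2
  rw [← h1, h2]

theorem exists_coeff_not_mem_of_expansionTerm {Z : Set ℂ} (hZ : range ((↑) : ℝ → ℂ) ⊆ Z)
    {ψ : ℂ → ℂ} (hψ : ∀ᶠ ζ : ℝ in atTop, (expansionTerm ζ : ℂ) = ψ (Real.exp (2 * ζ)))
    {k e : ℕ → ℂ → ℂ} {ν : ℕ → ℝ} (H : HasStarSeries Z ψ k e ν) : ∃ q, k q ∉ K1 Z 0 := by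
  refine exists_coeff_not_mem_K10 hZ ?_ H
  filter_upwards [Real.tendsto_exp_atTop.eventually (eventually_eq_shiftTerm hψ)] with x hx
  rw [← hx, Complex.ofReal_exp]

theorem mem_realGerms_FC1_one (Z : Set ℂ) {ψ : ℝ → ℝ}
    (h : ∀ᶠ ζ in atTop, expansionTerm ζ = ψ (Real.exp (2 * ζ))) : ψ ∈ realGerms (FC1 Z 1) := by
  refine ⟨shiftTerm, shiftTerm_mem_FC1 Z, ?_⟩
  rw [← eventually_exp_two_mul (p := fun x => (ψ x : ℂ) = shiftTerm x)]
  filter_upwards [h, ofReal_expansionTerm] with ζ h1 h2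
  rw [← h1, h2]

theorem not_mem_realGerms_FC1_zero {Z : Set ℂ} (hZ : range ((↑) : ℝ → ℂ) ⊆ Z) {ψ : ℝ → ℝ}
    (h : ∀ᶠ ζ in atTop, expansionTerm ζ = ψ (Real.exp (2 * ζ))) : ψ ∉ realGerms (FC1 Z 0) := by
  rintro ⟨χ, hχ, hev⟩
  obtain ⟨-, -, k, e, ν, hk, H⟩ := hχ
  rw [← eventually_exp_two_mul] at hev
  obtain ⟨q, hq⟩ := exists_coeff_not_mem_of_expansionTerm hZ (ψ := χ) (by
    filter_upwards [h, hev] with ζ h1 h2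
    rw [h1, h2]) H
  exact hq (hk q)

theorem expansionTerm_mem (Z : Set ℂ) : expansionTerm ∈ compExp (realGerms (FC1 Z 1)) 2 := by
  have h : ∀ᶠ ζ in atTop, expansionTerm ζ =
      (fun x => expansionTerm (Real.log x / 2)) (Real.exp (2 * ζ)) :=
    Eventually.of_forall fun ζ => by simp
  exact ⟨fun x => expansionTerm (Real.log x / 2), mem_realGerms_FC1_one Z h, h⟩

theorem expansionTerm_not_mem {Z : Set ℂ} (hZ : range ((↑) : ℝ → ℂ) ⊆ Z) :
    expansionTerm ∉ compExp (realGerms (FC1 Z 0)) 2 := by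
  rintro ⟨ψ, hψ, h⟩
  exact not_mem_realGerms_FC1_zero hZ h hψ

theorem log_one_add_exp_neg_mem_FC0 :
    (fun ζ => -Complex.log (1 + Complex.exp (-ζ))) ∈ FC0 := by
  obtain ⟨a, ha, han, H⟩ := hasExp_ell.approx
  refine ⟨a, by linarith, fun ζ hζ => (han ζ hζ).neg, fun q => -((-1) ^ (q + 2) / (q + 1 : ℝ)),
    fun q => q + 1, by norm_num, fun i j h => by simpa using h,
    tendsto_atTop_add_const_right _ _ tendsto_natCast_atTop_atTop, fun N => ?_⟩
  -- The expansion of `ell` starts at `e^(-ζ)` and the Dulac exponents are `q + 1`, so `N` Dulac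
  -- terms correspond to the order `N + 1`.
  obtain ⟨C, hC⟩ := H (N + 1)
  refine ⟨C, fun ζ hζ => ?_⟩
  have := hC ζ hζ
  rw [Finset.sum_range_succ'] at this
  simp only [coeff_logSeries_X, Polynomial.aeval_C, Complex.coe_algebraMap] at this
  rw [← norm_neg]
  convert! this using 2
  · rw [neg_sub, sub_neg_eq_add, add_comm, ell, ← sub_neg_eq_add, ← Finset.sum_neg_distrib]
    congr 1
    rw [show ((0 + 1 : ℕ)) = 1 from rfl]
    simp
  · push_cast
    rfl

theorem logChart_gluingMap_mem : logChart gluingMap ∈ realGerms classH := by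
  refine ⟨fun ζ => ζ + -Complex.log (1 + Complex.exp (-ζ)), ?_, Eventually.of_forall fun x => ?_⟩
  · change (fun ζ : ℂ => ζ + -Complex.log (1 + Complex.exp (-ζ)) - ζ) ∈ FC0
    simpa using log_one_add_exp_neg_mem_FC0
  · have := ofReal_ell x
    rw [ell] at this
    beta_reduce
    rw [logChart_gluingMap, this, Complex.ofReal_sub, sub_eq_add_neg]

/-- The map `f^log` belongs to `𝓗`, which puts `g` at level `1`. Conjugation by `m₂` puts `B` at
level `2`, and the expansion rule applies to `g ∘ B` because `1 < 2`. -/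
theorem ExpansionFramework.expansionTerm_mem {F : Set (ℝ → ℝ)} (hF : ExpansionFramework F) :
    expansionTerm ∈ compExp F 2 := by
  have h1 : innerMap ∈ idAddCompExp F 1 := hF.conjExp_mem _ logChart_gluingMap_mem
  have h2 : conjugatedMap ∈ idAddCompExp F 2 := by
    have := hF.affine_conj 2 two_pos 0 1 one_pos innerMap h1
    rw [one_mul] at this
    convert! this using 1
    ext ζ
    change 2⁻¹ * innerMap (2 * ζ) = _
    rw [add_zero, sub_zero]
    ring
  exact hF.expand 2 1 one_pos one_lt_two (fun ζ => innerMap ζ - ζ) h1 conjugatedMap h2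

/-! ### The theorem -/

theorem mainTheorem2 :
    (∃ (M : Type) (_ : TopologicalSpace M) (_ : T2Space M) (_ : SecondCountableTopology M)
        (_ : ChartedSpace (ℝ × ℝ) M) (_ : IsManifold 𝓘(ℝ, ℝ × ℝ) ω M)
        (V : (x : M) → TangentSpace 𝓘(ℝ, ℝ × ℝ) x) (P : SimpleAlternantPolycycle V 4)
        (entry exit : Fin 4 → ℝ → M) (Δ : ℝ → ℝ),
      IsAnalyticField V ∧
      (∀ i, IsSection V (P.chart i) (P.connection i) (exit i)) ∧
      (∀ i, IsSection V (P.chart (i + 1)) (P.connection i) (entry (i + 1))) ∧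
      IsTransitMap V P.carrier (exit 3) (entry 0) (fun z => z) ∧
      IsTransitMap V P.carrier (entry 0) (exit 0) (fun z => Real.exp (-(1 / z ^ 2))) ∧
      IsTransitMap V P.carrier (exit 0) (entry 1) gluingMap ∧
      IsTransitMap V P.carrier (entry 1) (exit 1) (fun z => (1 / -Real.log z) ^ (1 / 2 : ℝ)) ∧
      IsTransitMap V P.carrier (exit 1) (entry 2) (fun z => z) ∧
      IsTransitMap V P.carrier (entry 2) (exit 2) (fun z => Real.exp (-(1 / z))) ∧
      IsTransitMap V P.carrier (exit 2) (entry 3) gluingMap ∧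
      IsTransitMap V P.carrier (entry 3) (exit 3) (fun z => 1 / -Real.log z) ∧
      IsTransitMap V P.carrier (exit 3) (exit 3) Δ ∧
      logChart Δ =ᶠ[atTop] logReturnMap) ∧
    ¬ (logReturnMap =ᶠ[atTop] id) ∧
    (∀ Z : Set ℂ, range ((↑) : ℝ → ℂ) ⊆ Z →
      expansionTerm ∈ compExp (realGerms (FC1 Z 1)) 2 ∧
      expansionTerm ∉ compExp (realGerms (FC1 Z 0)) 2 ∧
      (∀ F : Set (ℝ → ℝ), ExpansionFramework F →
        ∃ ψ ∈ F, (∀ᶠ ζ in atTop, expansionTerm ζ = ψ (Real.exp (2 * ζ))) ∧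
          ψ ∈ realGerms (FC1 Z 1) ∧ ψ ∉ realGerms (FC1 Z 0)) ∧
      (∀ ψ : ℂ → ℂ, (∀ᶠ ζ : ℝ in atTop, (expansionTerm ζ : ℂ) = ψ (Real.exp (2 * ζ))) →
        ∀ (k e : ℕ → ℂ → ℂ) (ν : ℕ → ℝ), HasStarSeries Z ψ k e ν → ∃ q, k q ∉ K1 Z 0) ∧
      (∀ p, ∀ k₁ ∈ K1 Z p, ∀ k₂ ∈ K1 Z p, ∀ (e₁ e₂ : ℂ → ℂ) (ν₁ ν₂ : ℝ),
        IsExponent e₁ ν₁ → IsExponent e₂ ν₂ →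
        (DivideDifferentiate Z p k₁ e₁ k₂ e₂ ↔
          (fun ζ => deriv k₂ ζ * k₁ ζ - deriv k₁ ζ * k₂ ζ +
            k₂ ζ * k₁ ζ * (deriv e₂ ζ - deriv e₁ ζ)) ∈ K1 Z p)) ∧
      (∀ k₁ ∈ K1 Z 1, ∀ k₂ ∈ K1 Z 1, ∀ (e : ℂ → ℂ) (ν : ℝ), IsExponent e ν →
        (DivideDifferentiate Z 1 k₁ e k₂ e ↔
          (fun ζ => deriv k₂ ζ * k₁ ζ - deriv k₁ ζ * k₂ ζ) ∈ K1 Z 1))) := by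
  refine ⟨exists_polycycle, logReturnMap_not_eventuallyEq_id, fun Z hZ =>
    ⟨expansionTerm_mem Z, expansionTerm_not_mem hZ, fun F hF => ?_,
      fun ψ hψ k e ν H => exists_coeff_not_mem_of_expansionTerm hZ hψ H,
      fun p k₁ hk₁ k₂ hk₂ e₁ e₂ ν₁ ν₂ he₁ he₂ => divideDifferentiate_iff hk₁ hk₂ he₁ he₂,
      fun k₁ hk₁ k₂ hk₂ e ν he => divideDifferentiate_self_iff hk₁ hk₂ he⟩⟩
  obtain ⟨ψ, hψ, h⟩ := hF.expansionTerm_mem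
  exact ⟨ψ, hψ, h, mem_realGerms_FC1_one Z h, not_mem_realGerms_FC1_zero hZ h⟩
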